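/- Work over $\mathbb{C}$, and let $\mathbb{P}(E)$ denote the projective bundle of hyperplanes in the fibres of a vector bundle $E$. For a smooth projective variety $X$ let $N_1(X)$ be the real vector space of $1$-cycles with real coefficients modulo numerical equivalence, $\overline{NE}(X) \subset N_1(X)$ the closure of the convex cone generated by the classes of curves, and $K_X$ the canonical bundle. An extremal ray of $\overline{NE}(X)$ is a half-line $R = \mathbb{R}_{\ge 0} z \subset \overline{NE}(X)$ with $z \neq 0$ such that $u, w \in \overline{NE}(X)$ and $u + w \in R$ imply $u, w \in R$; it is $K_X$-negative if $K_X \cdot z < 0$ for all $0 \ne z \in R$. The contraction of $R$ is a morphism $\varphi\colon X \to Y$ to a complete variety $Y$ with $\varphi_* \mathcal{O}_X = \mathcal{O}_Y$ such that an integral curve $C \subset X$ is mapped to a point if and only if $[C] \in R$. **Proposition.** Let $r \ge 0$ and let $0 \le a_1 \le \dots \le a_r$ be integers. Let $E := \mathcal{O}_{\mathbb{P}^1} \oplus \mathcal{O}_{\mathbb{P}^1}(a_1) \oplus \dots \oplus \mathcal{O}_{\mathbb{P}^1}(a_r)$, and let $\pi\colon X := \mathbb{P}(E) \to \mathbb{P}^1$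 be the associated $\mathbb{P}^r$-bundle. Let $\varphi\colon X \to Y$ be the contraction of a $K_X$-negative extremal ray of $\overline{NE}(X)$, and assume that $\varphi$ is different from $\pi$, i.e. there is no isomorphism $e\colon Y \to \mathbb{P}^1$ with $e \circ \varphi = \pi$. Then either $E \cong \mathcal{O}_{\mathbb{P}^1}^{\oplus (r+1)}$ or $E \cong \mathcal{O}_{\mathbb{P}^1}^{\oplus r} \oplus \mathcal{O}_{\mathbb{P}^1}(1)$. -/

import Mathlib

open CategoryTheory AlgebraicGeometry

noncomputable section

namespace ProjBundle

/-! ## Vector bundles -/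

/-- Restriction of regular functions from an open `U` to a smaller open `V`. -/
abbrev res {X : Scheme.{0}} {U V : X.Opens} (h : V ≤ U) : Γ(X, U) →+* Γ(X, V) :=
  (X.presheaf.map (homOfLE h).op).hom

/-- An (algebraic) vector bundle of rank `n` on a scheme `B`: an open cover `U i`, a frame
`e⁽ⁱ⁾₁, …, e⁽ⁱ⁾ₙ` over each `U i`, and the invertible transition matrices `g i j` of regular
functions with `e⁽ⁱ⁾ₗ = ∑ₘ (g i j)ₗₘ e⁽ʲ⁾ₘ` over `U i ∩ U j`, subject to the cocycle condition. -/
structure VectorBundle (B : Scheme.{0}) (n : ℕ) where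
  ι : Type
  U : ι → B.Opens
  iSup_U : ⨆ i, U i = ⊤
  g : ∀ i j, Matrix.GeneralLinearGroup (Fin n) Γ(B, U i ⊓ U j)
  cocycle : ∀ i j k,
    Matrix.GeneralLinearGroup.map
        (res (le_inf (inf_le_left.trans inf_le_left) inf_le_right :
          U i ⊓ U j ⊓ U k ≤ U i ⊓ U k)) (g i k) =
      Matrix.GeneralLinearGroup.map (res (inf_le_left : U i ⊓ U j ⊓ U k ≤ U i ⊓ U j)) (g i j) *
      Matrix.GeneralLinearGroup.map
        (res (le_inf (inf_le_left.trans inf_le_right) inf_le_right :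
          U i ⊓ U j ⊓ U k ≤ U j ⊓ U k)) (g j k)

/-- Two vector bundles of rank `n` are isomorphic: over each `E.U i ∩ F.U k` there is an invertible
matrix `h i k` expressing the image of the frame `e⁽ⁱ⁾` of `E` through the frame `f⁽ᵏ⁾` of `F`, and
these matrices are compatible with the transition matrices of `E` and `F`. -/
def VectorBundle.IsIsomorphic {B : Scheme.{0}} {n : ℕ} (E F : VectorBundle B n) : Prop :=
  ∃ h : ∀ i k, Matrix.GeneralLinearGroup (Fin n) Γ(B, E.U i ⊓ F.U k),
    ∀ (i j : E.ι) (k l : F.ι) (W : B.Opens) (hi : W ≤ E.U i) (hj : W ≤ E.U j)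
      (hk : W ≤ F.U k) (hl : W ≤ F.U l),
      Matrix.GeneralLinearGroup.map (res (le_inf hi hj)) (E.g i j) *
          Matrix.GeneralLinearGroup.map (res (le_inf hj hl)) (h j l) =
        Matrix.GeneralLinearGroup.map (res (le_inf hi hk)) (h i k) *
          Matrix.GeneralLinearGroup.map (res (le_inf hk hl)) (F.g k l)

/-- A line bundle is a vector bundle of rank one. -/
abbrev LineBundle (X : Scheme.{0}) := VectorBundle X 1

/-- Every point lies in some member of the trivializing cover. -/
theorem VectorBundle.exists_mem {B : Scheme.{0}} {n : ℕ} (E : VectorBundle B n) (x : B) :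
    ∃ i, x ∈ E.U i := by
  have h : x ∈ (⨆ i, E.U i) := by rw [E.iSup_U]; trivial
  simpa using h

/-- A member of the trivializing cover that contains `x`. -/
def VectorBundle.idx {B : Scheme.{0}} {n : ℕ} (E : VectorBundle B n) (x : B) : E.ι :=
  (E.exists_mem x).choose

/-! ## The projective line and the bundles `𝒪(d₁) ⊕ … ⊕ 𝒪(dₙ)` on it -/

/-- The grading of `ℂ[x₀, x₁]` by degree. -/
abbrev grading : ℕ → Submodule ℂ (MvPolynomial (Fin 2) ℂ) :=
  MvPolynomial.homogeneousSubmodule (Fin 2) ℂ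

instance : GradedAlgebra grading := MvPolynomial.gradedAlgebra

/-- The complex projective line `ℙ¹ = Proj ℂ[x₀, x₁]`. -/
def P1 : Scheme.{0} := Proj grading

/-- The structure morphism `ℙ¹ ⟶ Spec ℂ`. -/
def P1.toSpec : P1 ⟶ Spec (.of ℂ) :=
  Proj.toSpecZero grading ≫ Spec.map (CommRingCat.ofHom (algebraMap ℂ (grading 0)))

/-- The standard open `D₊(xᵢ) ⊆ ℙ¹`. -/
def P1.D (i : Fin 2) : P1.Opens := Proj.basicOpen grading (MvPolynomial.X i)

theorem P1.iSup_D : ⨆ i, P1.D i = ⊤ := by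
  refine Proj.iSup_basicOpen_eq_top' _ _ (fun i ↦ ⟨1, MvPolynomial.isHomogeneous_X ℂ i⟩) ?_
  rw [eq_top_iff]
  intro f _
  induction f using MvPolynomial.induction_on with
  | C c =>
    exact Subalgebra.algebraMap_mem _
      (⟨MvPolynomial.C c, MvPolynomial.isHomogeneous_C _ c⟩ : grading 0)
  | add p q hp hq => exact add_mem (hp trivial) (hq trivial)
  | mul_X p i hp => exact mul_mem (hp trivial) (Algebra.subset_adjoin ⟨i, rfl⟩)

/-- The value at `x ∈ D₊(xⱼ)` of the fraction `xᵢ / xⱼ`. -/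
def P1.ratioAt (i j : Fin 2) (W : P1.Opens) (hW : W ≤ P1.D j) (x : W) :
    HomogeneousLocalization.AtPrime grading (ProjectiveSpectrum.asHomogeneousIdeal
      (show ProjectiveSpectrum grading from x.1)).toIdeal :=
  HomogeneousLocalization.mk
    ⟨1, ⟨MvPolynomial.X i, MvPolynomial.isHomogeneous_X ℂ i⟩,
      ⟨MvPolynomial.X j, MvPolynomial.isHomogeneous_X ℂ j⟩, hW x.2⟩

/-- The regular function `xᵢ / xⱼ` on an open subset `W` of `D₊(xⱼ)`. -/
def P1.ratio (i j : Fin 2) (W : P1.Opens) (hW : W ≤ P1.D j) : Γ(P1, W) :=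
  (show ((ProjectiveSpectrum.Proj.structureSheaf grading).presheaf.obj (.op W) : Type _) from
    ⟨P1.ratioAt i j W hW,
      fun x ↦ ⟨W, x.2, 𝟙 _, 1, ⟨MvPolynomial.X i, MvPolynomial.isHomogeneous_X ℂ i⟩,
        ⟨MvPolynomial.X j, MvPolynomial.isHomogeneous_X ℂ j⟩, fun y ↦ hW y.2, fun _ ↦ rfl⟩⟩)

theorem P1.ratio_mul (i j k : Fin 2) (W : P1.Opens) (hj : W ≤ P1.D j) (hk : W ≤ P1.D k) :
    P1.ratio i j W hj * P1.ratio j k W hk = P1.ratio i k W hk := by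
  apply Subtype.ext
  funext x
  apply HomogeneousLocalization.val_injective
  change (P1.ratioAt i j W hj x * P1.ratioAt j k W hk x).val = (P1.ratioAt i k W hk x).val
  rw [HomogeneousLocalization.val_mul]
  simp only [P1.ratioAt, HomogeneousLocalization.val_mk, Localization.mk_mul]
  rw [Localization.mk_eq_mk_iff, Localization.r_iff_exists]
  exact ⟨1, by simp; ring⟩

theorem P1.ratio_self (i : Fin 2) (W : P1.Opens) (hi : W ≤ P1.D i) : P1.ratio i i W hi = 1 := by
  apply Subtype.ext
  funext x
  apply HomogeneousLocalization.val_injective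
  change (P1.ratioAt i i W hi x).val = (1 : HomogeneousLocalization.AtPrime grading
    (ProjectiveSpectrum.asHomogeneousIdeal (show ProjectiveSpectrum grading from x.1)).toIdeal).val
  rw [HomogeneousLocalization.val_one]
  simp only [P1.ratioAt, HomogeneousLocalization.val_mk]
  rw [← Localization.mk_one, Localization.mk_eq_mk_iff, Localization.r_iff_exists]
  exact ⟨1, by simp⟩

/-- The invertible function `xᵢ / xⱼ` on an open subset `W` of `D₊(xᵢ) ∩ D₊(xⱼ)`. -/
def P1.unit (i j : Fin 2) (W : P1.Opens) (hi : W ≤ P1.D i) (hj : W ≤ P1.D j) : Γ(P1, W)ˣ where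
  val := P1.ratio i j W hj
  inv := P1.ratio j i W hi
  val_inv := by rw [P1.ratio_mul, P1.ratio_self]
  inv_val := by rw [P1.ratio_mul, P1.ratio_self]

/-- The diagonal matrix with entries `(xᵢ / xⱼ) ^ d₁, …, (xᵢ / xⱼ) ^ dₙ` on an open subset `W` of
`D₊(xᵢ) ∩ D₊(xⱼ)`. -/
def P1.diag {n : ℕ} (d : Fin n → ℤ) (i j : Fin 2) (W : P1.Opens) (hi : W ≤ P1.D i)
    (hj : W ≤ P1.D j) : Matrix.GeneralLinearGroup (Fin n) Γ(P1, W) where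
  val := Matrix.diagonal fun k ↦ ((P1.unit i j W hi hj ^ d k : Γ(P1, W)ˣ) : Γ(P1, W))
  inv := Matrix.diagonal fun k ↦ (((P1.unit i j W hi hj ^ d k)⁻¹ : Γ(P1, W)ˣ) : Γ(P1, W))
  val_inv := by simp [Matrix.diagonal_mul_diagonal]
  inv_val := by simp [Matrix.diagonal_mul_diagonal]

theorem P1.map_diag {n : ℕ} (d : Fin n → ℤ) (i j : Fin 2) (W W' : P1.Opens) (hi : W ≤ P1.D i)
    (hj : W ≤ P1.D j) (h : W' ≤ W) :
    Matrix.GeneralLinearGroup.map (res h) (P1.diag d i j W hi hj) =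
      P1.diag d i j W' (h.trans hi) (h.trans hj) := by
  have hu : Units.map (res h : Γ(P1, W) →* Γ(P1, W')) (P1.unit i j W hi hj) =
      P1.unit i j W' (h.trans hi) (h.trans hj) := Units.ext rfl
  apply Units.ext
  change (Matrix.diagonal fun k ↦ _).map (res h) = Matrix.diagonal fun k ↦ _
  rw [Matrix.diagonal_map (map_zero _)]
  congr 1
  funext k
  have := congrArg (fun u : Γ(P1, W')ˣ ↦ ((u ^ d k : Γ(P1, W')ˣ) : Γ(P1, W'))) hu
  simpa [← map_zpow] using this

theorem P1.diag_mul {n : ℕ} (d : Fin n → ℤ) (i j k : Fin 2) (W : P1.Opens) (hi : W ≤ P1.D i)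
    (hj : W ≤ P1.D j) (hk : W ≤ P1.D k) :
    P1.diag d i k W hi hk = P1.diag d i j W hi hj * P1.diag d j k W hj hk := by
  have hu : P1.unit i k W hi hk = P1.unit i j W hi hj * P1.unit j k W hj hk :=
    Units.ext (P1.ratio_mul i j k W hj hk).symm
  apply Units.ext
  change Matrix.diagonal _ = Matrix.diagonal _ * Matrix.diagonal _
  rw [Matrix.diagonal_mul_diagonal]
  congr 1
  funext l
  rw [hu, mul_zpow, Units.val_mul]

/-- The vector bundle `𝒪(d₁) ⊕ … ⊕ 𝒪(dₙ)` on `ℙ¹`. Over `D₊(xᵢ)` the summand `𝒪(dₖ)` has the frame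
`xᵢ ^ dₖ`, so that the transition matrices are the diagonal matrices with entries
`(xᵢ / xⱼ) ^ dₖ`. -/
def splitBundle {n : ℕ} (d : Fin n → ℤ) : VectorBundle P1 n where
  ι := Fin 2
  U := P1.D
  iSup_U := P1.iSup_D
  g i j := P1.diag d i j _ inf_le_left inf_le_right
  cocycle i j k := by
    simp only [P1.map_diag]
    exact P1.diag_mul ..

/-! ## Projective bundles -/

/-- The projective bundle `π : ℙ(E) ⟶ B` of hyperplanes in the fibres of a vector bundle `E` of rank
`n`, so that the vectors of a frame of `E` are the homogeneous coordinates in the fibres of `π`.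
That is, `X` is the scheme over `B` obtained by gluing the `ℙⁿ⁻¹ × U i` through the transition
matrices of `E`:
* `X` is covered by opens `W i k = D₊(e⁽ⁱ⁾ₖ)`, where the `W i k` for fixed `i` cover the part of `X`
  over `U i`, with regular functions `y i k l = e⁽ⁱ⁾ₗ / e⁽ⁱ⁾ₖ` on `W i k`;
* the functions `y i k l` for `l ≠ k` identify `W i k` with the affine space over `U i`;
* on the part of `W i k` over `U j`, one has `e⁽ʲ⁾ₗ / e⁽ⁱ⁾ₖ = ∑ₘ (g j i)ₗₘ (e⁽ⁱ⁾ₘ / e⁽ⁱ⁾ₖ)`, this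
  function is invertible exactly on `W i k ∩ W j l`, and there
  `e⁽ʲ⁾ₘ / e⁽ⁱ⁾ₖ = (e⁽ʲ⁾ₘ / e⁽ʲ⁾ₗ) (e⁽ʲ⁾ₗ / e⁽ⁱ⁾ₖ)`.
These data determine `X` up to a unique isomorphism over `B`. -/
structure ProjectiveBundle {B : Scheme.{0}} {n : ℕ} (E : VectorBundle B n) where
  X : Scheme.{0}
  π : X ⟶ B
  W : E.ι → Fin n → X.Opens
  y : ∀ i k, Fin n → Γ(X, W i k)
  iSup_W : ∀ i, ⨆ k, W i k = π ⁻¹ᵁ E.U i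
  W_le : ∀ i k, W i k ≤ π ⁻¹ᵁ E.U i
  y_self : ∀ i k, y i k k = 1
  isIso_chart : ∀ i k, IsIso (AffineSpace.homOfVector (n := {l : Fin n // l ≠ k})
    (π.resLE (E.U i) (W i k) (W_le i k)) fun l ↦ (W i k).topIso.inv (y i k l.1))
  /-- The function `e⁽ʲ⁾ₗ / e⁽ⁱ⁾ₖ` on the part of `W i k` over `U j`. -/
  s : ∀ i k j, Fin n → Γ(X, W i k ⊓ π ⁻¹ᵁ E.U j)
  s_eq : ∀ i k j l, s i k j l = ∑ m,
    (π.appLE (E.U j ⊓ E.U i) (W i k ⊓ π ⁻¹ᵁ E.U j)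
      (le_inf inf_le_right (inf_le_left.trans (W_le i k)))).hom ((E.g j i).1 l m) *
    res (inf_le_left : W i k ⊓ π ⁻¹ᵁ E.U j ≤ W i k) (y i k m)
  overlap : ∀ i k j l, W i k ⊓ W j l = X.basicOpen (s i k j l)
  transition : ∀ i k j l m,
    res (le_inf inf_le_left (inf_le_right.trans (W_le j l)) :
      W i k ⊓ W j l ≤ W i k ⊓ π ⁻¹ᵁ E.U j) (s i k j m) =
    res (inf_le_right : W i k ⊓ W j l ≤ W j l) (y j l m) *
    res (le_inf inf_le_left (inf_le_right.trans (W_le j l)) :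
      W i k ⊓ W j l ≤ W i k ⊓ π ⁻¹ᵁ E.U j) (s i k j l)

/-- The structure morphism to `Spec ℂ` of a projective bundle over `ℙ¹`. -/
def ProjectiveBundle.toSpec {n : ℕ} {E : VectorBundle P1 n} (P : ProjectiveBundle E) :
    P.X ⟶ Spec (.of ℂ) :=
  P.π ≫ P1.toSpec

/-! ## Curves and intersection numbers on a complete complex variety `p : X ⟶ Spec ℂ` -/

section Intersection

variable {X : Scheme.{0}} (p : X ⟶ Spec (.of ℂ))

/-- The inclusion of the constants into the local ring of `X` at `x`. -/
def stalkHom (x : X) : ℂ →+* X.presheaf.stalk x :=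
  (Spec.preimage (X.fromSpecStalk x ≫ p)).hom

/-- The inclusion of the constants into the residue field of `X` at `x`. -/
def residueHom (x : X) : ℂ →+* X.residueField x :=
  (X.residue x).hom.comp (stalkHom p x)

/-- The point `η` is the generic point of an integral curve `C = closure {η}` in `X`: the function
field of `C`, which is the residue field of `η`, has transcendence degree one over `ℂ`. -/
def IsCurve (η : X) : Prop :=
  letI := (residueHom p η).toAlgebra
  Algebra.trdeg ℂ (X.residueField η) = 1

/-- The integral curves in `X`, each given by its generic point. -/
abbrev Curve := {η : X // IsCurve p η}

/-- A point of the normalization of the complete curve `C = closure {η}`: a normalized discrete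
valuation of the function field of `C` over `ℂ`. -/
structure Place (η : X) where
  v : Valuation (X.residueField η) (WithZero (Multiplicative ℤ))
  surjective : Function.Surjective v
  map_const : ∀ c : ℂ, c ≠ 0 → v (residueHom p η c) = 1

variable {p}

/-- The order of vanishing of the nonzero rational function `f` at the place `w`. -/
def Place.ord {η : X} (w : Place p η) (f : X.residueField η) : ℤ := -WithZero.log (w.v f)

/-- The point `x` is the image in `X` of the point `w` of the normalization of `closure {η}`: it lies
on `closure {η}`, and its local ring there is dominated by the valuation ring of `w`. -/
def Place.IsCenter {η : X} (w : Place p η) (x : X) : Prop :=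
  ∃ h : η ⤳ x, ∀ f : X.presheaf.stalk x,
    w.v ((X.residue η).hom ((X.presheaf.stalkSpecializes h).hom f)) ≤ 1 ∧
    (w.v ((X.residue η).hom ((X.presheaf.stalkSpecializes h).hom f)) < 1 ↔
      f ∈ IsLocalRing.maximalIdeal (X.presheaf.stalk x))

open Classical in
/-- The image in `X` of the point `w` of the normalization of `closure {η}`. It exists and is unique
if `X` is complete. -/
def Place.center {η : X} (w : Place p η) : X :=
  if h : ∃ x, w.IsCenter x then h.choose else η

open Classical in
/-- The value at `η ∈ U i ∩ U j` of the transition function `e⁽ⁱ⁾ / e⁽ʲ⁾` of a line bundle. -/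
def transitionAt (L : LineBundle X) (i j : L.ι) (η : X) : X.residueField η :=
  if h : η ∈ L.U i ⊓ L.U j then (X.evaluation (L.U i ⊓ L.U j) η h).hom ((L.g i j).1 0 0) else 1

variable (p)

/-- The intersection number `L · C` of a line bundle `L` with the curve `C = closure {η}`: the degree
of the pull-back of `L` to the normalization of `C`, which is the sum of the orders of a nonzero
rational section. The rational section used is the frame `e⁽ⁱ⁾` of `L` near `η`; its order at a
place centered at a point of `U j` is that of `e⁽ⁱ⁾ / e⁽ʲ⁾`. -/
def intersectionNumber (L : LineBundle X) (η : X) : ℤ :=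
  ∑ᶠ w : Place p η, w.ord (transitionAt L (L.idx η) (L.idx w.center) η)

/-! ## The cone of curves -/

/-- The map that sends a one-cycle with real coefficients to its intersection numbers with all line
bundles. Its kernel consists of the numerically trivial one-cycles. -/
def numericalClass : (Curve p →₀ ℝ) →ₗ[ℝ] (LineBundle X → ℝ) :=
  Finsupp.linearCombination ℝ fun C L ↦ (intersectionNumber p L C.1 : ℝ)

/-- The space `N₁(X)` of one-cycles with real coefficients modulo numerical equivalence, realized as
the image of `numericalClass`. A finite-dimensional subspace carries the standard topology of a
finite-dimensional real vector space. -/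
abbrev N1 : Submodule ℝ (LineBundle X → ℝ) := LinearMap.range (numericalClass p)

variable {p}

/-- The class in `N₁(X)` of a curve. -/
def Curve.cls (C : Curve p) : N1 p :=
  ⟨numericalClass p (Finsupp.single C 1), LinearMap.mem_range_self _ _⟩

/-- The intersection number of a line bundle with a class in `N₁(X)`. -/
def degree (L : LineBundle X) (z : N1 p) : ℝ := z.1 L

variable (p)

/-- The closed cone of curves `NE̅(X)`: the closure of the convex cone in `N₁(X)` generated by the
classes of curves. -/
def closedConeOfCurves : Set (N1 p) :=
  closure (Submodule.span NNReal (Set.range (Curve.cls (p := p))) : Set (N1 p))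

end Intersection

/-- `R` is an extremal ray of the convex cone `σ`: a half-line from the origin in `σ` such that two
elements of `σ` whose sum lies in `R` lie in `R` themselves. -/
def IsExtremalRay {V : Type*} [AddCommGroup V] [Module ℝ V] (σ R : Set V) : Prop :=
  (∃ z ∈ σ, z ≠ 0 ∧ R = {u | ∃ c : ℝ, 0 ≤ c ∧ u = c • z}) ∧
    ∀ u ∈ σ, ∀ w ∈ σ, u + w ∈ R → u ∈ R ∧ w ∈ R

/-! ## The canonical bundle -/

/-- `K` is the canonical bundle `Ωⁿ` of the smooth variety `p : X ⟶ Spec ℂ`, presented by local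
coordinates: over each `K.U i` there are functions `t i 1, …, t i n` whose differentials form a
basis of the Kähler differentials at every point, and `K` has the frames `dt i 1 ∧ … ∧ dt i n`. -/
def IsCanonicalBundle {X : Scheme.{0}} (p : X ⟶ Spec (.of ℂ)) (K : LineBundle X) : Prop :=
  ∃ (n : ℕ) (t : ∀ i, Fin n → Γ(X, K.U i)),
    (∀ (i : K.ι) (x : X) (hx : x ∈ K.U i),
      letI := (stalkHom p x).toAlgebra
      ∃ b : Module.Basis (Fin n) (X.presheaf.stalk x) (Ω[X.presheaf.stalk x⁄ℂ]), ∀ k,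
        b k = KaehlerDifferential.D ℂ (X.presheaf.stalk x)
          ((X.presheaf.germ (K.U i) x hx).hom (t i k))) ∧
    ∀ (i j : K.ι) (x : X) (hi : x ∈ K.U i) (hj : x ∈ K.U j),
      letI := (stalkHom p x).toAlgebra
      exteriorPower.ιMulti (X.presheaf.stalk x) n (fun k ↦
          KaehlerDifferential.D ℂ (X.presheaf.stalk x)
            ((X.presheaf.germ (K.U i) x hi).hom (t i k))) =
        (X.presheaf.germ (K.U i ⊓ K.U j) x ⟨hi, hj⟩).hom ((K.g i j).1 0 0) •
          exteriorPower.ιMulti (X.presheaf.stalk x) n (fun k ↦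
            KaehlerDifferential.D ℂ (X.presheaf.stalk x)
              ((X.presheaf.germ (K.U j) x hj).hom (t j k)))

/-! ## Contractions -/

/-- The morphism `φ : X ⟶ Y` over `ℂ` is the contraction of the extremal ray `R` of `NE̅(X)`: `Y` is a
complete variety, `φ_* 𝒪_X = 𝒪_Y`, and the curves that `φ` maps to points are exactly those with
class in `R`. -/
structure IsContraction {X : Scheme.{0}} (p : X ⟶ Spec (.of ℂ)) (R : Set (N1 p))
    {Y : Scheme.{0}} (q : Y ⟶ Spec (.of ℂ)) (φ : X ⟶ Y) : Prop where
  comp : φ ≫ q = p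
  isIntegral : IsIntegral Y
  isProper : IsProper q
  bijective_app : ∀ V : Y.Opens, Function.Bijective (φ.app V).hom
  isClosed_iff : ∀ C : Curve p, IsClosed {φ C.1} ↔ C.cls ∈ R

end ProjBundle

end

open ProjBundle

open CategoryTheory AlgebraicGeometry ProjBundle

noncomputable section

namespace FunctionField

open IsDedekindDomain WithZero

open scoped Multiplicative

/-! ## Principal divisors on function fields in one variable -/

universe u

/-! Let `H` be the tautological quotient `𝒪(1)` on `X` and `F` the pull-back of `𝒪(1)` from `ℙ¹`. As
all twists are nonnegative, both are nef, and every line bundle has the same intersection numbers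
with curves as some `mH + lF` (`exists_intersectionNumber_eq`). Two kinds of curves matter: the
section `σ` that belongs to the quotient `E → 𝒪`, with `H·σ = 0 < F·σ`, and the lines `ℓ` in the
fibres of `π`, with `F·ℓ = 0 < H·ℓ`. So `σ` and any one such `ℓ` span the cone of curves. The
Jacobian of the coordinate change between the two charts along `σ` gives `K·σ = (∑ aᵢ - 2) F·σ`
(`intersectionNumber_canonical_zeroSection`).

Suppose `∑ aᵢ ≥ 2`. Then `K·σ ≥ 0`, so a `K`-negative extremal ray `R` does not contain `σ`, and
extremality forces it to contain every line in every fibre (`IsExtremalRay.cls_mem`,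
`cls_chartLine_mem`). Hence `φ` contracts all these lines. Joining a point of a fibre to the point
of `σ` in that fibre by a line shows that `φ` depends only on the image under `π`, so `φ = ψ ∘ π`
(`exists_comp_eq`). Since `φ` does not contract `σ`, the morphism `ψ` on `ℙ¹` has finite fibres; it
is proper, hence finite, and `ψ_* 𝒪 = 𝒪`, so it is an isomorphism (`exists_iso_of_comp_eq`),
contrary to `φ ≠ π`. Therefore `∑ aᵢ < 2`, and monotonicity leaves only the two bundles claimed.

Two foundations carry this. Intersection numbers are sums, over all places of the function field of
a curve, of orders of arbitrarily chosen frames; they do not depend on the choices because principal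
divisors have degree zero (`finite_ord_and_finsum_ord`) and every place has a centre
(`Place.isCenter_center`). The description of line bundles holds because the charts of `X` are
affine spaces, hence factorial with constant units: a line bundle has a frame on each chart
(`exists_frame`), and the quotient of two such frames is supported on coordinate hyperplanes, so its
divisor is an integral multiple of that of a coordinate (`exists_isFrameSystem`). -/

/-- A normalized discrete valuation of `K` that is trivial on `k`. -/
structure NormVal (k K : Type u) [Field k] [Field K] [Algebra k K] where
  v : Valuation K (WithZero (Multiplicative ℤ))
  surjective : Function.Surjective v
  map_const : ∀ c : k, c ≠ 0 → v (algebraMap k K c) = 1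

variable {k K : Type u} [Field k] [Field K] [Algebra k K]

theorem NormVal.ext {w w' : NormVal k K} (h : w.v = w'.v) : w = w' := by
  cases w; cases w'; congr

/-- The order of `f` at `w`. -/
def NormVal.ord (w : NormVal k K) (f : K) : ℤ := -WithZero.log (w.v f)

theorem NormVal.ord_mul (w : NormVal k K) {f g : K} (hf : f ≠ 0) (hg : g ≠ 0) :
    w.ord (f * g) = w.ord f + w.ord g := by
  simp only [NormVal.ord, map_mul]
  rw [WithZero.log_mul (by simpa using hf) (by simpa using hg)]
  ring

theorem NormVal.ord_inv (w : NormVal k K) (f : K) : w.ord f⁻¹ = -w.ord f := by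
  simp [NormVal.ord, WithZero.log_inv]

theorem NormVal.map_const_le (w : NormVal k K) (c : k) : w.v (algebraMap k K c) ≤ 1 := by
  by_cases hc : c = 0
  · simp [hc]
  · exact (w.map_const c hc).le

theorem NormVal.ord_pos_iff (w : NormVal k K) {f : K} (hf : f ≠ 0) : 0 < w.ord f ↔ w.v f < 1 := by
  rw [NormVal.ord, Left.neg_pos_iff, WithZero.log_lt_iff_lt_exp (by simpa using hf)]
  simp

/-- Two normalized valuations such that the first is dominated by the second on a Dedekind domain
with fraction field `K` agree. -/
theorem eq_valuation_of_le {B : Type*} [CommRing B] [IsDedekindDomain B] [Algebra B K]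
    [IsFractionRing B K] (w : NormVal k K) (P : HeightOneSpectrum B)
    (hle : ∀ b : B, w.v (algebraMap B K b) ≤ 1)
    (hP : ∀ b : B, b ∈ P.asIdeal ↔ w.v (algebraMap B K b) < 1) :
    w.v = P.valuation K := by
  have key : ∀ x : K, P.valuation K x ≤ 1 → w.v x ≤ 1 := by
    intro x hx
    obtain ⟨n, d, hd⟩ := P.exists_primeCompl_mul_eq_of_integer x hx
    have h1 : w.v (algebraMap B K d) = 1 := by
      refine le_antisymm (hle _) ?_
      by_contra! h
      exact d.2 ((hP _).mpr h)
    have := congrArg w.v hd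
    rw [map_mul] at this
    rw [h1, mul_one] at this
    rw [this]
    exact hle _
  have unit : ∀ x : K, P.valuation K x = 1 → w.v x = 1 := by
    intro x hx
    refine le_antisymm (key x hx.le) ?_
    have h0 : x ≠ 0 := by rintro rfl; simp at hx
    have := key x⁻¹ (by simp [hx])
    rw [map_inv₀] at this
    exact (inv_le_one₀ (zero_lt_iff.mpr (by simpa using h0))).mp this
  obtain ⟨π, hπ⟩ := P.valuation_exists_uniformizer K
  have hπ0 : π ≠ 0 := by rintro rfl; simp at hπ; exact WithZero.exp_ne_zero hπ.symm
  -- Every element is a power of the uniformizer times a unit of the localization at `P`, so `w` is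
  -- determined by its value at `π`.
  have repr : ∀ x : K, x ≠ 0 → ∃ n : ℤ, P.valuation K x = exp n ∧ w.v x = (w.v π) ^ (-n) := by
    intro x hx
    have hx' : P.valuation K x ≠ 0 := by simpa using hx
    refine ⟨WithZero.log (P.valuation K x), (WithZero.exp_log hx').symm, ?_⟩
    set n := WithZero.log (P.valuation K x) with hn
    have h1 : P.valuation K (x * π ^ n) = 1 := by
      rw [map_mul, map_zpow₀, hπ, ← WithZero.exp_log hx', ← hn, ← WithZero.exp_zsmul,
        ← WithZero.exp_add]
      simp
    have h2 := unit _ h1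
    rw [map_mul, map_zpow₀] at h2
    rw [zpow_neg]
    exact eq_inv_of_mul_eq_one_left h2
  obtain ⟨m, hm⟩ : ∃ m : ℤ, w.v π = exp m :=
    ⟨_, (WithZero.exp_log (by simpa using hπ0)).symm⟩
  -- The value group of `w` is generated by the value of `π`, so surjectivity gives `m = ±1`; the
  -- sign follows because `π` is integral at `P`.
  have hm1 : m = -1 := by
    obtain ⟨y, hy⟩ := w.surjective (exp (-1 : ℤ))
    have hy0 : y ≠ 0 := by rintro rfl; simp at hy; exact WithZero.exp_ne_zero hy.symm
    obtain ⟨n, -, hn⟩ := repr y hy0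
    rw [hy, hm, ← WithZero.exp_zsmul, WithZero.exp_inj] at hn
    have hmd : m ∣ 1 := ⟨n, by simp at hn; linarith [mul_comm n m]⟩
    have hneg : m ≤ 0 := by
      have := key π (by rw [hπ, ← WithZero.exp_zero, WithZero.exp_le_exp]; norm_num)
      rw [hm, ← WithZero.exp_zero, WithZero.exp_le_exp] at this
      exact this
    rcases Int.isUnit_iff.mp (isUnit_of_dvd_one hmd) with h | h
    · omega
    · exact h
  ext x
  by_cases hx : x = 0
  · simp [hx]
  · obtain ⟨n, h1, h2⟩ := repr x hx
    rw [h1, h2, hm, hm1, ← WithZero.exp_zsmul]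
    simp


open scoped IntermediateField.algebraAdjoinAdjoin IntermediateField

/-- The residue field of `p` is a copy of the algebraically closed field `k`, so it has no
nontrivial integral extension. -/
theorem inertiaDeg_eq_one [IsAlgClosed k] {R B : Type u} [CommRing R] [CommRing B] [Algebra R B]
    [Algebra.IsIntegral R B] [Algebra k R] (p : Ideal R) [p.IsMaximal]
    (hkp : Function.Surjective (algebraMap k (R ⧸ p))) (P : Ideal B) [P.IsPrime] [P.LiesOver p] :
    P.inertiaDeg R = 1 := by
  have : P.IsMaximal := Ideal.IsMaximal.of_liesOver_isMaximal P p
  let _ : Field (R ⧸ p) := Ideal.Quotient.field p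
  have : IsAlgClosed (R ⧸ p) := IsAlgClosed.of_ringEquiv k (R ⧸ p)
    (RingEquiv.ofBijective (algebraMap k (R ⧸ p)) ⟨(algebraMap k (R ⧸ p)).injective, hkp⟩)
  rw [← Ideal.inertiaDeg'_eq_inertiaDeg p P, Ideal.inertiaDeg'_algebraMap]
  have hb : Function.Bijective (algebraMap (R ⧸ p) (B ⧸ P)) :=
    IsAlgClosed.algebraMap_bijective_of_isIntegral
  rw [← (LinearEquiv.ofBijective (Algebra.linearMap (R ⧸ p) (B ⧸ P)) hb).finrank_eq]
  exact Module.finrank_self _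

open Ideal in
-- The valuations positive on `fR` are those of the primes of `B` over `(fR)`, and the order of `fR`
-- at such a prime is its ramification index. As all inertia degrees are one, the identity `∑ e f =
-- rank` is the claim. The hypothesis `hint` gives each of these valuations a centre on `B`.
theorem sum_ord_eq_finrank_of_isMaximal [IsAlgClosed k] {R B : Type u} [CommRing R] [IsDomain R]
    [CommRing B] [IsDedekindDomain B] [Algebra R B] [Module.Finite R B] [Module.Flat R B]
    [Algebra k R] [Algebra k B] [IsScalarTower k R B] [Algebra B K] [IsFractionRing B K]
    [IsScalarTower k B K] (fR : R) (hfB0 : algebraMap R B fR ≠ 0)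
    [hpmax : (Ideal.span {fR}).IsMaximal]
    (hkp : Function.Surjective (algebraMap k (R ⧸ Ideal.span {fR})))
    (hint : ∀ w : NormVal k K, w.v (algebraMap B K (algebraMap R B fR)) < 1 →
      ∀ b : B, w.v (algebraMap B K b) ≤ 1) :
    {w : NormVal k K | w.v (algebraMap B K (algebraMap R B fR)) < 1}.Finite ∧
      ∑ᶠ (w : NormVal k K) (_ : w.v (algebraMap B K (algebraMap R B fR)) < 1),
        w.ord (algebraMap B K (algebraMap R B fR)) = Module.finrank R B := by
  set p : Ideal R := Ideal.span {fR} with hp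
  set fB : B := algebraMap R B fR with hfB
  set f : K := algebraMap B K fB with hf
  have hfR0 : fR ≠ 0 := fun h ↦ hfB0 (by rw [hfB, h, map_zero])
  have hmap : p.map (algebraMap R B) = Ideal.span {fB} := by
    rw [Ideal.map_span, Set.image_singleton]
  have hmap0 : p.map (algebraMap R B) ≠ ⊥ := by
    rw [hmap, Ne, Ideal.span_singleton_eq_bot]
    exact hfB0
  have hbot : ∀ P ∈ p.primesOver B, P ≠ ⊥ := by
    rintro P ⟨h1, h2⟩
    refine Ideal.ne_bot_of_liesOver_of_ne_bot (p := p) ?_ P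
    rw [Ne, Ideal.span_singleton_eq_bot]
    exact hfR0
  have hfin : (p.primesOver B).Finite := IsDedekindDomain.primesOver_finite p B
  let hs (P : p.primesOver B) : HeightOneSpectrum B := ⟨P.1, P.2.1, hbot P.1 P.2⟩
  have hconst : ∀ (P : HeightOneSpectrum B) (c : k), c ≠ 0 →
      P.valuation K (algebraMap k K c) = 1 := by
    intro P c hc
    rw [IsScalarTower.algebraMap_apply k B K]
    rw [HeightOneSpectrum.valuation_eq_one_iff_notMem]
    exact fun h ↦ P.isPrime.ne_top (Ideal.eq_top_of_isUnit_mem _ h ((isUnit_iff_ne_zero.mpr hc).map _))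
  let e (P : p.primesOver B) : NormVal k K :=
    ⟨(hs P).valuation K, (hs P).valuation_surjective K, hconst _⟩
  have hbij : Set.BijOn e Set.univ {w : NormVal k K | w.v f < 1} := by
    refine ⟨fun P _ ↦ ?_, fun P _ Q _ h ↦ ?_, fun w hw ↦ ?_⟩
    · change (hs P).valuation K (algebraMap B K fB) < 1
      rw [HeightOneSpectrum.valuation_lt_one_iff_mem]
      have := P.2.2
      exact (Ideal.mem_of_liesOver P.1 p fR).mp (Ideal.mem_span_singleton_self fR)
    · have hv : (hs P).valuation K = (hs Q).valuation K := congrArg NormVal.v h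
      apply Subtype.ext
      ext b
      change b ∈ (hs P).asIdeal ↔ b ∈ (hs Q).asIdeal
      rw [← HeightOneSpectrum.valuation_lt_one_iff_mem (K := K) (hs P), hv,
        HeightOneSpectrum.valuation_lt_one_iff_mem]
    -- Surjectivity: the elements of `B` of positive order at `w` form a prime over `(fR)`, and
    -- `eq_valuation_of_le` identifies `w` with its valuation.
    · have hB : ∀ b : B, w.v (algebraMap B K b) ≤ 1 := hint w hw
      let P : Ideal B :=
        { carrier := {b | w.v (algebraMap B K b) < 1}
          zero_mem' := by simp
          add_mem' := fun {a b} ha hb ↦ by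
            simp only [Set.mem_ofPred_eq, map_add] at *
            exact w.v.map_add_lt ha hb
          smul_mem' := fun c b hb ↦ by
            simp only [Set.mem_ofPred_eq, smul_eq_mul, map_mul] at *
            exact mul_lt_one_of_nonneg_of_lt_one_right (hB c) zero_le hb }
      have hPp : P.IsPrime := by
        refine ⟨?_, fun {a b} hab ↦ ?_⟩
        · rw [Ne, Ideal.eq_top_iff_one]
          change ¬ w.v _ < 1
          simp
        · by_contra! hcon
          have h1 : w.v (algebraMap B K a) = 1 := le_antisymm (hB a) (not_lt.mp hcon.1)
          have h2 : w.v (algebraMap B K b) = 1 := le_antisymm (hB b) (not_lt.mp hcon.2)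
          have h3 : w.v (algebraMap B K (a * b)) < 1 := hab
          rw [map_mul, map_mul, h1, h2] at h3
          simp at h3
      have hfP : fB ∈ P := hw
      have hPl : P.LiesOver p := by
        refine ⟨hpmax.eq_of_le (Ideal.IsPrime.under R P).ne_top ?_⟩
        rw [Ideal.span_singleton_le_iff_mem]
        exact hfP
      refine ⟨⟨P, hPp, hPl⟩, trivial, ?_⟩
      exact NormVal.ext (eq_valuation_of_le w (hs ⟨P, hPp, hPl⟩) hB fun b ↦ Iff.rfl).symm
  have hord : ∀ P : p.primesOver B, (e P).ord f = P.1.ramificationIdx R := by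
    intro P
    have := P.2.1
    have := P.2.2
    change -WithZero.log ((hs P).valuation K (algebraMap B K fB)) = _
    rw [HeightOneSpectrum.valuation_of_algebraMap,
      HeightOneSpectrum.intValuation_eq_exp_neg_multiplicity _ hfB0, WithZero.log_exp, neg_neg,
      Ideal.IsDedekindDomain.ramificationIdx_eq_multiplicity p P.1 hmap0, hmap]
  have := hfin.fintype
  constructor
  · rw [← hbij.image_eq]
    exact (Set.toFinite _).image _
  · refine (finsum_mem_eq_of_bijOn e hbij (g := fun w ↦ w.ord f) (fun _ _ ↦ rfl)).symm.trans ?_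
    rw [← sum_ramification_inertia_eq_finrank p B, finsum_mem_univ, finsum_eq_sum_of_fintype]
    push_cast
    refine Finset.sum_congr rfl fun P _ ↦ ?_
    have := P.2.1
    have := P.2.2
    rw [hord, inertiaDeg_eq_one p hkp P.1]
    simp

open Ideal in
/-- The number of zeros of a nonconstant rational function, counted with multiplicities, is the
degree of the field extension it generates. -/
theorem sum_ord_zeros [IsAlgClosed k] [CharZero k] (f : K) (hf : Transcendental k f)
    [FiniteDimensional k⟮f⟯ K] :
    {w : NormVal k K | w.v f < 1}.Finite ∧
      ∑ᶠ (w : NormVal k K) (_ : w.v f < 1), w.ord f = Module.finrank k⟮f⟯ K := by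
  -- The curve is viewed as a cover of the affine line `Spec k[f]`: `B` is the integral closure of
  -- `k[f]` in `K`, and the zeros of `f` lie over the origin.
  let R := Algebra.adjoin k {f}
  let eR : Polynomial k ≃ₐ[k] R :=
    (AlgEquiv.ofInjective (Polynomial.aeval f) (transcendental_iff_injective.mp hf)).trans
      (Subalgebra.equivOfEq _ _ (Algebra.adjoin_singleton_eq_range_aeval k f).symm)
  have : IsPrincipalIdealRing R :=
    IsPrincipalIdealRing.of_surjective eR.toRingEquiv.toRingHom eR.surjective
  let fR : R := ⟨f, Algebra.self_mem_adjoin_singleton k f⟩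
  have hX : eR Polynomial.X = fR := Subtype.ext (Polynomial.aeval_X f)
  have hf0 : f ≠ 0 := by rintro rfl; exact hf (isAlgebraic_zero)
  let B := integralClosure R K
  have : IsDedekindDomain B := integralClosure.isDedekindDomain R k⟮f⟯ K
  have : IsFractionRing B K := integralClosure.isFractionRing_of_finite_extension k⟮f⟯ K
  have : Module.Finite R B := IsIntegralClosure.finite R k⟮f⟯ K B
  have hfR0 : fR ≠ 0 := fun h ↦ hf0 (congrArg Subtype.val h)
  have hfirr : Irreducible fR := by
    rw [← hX]
    exact (MulEquiv.irreducible_iff eR).mpr Polynomial.irreducible_X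
  let p : Ideal R := Ideal.span {fR}
  have hpmax : p.IsMaximal := PrincipalIdealRing.isMaximal_of_irreducible hfirr
  have hkp : Function.Bijective (algebraMap k (R ⧸ p)) := by
    have : Nontrivial (R ⧸ p) := Ideal.Quotient.nontrivial_iff.mpr hpmax.ne_top
    refine ⟨(algebraMap k (R ⧸ p)).injective, fun y ↦ ?_⟩
    obtain ⟨y, rfl⟩ := Ideal.Quotient.mk_surjective y
    obtain ⟨q, rfl⟩ := eR.surjective y
    refine ⟨q.coeff 0, ?_⟩
    rw [IsScalarTower.algebraMap_apply k R (R ⧸ p)]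
    refine Ideal.Quotient.eq.mpr ?_
    rw [Ideal.mem_span_singleton]
    obtain ⟨q', hq'⟩ : Polynomial.X ∣ Polynomial.C (q.coeff 0) - q := by
      rw [Polynomial.X_dvd_iff]; simp
    refine ⟨eR q', ?_⟩
    rw [← hX, ← map_mul, ← hq', map_sub, sub_left_inj]
    exact (eR.commutes (q.coeff 0)).symm
  -- A valuation with `w.v f < 1` is integral on `k[f]`, hence on everything integral over it.
  have hint : ∀ w : NormVal k K, w.v f < 1 → ∀ b : B, w.v (algebraMap B K b) ≤ 1 := by
    intro w hw
    have hR : ∀ x : R, w.v (x : K) ≤ 1 := by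
      rintro ⟨x, hx⟩
      have hle : Algebra.adjoin k {f} ≤ (⟨w.v.integer.toSubsemiring, w.map_const_le⟩ : Subalgebra k K) := by
        refine Algebra.adjoin_le ?_
        rintro y rfl
        exact (show w.v y < 1 from hw).le
      exact hle hx
    have hB : ∀ b : B, w.v (algebraMap B K b) ≤ 1 := by
      intro b
      refine (Valuation.integer.integers w.v).mem_of_integral ?_
      refine IsIntegral.map_of_comp_eq
        ((algebraMap R K).codRestrict w.v.integer hR) (RingHom.id K) ?_ b.2
      ext; rfl
    exact hB
  have hfin : Module.finrank k⟮f⟯ K = Module.finrank R B := IsFractionRing.finrank_eq R k⟮f⟯ B K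
  rw [hfin]
  exact sum_ord_eq_finrank_of_isMaximal (K := K) (B := B) fR
    (fun h ↦ hf0 (congrArg (algebraMap B K) h)) hkp.2 hint

open Cardinal in
-- In transcendence degree one `f` alone is a transcendence basis, so `K` is algebraic over `k(f)`;
-- being essentially of finite type, it is finite over `k(f)`.
theorem finiteDimensional_adjoin_simple [Algebra.EssFiniteType k K] (htr : Algebra.trdeg k K = 1)
    (f : K) (hf : Transcendental k f) : FiniteDimensional k⟮f⟯ K := by
  have hb : IsTranscendenceBasis k (fun _ : Unit ↦ f) := by
    refine AlgebraicIndependent.isTranscendenceBasis_of_lift_trdeg_le_of_finite ?_ ?_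
    · exact (algebraicIndependent_unique_type_iff (x := fun _ : Unit ↦ f)).mpr hf
    · rw [htr]; simp
  have halg := hb.isAlgebraic_field
  rw [Set.range_const] at halg
  have : Algebra.EssFiniteType k⟮f⟯ K := Algebra.EssFiniteType.of_comp k k⟮f⟯ K
  exact Algebra.finite_of_essFiniteType_of_isAlgebraic

theorem ord_eq_zero_of_isAlgebraic [IsAlgClosed k] (w : NormVal k K) {f : K} (hf : IsAlgebraic k f) :
    w.ord f = 0 := by
  obtain ⟨c, rfl⟩ : ∃ c, algebraMap k K c = f := by
    have := IntermediateField.isAlgebraic_adjoin_simple hf.isIntegral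
    have hbot := IntermediateField.eq_bot_of_isAlgClosed_of_isAlgebraic k⟮f⟯
    exact IntermediateField.mem_bot.mp (hbot ▸ IntermediateField.mem_adjoin_simple_self k f)
  by_cases hc : c = 0
  · simp [hc, NormVal.ord]
  · simp [NormVal.ord, w.map_const c hc]

variable [IsAlgClosed k] [CharZero k]

/-- A nonzero rational function has finitely many zeros and poles, and the number of its zeros
equals the number of its poles. -/
theorem finite_ord_and_finsum_ord [Algebra.EssFiniteType k K] (htr : Algebra.trdeg k K = 1)
    (f : K) : {w : NormVal k K | w.ord f ≠ 0}.Finite ∧ ∑ᶠ w : NormVal k K, w.ord f = 0 := by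
  by_cases hf : IsAlgebraic k f
  · simp [ord_eq_zero_of_isAlgebraic _ hf]
  have hf' : Transcendental k f⁻¹ := fun h ↦ hf (by simpa using h.inv)
  have hf0 : f ≠ 0 := by rintro rfl; exact hf (isAlgebraic_zero)
  have h1 := finiteDimensional_adjoin_simple htr f hf
  have h2 := finiteDimensional_adjoin_simple htr f⁻¹ hf'
  have e1 := sum_ord_zeros f hf
  have e2 := sum_ord_zeros f⁻¹ hf'
  -- The poles of `f` are the zeros of `f⁻¹`; both counts are the degree of `K` over the same
  -- subfield.
  have heq : k⟮f⁻¹⟯ = k⟮f⟯ := by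
    apply le_antisymm <;> rw [IntermediateField.adjoin_simple_le_iff]
    · exact inv_mem (IntermediateField.mem_adjoin_simple_self k f)
    · simpa using inv_mem (IntermediateField.mem_adjoin_simple_self k f⁻¹)
  rw [heq] at e2
  have hsupp : {w : NormVal k K | w.ord f ≠ 0} =
      {w : NormVal k K | w.v f < 1} ∪ {w : NormVal k K | w.v f⁻¹ < 1} := by
    ext w
    simp only [Set.mem_ofPred_eq, Set.mem_union, ← w.ord_pos_iff hf0,
      ← w.ord_pos_iff (inv_ne_zero hf0), w.ord_inv]
    omega
  have hdisj : Disjoint {w : NormVal k K | w.v f < 1} {w : NormVal k K | w.v f⁻¹ < 1} := by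
    rw [Set.disjoint_left]
    intro w h1 h2
    simp only [Set.mem_ofPred_eq, ← w.ord_pos_iff hf0,
      ← w.ord_pos_iff (inv_ne_zero hf0), w.ord_inv] at h1 h2
    omega
  refine ⟨hsupp ▸ e1.1.union e2.1, ?_⟩
  rw [← finsum_mem_support (fun w : NormVal k K ↦ w.ord f)]
  change ∑ᶠ w ∈ {w : NormVal k K | w.ord f ≠ 0}, w.ord f = 0
  rw [hsupp, finsum_mem_union hdisj e1.1 e2.1]
  have e3 := e2.2
  simp only [NormVal.ord_inv] at e3
  have e4 : ∑ᶠ w ∈ {w : NormVal k K | w.v f⁻¹ < 1}, w.ord f = -(Module.finrank k⟮f⟯ K : ℤ) := by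
    have := finsum_mem_neg_distrib (fun w : NormVal k K ↦ w.ord f) e2.1
    rw [← e3, eq_neg_iff_add_eq_zero, add_comm]
    exact (congrArg (· + _) this).trans (neg_add_cancel _)
  rw [e4]
  exact (congrArg (· + _) e1.2).trans (add_neg_cancel _)

/-- A nonconstant rational function has a zero. -/
theorem exists_zero [Algebra.EssFiniteType k K] (htr : Algebra.trdeg k K = 1)
    (f : K) (hf : Transcendental k f) : ∃ w : NormVal k K, 0 < w.ord f := by
  have h1 := finiteDimensional_adjoin_simple htr f hf
  have hf0 : f ≠ 0 := by rintro rfl; exact hf (isAlgebraic_zero)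
  by_contra! hcon
  have e1 := (sum_ord_zeros f hf).2
  have h3 : ∀ w : NormVal k K, ¬ w.v f < 1 := fun w ↦ by
    rw [← w.ord_pos_iff hf0]; exact not_lt.mpr (hcon w)
  have : (Module.finrank k⟮f⟯ K : ℤ) = 0 := by rw [← e1]; simp [h3]
  have := Module.finrank_pos (R := k⟮f⟯) (M := K)
  omega

end FunctionField

namespace ProjBundle

open HomogeneousLocalization

/-! ## Affine charts of the projective line -/

theorem le_preimage_top {X Y : Scheme.{0}} (p : X ⟶ Y) (U : X.Opens) : U ≤ p ⁻¹ᵁ ⊤ := le_top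

/-- The inclusion of the constants into the regular functions on `U`. -/
def constHom {X : Scheme.{0}} (p : X ⟶ Spec (.of ℂ)) (U : X.Opens) : ℂ →+* Γ(X, U) :=
  ((Scheme.ΓSpecIso (.of ℂ)).inv ≫ p.appLE ⊤ U (le_preimage_top p U)).hom

theorem constHom_eq_topIso {X : Scheme.{0}} (p : X ⟶ Spec (.of ℂ)) (U : X.Opens) :
    constHom p U = ((Scheme.ΓSpecIso (.of ℂ)).inv ≫ (U.ι ≫ p).appTop ≫ U.topIso.hom).hom := by
  rw [constHom]
  congr 2
  have h (V W : X.Opens) (h1 : V ≤ ⊤) (h2 : W = V) : X.presheaf.map (homOfLE h1).op =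
      X.presheaf.map (homOfLE (h2.le.trans h1)).op ≫ X.presheaf.map (eqToHom (by rw [h2])).op := by
    subst h2; simp
  simp only [Scheme.Hom.appLE, Scheme.Hom.comp_appTop, Scheme.Opens.topIso, Category.assoc]
  congr 1
  rw [Scheme.Hom.appTop, Scheme.Opens.ι_app]
  exact h U _ le_top (by simp)

/-- The ring of fractions of degree zero with powers of `xᵢ` as denominators. -/
abbrev P1.A (i : Fin 2) : Type := Away grading (MvPolynomial.X i : MvPolynomial (Fin 2) ℂ)

/-- The localization map of `ℂ[x₀, x₁]` at `xᵢ`. -/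
abbrev P1.toLoc (i : Fin 2) : MvPolynomial (Fin 2) ℂ →+*
    Localization.Away (MvPolynomial.X i : MvPolynomial (Fin 2) ℂ) :=
  algebraMap _ _

theorem P1.X_mem (i : Fin 2) : (MvPolynomial.X i : MvPolynomial (Fin 2) ℂ) ∈ grading 1 :=
  MvPolynomial.isHomogeneous_X ℂ i

/-- The fraction `xᵢ₊₁ / xᵢ`. -/
def P1.awayRatio (i : Fin 2) : P1.A i :=
  Away.mk grading (P1.X_mem i) 1 (MvPolynomial.X (i + 1))
    (by simpa using P1.X_mem (i + 1))

/-- Addition in `Fin 2` is modulo two, so here and below `i + 1` denotes the other index. -/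
def P1.awayHom (i : Fin 2) : Polynomial ℂ →+* P1.A i :=
  Polynomial.eval₂RingHom ((fromZeroRingHom grading _).comp (algebraMap ℂ (grading 0)))
    (P1.awayRatio i)

theorem P1.val_awayHom_C (i : Fin 2) (c : ℂ) : (P1.awayHom i (Polynomial.C c)).val =
    P1.toLoc i (MvPolynomial.C c) := by
  simp [P1.awayHom, fromZeroRingHom]
  rfl

theorem P1.mul_val_awayRatio (i : Fin 2) :
    P1.toLoc i (MvPolynomial.X i) * (P1.awayRatio i).val = P1.toLoc i (MvPolynomial.X (i + 1)) := by
  rw [P1.toLoc, P1.awayRatio, Away.val_mk, ← Localization.mk_one_eq_algebraMap, Localization.mk_mul,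
    ← Localization.mk_one_eq_algebraMap, Localization.mk_eq_mk_iff, Localization.r_iff_exists]
  exact ⟨1, by simp⟩

/-- Dehomogenization with respect to `xᵢ`. -/
def P1.dehomogenize (i : Fin 2) : MvPolynomial (Fin 2) ℂ →+* Polynomial ℂ :=
  MvPolynomial.eval₂Hom Polynomial.C (fun j ↦ if j = i then 1 else Polynomial.X)

/-- On a monomial of degree `n` this is `xᵢᵃ xᵢ₊₁ᵇ = xᵢⁿ (xᵢ₊₁ / xᵢ)ᵇ` with `a + b = n`. It yields
the surjectivity of `P1.awayHom`. -/
theorem P1.algebraMap_eq_mul_awayHom (i : Fin 2) (n : ℕ) (p : MvPolynomial (Fin 2) ℂ)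
    (hp : p.IsHomogeneous n) :
    P1.toLoc i p = P1.toLoc i (MvPolynomial.X i) ^ n * (P1.awayHom i (P1.dehomogenize i p)).val := by
  have hmon : ∀ m ∈ p.support,
      P1.toLoc i (MvPolynomial.monomial m (p.coeff m)) =
      P1.toLoc i (MvPolynomial.X i) ^ n * (algebraMap (P1.A i)
        (Localization.Away (MvPolynomial.X i : MvPolynomial (Fin 2) ℂ)))
        (P1.awayHom i (P1.dehomogenize i (MvPolynomial.monomial m (p.coeff m)))) := by
    intro m hm
    have hdeg : m i + m (i + 1) = n := by
      have := hp (MvPolynomial.mem_support_iff.mp hm)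
      rw [← this]
      fin_cases i <;> simp [Finsupp.weight_apply, Finsupp.sum_fintype, add_comm]
    have hmm : MvPolynomial.monomial m (p.coeff m) = MvPolynomial.C (p.coeff m) *
        MvPolynomial.X i ^ m i * MvPolynomial.X (i + 1) ^ m (i + 1) := by
      rw [MvPolynomial.monomial_eq, Finsupp.prod_fintype _ _ (by simp)]
      fin_cases i <;> simp [Fin.prod_univ_two] <;> ring
    have hne : i + 1 ≠ i := by fin_cases i <;> simp
    have hd : P1.dehomogenize i (MvPolynomial.monomial m (p.coeff m)) =
        Polynomial.C (p.coeff m) * Polynomial.X ^ m (i + 1) := by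
      rw [hmm]
      simp [P1.dehomogenize, hne]
    have hX : P1.awayHom i Polynomial.X = P1.awayRatio i := by simp [P1.awayHom]
    have hC : algebraMap (P1.A i) (Localization.Away (MvPolynomial.X i : MvPolynomial (Fin 2) ℂ))
        (P1.awayHom i (Polynomial.C (p.coeff m))) = _ := P1.val_awayHom_C i (p.coeff m)
    have hr : _ * algebraMap (P1.A i) (Localization.Away (MvPolynomial.X i : MvPolynomial (Fin 2) ℂ))
        (P1.awayRatio i) = _ := P1.mul_val_awayRatio i
    rw [hd, hmm, ← hdeg]
    simp only [map_mul, map_pow, hX, hC]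
    rw [← hr, pow_add]
    ring
  change _ = _ * (algebraMap (P1.A i)
        (Localization.Away (MvPolynomial.X i : MvPolynomial (Fin 2) ℂ))) _
  conv_lhs => rw [p.as_sum]
  conv_rhs => rw [p.as_sum]
  simp only [map_sum, Finset.mul_sum]
  exact Finset.sum_congr rfl hmon

/-- Dehomogenization sends `xᵢ` to one, so it extends to the localization and inverts the map from
the left. A fraction with denominator `xᵢⁿ` is the image of the dehomogenization of its numerator.
-/
theorem P1.awayHom_bijective (i : Fin 2) : Function.Bijective (P1.awayHom i) := by
  constructor
  · have hφ : IsUnit (P1.dehomogenize i (MvPolynomial.X i)) := by simp [P1.dehomogenize]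
    let ψ : P1.A i →+* Polynomial ℂ :=
      (Localization.awayLift (P1.dehomogenize i) _ hφ).comp
        (algebraMap (P1.A i) (Localization.Away _))
    have hψ (x : P1.A i) : ψ x = Localization.awayLift (P1.dehomogenize i) _ hφ x.val := rfl
    have hlift (p : MvPolynomial (Fin 2) ℂ) : Localization.awayLift (P1.dehomogenize i) _ hφ
        (P1.toLoc i p) = P1.dehomogenize i p := IsLocalization.Away.lift_eq _ _ _
    have hne : i + 1 ≠ i := by fin_cases i <;> simp
    have : ψ.comp (P1.awayHom i) = RingHom.id _ := by
      apply Polynomial.ringHom_ext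
      · intro c
        rw [RingHom.comp_apply, hψ, P1.val_awayHom_C, hlift]
        simp [P1.dehomogenize]
      · have h := congrArg (Localization.awayLift (P1.dehomogenize i) _ hφ) (P1.mul_val_awayRatio i)
        rw [map_mul, hlift, hlift, ← hψ] at h
        have hX : P1.awayHom i Polynomial.X = P1.awayRatio i := by simp [P1.awayHom]
        rw [RingHom.comp_apply, hX]
        simpa [P1.dehomogenize, hne] using h
    exact Function.LeftInverse.injective (g := ψ) (fun x ↦ congrArg (fun f ↦ f x) this)
  · intro x
    obtain ⟨n, p, hp, rfl⟩ := Away.mk_surjective grading (P1.X_mem i) x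
    refine ⟨P1.dehomogenize i p, HomogeneousLocalization.val_injective _ ?_⟩
    have hp' : p.IsHomogeneous n := by simpa using hp
    have h := P1.algebraMap_eq_mul_awayHom i n p hp'
    have hu : IsUnit (P1.toLoc i (MvPolynomial.X i) ^ n) :=
      (IsLocalization.Away.algebraMap_isUnit (MvPolynomial.X i : MvPolynomial (Fin 2) ℂ)).pow n
    apply hu.mul_left_cancel
    rw [← h, Away.val_mk, ← map_pow, P1.toLoc, ← Localization.mk_one_eq_algebraMap,
      ← Localization.mk_one_eq_algebraMap, Localization.mk_mul, Localization.mk_eq_mk_iff,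
      Localization.r_iff_exists]
    exact ⟨1, by simp⟩

theorem P1.isAffineOpen_D (i : Fin 2) : IsAffineOpen (P1.D i) :=
  Proj.isAffineOpen_basicOpen grading _ (P1.X_mem i) one_pos

/-- The polynomial functions on `D₊(xᵢ)` in the coordinate `xᵢ₊₁ / xᵢ`. -/
def P1.chartHom (i : Fin 2) : Polynomial ℂ →+* Γ(P1, P1.D i) :=
  Polynomial.eval₂RingHom (constHom P1.toSpec (P1.D i)) (P1.ratio (i + 1) i (P1.D i) le_rfl)

theorem P1.constHom_D (i : Fin 2) :
    constHom P1.toSpec (P1.D i) = ((CommRingCat.ofHom (algebraMap ℂ (grading 0))) ≫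
      (CommRingCat.ofHom (fromZeroRingHom grading _)) ≫
        (Proj.awayToSection grading (MvPolynomial.X i))).hom := by
  have h1 : (Proj.basicOpen grading (MvPolynomial.X i)).ι ≫ Proj.toSpecZero grading =
      Proj.basicOpenToSpec grading (MvPolynomial.X i) ≫
      Spec.map (CommRingCat.ofHom (fromZeroRingHom grading _)) := by
    rw [← Proj.basicOpenIsoSpec_hom grading _ (P1.X_mem i) one_pos,
      ← Iso.inv_comp_eq, Proj.basicOpenIsoSpec_inv_ι_assoc, Proj.awayι_toSpecZero]
  have h2 : constHom (Proj.toSpecZero grading ≫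
      Spec.map (CommRingCat.ofHom (algebraMap ℂ (grading 0))))
      (Proj.basicOpen grading (MvPolynomial.X i)) = ((CommRingCat.ofHom (algebraMap ℂ (grading 0))) ≫
      (CommRingCat.ofHom (fromZeroRingHom grading _)) ≫
        (Proj.awayToSection grading (MvPolynomial.X i))).hom := by
    rw [constHom_eq_topIso, reassoc_of% h1]
    congr 1
    have h3 := Proj.basicOpenToSpec_app_top grading (MvPolynomial.X i : MvPolynomial (Fin 2) ℂ)
    simp only [Scheme.Hom.comp_appTop, Category.assoc]
    rw [← Scheme.ΓSpecIso_inv_naturality_assoc]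
    have h4 : (Proj.basicOpenToSpec grading (MvPolynomial.X i)).appTop = _ := h3
    rw [h4]
    simp only [Category.assoc, Iso.inv_hom_id, Category.comp_id]
    rw [← Scheme.ΓSpecIso_inv_naturality_assoc, Iso.inv_hom_id_assoc]
  exact h2

/-- This map is `P1.awayHom` followed by the isomorphism of the degree-zero localization with the
sections over `D₊(xᵢ)`; the two agree on constants by `P1.constHom_D`. -/
theorem P1.chartHom_bijective (i : Fin 2) : Function.Bijective (P1.chartHom i) := by
  have h : P1.chartHom i = RingHom.comp (Proj.awayToSection grading (MvPolynomial.X i)).hom (P1.awayHom i) := by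
    apply Polynomial.ringHom_ext
    · intro c
      have h1 : P1.chartHom i (Polynomial.C c) = constHom P1.toSpec (P1.D i) c := by
        simp [P1.chartHom]
      have h2 : P1.awayHom i (Polynomial.C c) =
          (fromZeroRingHom grading _) (algebraMap ℂ (grading 0) c) := by simp [P1.awayHom]
      rw [P1.constHom_D] at h1
      refine h1.trans (congrArg (Proj.awayToSection grading (MvPolynomial.X i)).hom h2.symm)
    · have h1 : P1.chartHom i Polynomial.X = P1.ratio (i + 1) i (P1.D i) le_rfl := by
        simp [P1.chartHom]
      have h2 : P1.awayHom i Polynomial.X = P1.awayRatio i := by simp [P1.awayHom]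
      refine h1.trans (Eq.trans ?_
        (congrArg (Proj.awayToSection grading (MvPolynomial.X i)).hom h2.symm))
      apply Subtype.ext
      funext x
      apply HomogeneousLocalization.val_injective
      refine Eq.trans ?_
        (ProjectiveSpectrum.Proj.awayToSection_apply grading _ (P1.awayRatio i) x).symm
      rw [P1.awayRatio, Away.val_mk, Localization.mk_eq_mk', IsLocalization.map_mk',
        ← Localization.mk_eq_mk']
      change (P1.ratioAt (i + 1) i (P1.D i) le_rfl x).val = _
      simp only [P1.ratioAt, HomogeneousLocalization.val_mk]
      rw [Localization.mk_eq_mk_iff, Localization.r_iff_exists]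
      exact ⟨1, by simp⟩
  rw [h]
  have h2 : IsIso (Proj.awayToSection grading (MvPolynomial.X i)) := by
    rw [← Proj.basicOpenIsoAway_hom grading _ (P1.X_mem i) one_pos]
    infer_instance
  exact (ConcreteCategory.bijective_of_isIso (Proj.awayToSection grading (MvPolynomial.X i))).comp (P1.awayHom_bijective i)

end ProjBundle

namespace ProjBundle

/-! ## Affine charts of projective bundles -/

section AffineSpace

variable {X S : Scheme.{0}} {f : X ⟶ S} {U : S.Opens} {W : X.Opens} {m : Type}
  (h : W ≤ f ⁻¹ᵁ U) (y : m → Γ(X, W))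

theorem isAffineOpen_of_isIso_homOfVector (hU : IsAffineOpen U)
    [IsIso (AffineSpace.homOfVector (f.resLE U W h) fun l ↦ W.topIso.inv (y l))] :
    IsAffineOpen W := by
  have : IsAffine U := hU
  have : IsAffine W := .of_isIso (AffineSpace.homOfVector (f.resLE U W h) fun l ↦ W.topIso.inv (y l))
  exact this

/-- The isomorphism with affine space over the affine scheme `U` becomes, on global sections, an
isomorphism with a polynomial ring over the functions on `U`; the rest identifies that map with
evaluation at `y`. -/
theorem bijective_eval₂Hom_of_isIso_homOfVector (hU : IsAffineOpen U)
    [IsIso (AffineSpace.homOfVector (f.resLE U W h) fun l ↦ W.topIso.inv (y l))] :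
    Function.Bijective (MvPolynomial.eval₂Hom (f.appLE U W h).hom y) := by
  have : IsAffine U := hU
  let φ := AffineSpace.homOfVector (f.resLE U W h) fun l ↦ W.topIso.inv (y l)
  let e := asIso φ ≪≫ AffineSpace.isoOfIsAffine m U
  let g := (MvPolynomial.map U.topIso.inv.hom : MvPolynomial m Γ(S, U) →+* MvPolynomial m Γ(U, ⊤))
  have hg : Function.Bijective g := (MvPolynomial.mapEquiv m U.topIso.symm.commRingCatIsoToRingEquiv).bijective
  let ψ : CommRingCat.of (MvPolynomial m Γ(U, ⊤)) ⟶ Γ(X, W) :=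
    (Scheme.ΓSpecIso _).inv ≫ e.hom.appTop ≫ W.topIso.hom
  have hψ : Function.Bijective ψ := by
    have : IsIso e.hom.appTop := inferInstanceAs (IsIso (Scheme.Γ.map e.hom.op))
    have : IsIso ψ := by dsimp only [ψ]; infer_instance
    exact ConcreteCategory.bijective_of_isIso ψ
  have key : ψ = CommRingCat.ofHom (MvPolynomial.eval₂Hom
      ((f.resLE U W h).appTop ≫ W.topIso.hom).hom y) := by
    simp only [ψ, e, Iso.trans_hom, Scheme.Hom.comp_appTop, AffineSpace.isoOfIsAffine_hom_appTop,
      Category.assoc, Iso.inv_hom_id_assoc]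
    ext : 1
    apply MvPolynomial.ringHom_ext
    · intro a
      have h1 : (𝔸(m; U) ↘ U).appTop ≫ φ.appTop = (f.resLE U W h).appTop := by
        rw [← Scheme.Hom.comp_appTop, AffineSpace.homOfVector_over]
      rw [CommRingCat.hom_comp, CommRingCat.hom_ofHom, RingHom.comp_apply, MvPolynomial.coe_eval₂Hom,
        MvPolynomial.eval₂_C, CommRingCat.hom_ofHom, MvPolynomial.coe_eval₂Hom,
        MvPolynomial.eval₂_C, ← h1]
      rfl
    · intro a
      have h1 : φ.appTop (AffineSpace.coord U a) = W.topIso.inv (y a) :=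
        AffineSpace.homOfVector_appTop_coord _ _ _
      rw [CommRingCat.hom_comp, CommRingCat.hom_ofHom, RingHom.comp_apply, MvPolynomial.coe_eval₂Hom,
        MvPolynomial.eval₂_X, CommRingCat.hom_ofHom, MvPolynomial.coe_eval₂Hom,
        MvPolynomial.eval₂_X]
      refine (congrArg W.topIso.hom h1).trans ?_
      rw [← CommRingCat.comp_apply, Iso.inv_hom_id]
      rfl
  have : MvPolynomial.eval₂Hom (f.appLE U W h).hom y = ψ.hom.comp g := by
    rw [key]
    apply MvPolynomial.ringHom_ext
    · intro a
      have h1 : f.appLE U W h = U.topIso.inv ≫ (f.resLE U W h).appTop ≫ W.topIso.hom := by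
        have h2 : (f.resLE U W h).appTop = U.topIso.hom ≫ f.appLE U W h ≫ W.topIso.inv :=
          Scheme.Hom.resLE_app_top ..
        simp only [h2, Category.assoc, Iso.inv_hom_id_assoc, Iso.inv_hom_id, Category.comp_id]
      rw [RingHom.comp_apply, MvPolynomial.coe_eval₂Hom, MvPolynomial.eval₂_C, MvPolynomial.map_C,
        h1, CommRingCat.hom_ofHom, MvPolynomial.coe_eval₂Hom, MvPolynomial.eval₂_C]
      rfl
    · intro a
      simp [g]
  rw [this]
  exact hψ.comp hg

end AffineSpace

section Chart

variable {n : ℕ} {d : Fin n → ℤ} (P : ProjectiveBundle (splitBundle d))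

/-- The affine chart `D₊(e⁽ⁱ⁾ₖ)`. -/
def chart (i : Fin 2) (k : Fin n) : P.X.Opens := P.W i k

theorem chart_le (i : Fin 2) (k : Fin n) : chart P i k ≤ P.π ⁻¹ᵁ P1.D i := P.W_le i k

theorem iSup_chart (i : Fin 2) : ⨆ k, chart P i k = P.π ⁻¹ᵁ P1.D i := P.iSup_W i

/-- The fraction `e⁽ⁱ⁾ₗ / e⁽ⁱ⁾ₖ`. -/
def fiberRatio (i : Fin 2) (k l : Fin n) : Γ(P.X, chart P i k) := P.y i k l

theorem fiberRatio_self (i : Fin 2) (k : Fin n) : fiberRatio P i k k = 1 := P.y_self i k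

/-- The fraction `xⱼ / xᵢ` on `D₊(e⁽ⁱ⁾ₖ)`. -/
def baseRatio (i : Fin 2) (k : Fin n) (j : Fin 2) : Γ(P.X, chart P i k) :=
  (P.π.appLE (P1.D i) (chart P i k) (chart_le P i k)).hom (P1.ratio j i (P1.D i) le_rfl)

/-- The coordinate functions on `W i k`: the coordinate `xᵢ₊₁ / xᵢ` of the base, which is listed at
the position `k`, and the fractions `e⁽ⁱ⁾ₗ / e⁽ⁱ⁾ₖ` for `l ≠ k`. -/
def coord (i : Fin 2) (k l : Fin n) : Γ(P.X, chart P i k) :=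
  if l = k then baseRatio P i k (i + 1) else fiberRatio P i k l

theorem coord_self (i : Fin 2) (k : Fin n) : coord P i k k = baseRatio P i k (i + 1) := if_pos rfl

theorem coord_of_ne (i : Fin 2) {k l : Fin n} (h : l ≠ k) : coord P i k l = fiberRatio P i k l :=
  if_neg h

/-- The polynomial functions on `W i k`. -/
def chartHom (i : Fin 2) (k : Fin n) : MvPolynomial (Fin n) ℂ →+* Γ(P.X, chart P i k) :=
  MvPolynomial.eval₂Hom (constHom P.toSpec (chart P i k)) (coord P i k)

theorem isIso_chart (i : Fin 2) (k : Fin n) :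
    IsIso (AffineSpace.homOfVector (n := {l : Fin n // l ≠ k})
      (P.π.resLE (P1.D i) (chart P i k) (chart_le P i k))
      fun l ↦ (chart P i k).topIso.inv (fiberRatio P i k l.1)) :=
  P.isIso_chart i k

theorem isAffineOpen_chart (i : Fin 2) (k : Fin n) : IsAffineOpen (chart P i k) :=
  have := isIso_chart P i k
  isAffineOpen_of_isIso_homOfVector (chart_le P i k) (fun l : {l // l ≠ k} ↦ fiberRatio P i k l)
    (P1.isAffineOpen_D i)

theorem constHom_comp_appLE (i : Fin 2) (k : Fin n) :
    (P.π.appLE (P1.D i) (chart P i k) (chart_le P i k)).hom.comp (constHom P1.toSpec (P1.D i)) =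
      constHom P.toSpec (chart P i k) := by
  rw [constHom, constHom, ← CommRingCat.hom_comp, Category.assoc, Scheme.Hom.appLE_comp_appLE]
  rfl

/-- The variable with index `k` stands for the base coordinate. Moved into the coefficients, it
turns `ℂ[X₁, …, Xₙ]` into a polynomial ring over `ℂ[t]`, and `ℂ[t]` is the ring of functions on
`D₊(xᵢ)`. -/
theorem chartHom_bijective (i : Fin 2) (k : Fin n) : Function.Bijective (chartHom P i k) := by
  have := isIso_chart P i k
  have h1 := bijective_eval₂Hom_of_isIso_homOfVector (chart_le P i k)
    (fun l : {l // l ≠ k} ↦ fiberRatio P i k l) (P1.isAffineOpen_D i)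
  let e1 : MvPolynomial (Fin n) ℂ ≃+* MvPolynomial {l // l ≠ k} (Polynomial ℂ) :=
    ((MvPolynomial.renameEquiv ℂ (Equiv.optionSubtypeNe k).symm).trans
      (MvPolynomial.optionEquivRight ℂ {l // l ≠ k})).toRingEquiv
  let e2 : MvPolynomial {l // l ≠ k} (Polynomial ℂ) ≃+* MvPolynomial {l // l ≠ k} Γ(P1, P1.D i) :=
    MvPolynomial.mapEquiv _ (RingEquiv.ofBijective _ (P1.chartHom_bijective i))
  have key : chartHom P i k = (MvPolynomial.eval₂Hom (P.π.appLE (P1.D i) (chart P i k) (chart_le P i k)).hom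
      (fun l : {l // l ≠ k} ↦ fiberRatio P i k l)).comp (e2.toRingHom.comp e1.toRingHom) := by
    apply MvPolynomial.ringHom_ext
    · intro c
      simp [chartHom, e1, e2, P1.chartHom, ← constHom_comp_appLE]
    · intro l
      by_cases hl : l = k
      · subst hl
        simp [chartHom, e1, e2, P1.chartHom, coord, baseRatio]
      · simp [chartHom, e1, e2, P1.chartHom, coord, hl]
  rw [key]
  exact h1.comp ((RingEquiv.bijective e2).comp (RingEquiv.bijective e1))

end Chart

end ProjBundle

namespace ProjBundle

/-! ## Rational functions on integral schemes -/

section Rational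

variable {X : Scheme.{0}}

theorem mem_basicOpen_iff_isUnit_germ {U : X.Opens} {x : X} (hx : x ∈ U) (f : Γ(X, U)) :
    x ∈ X.basicOpen f ↔ IsUnit ((X.presheaf.germ U x hx).hom f) :=
  X.mem_basicOpen f x hx

theorem res_res {U V W : X.Opens} (h : V ≤ U) (h' : W ≤ V) (f : Γ(X, U)) :
    res h' (res h f) = res (h'.trans h) f := by
  simp only [res, ← CommRingCat.comp_apply, ← X.presheaf.map_comp]
  rfl

theorem germ_res' {U V : X.Opens} (h : V ≤ U) {x : X} (hx : x ∈ V) (f : Γ(X, U)) :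
    (X.presheaf.germ V x hx).hom (res h f) = (X.presheaf.germ U x (h hx)).hom f :=
  X.presheaf.germ_res_apply (homOfLE h) x hx f

/-- A point of an affine open subset specializes to another one if all functions vanishing at the
first one vanish at the second one. -/
theorem _root_.AlgebraicGeometry.IsAffineOpen.specializes {U : X.Opens} (hU : IsAffineOpen U)
    {y x : X} (hx : x ∈ U) (h : ∀ f : Γ(X, U), x ∈ X.basicOpen f → y ∈ X.basicOpen f) :
    y ⤳ x := by
  rw [specializes_iff_forall_open]
  intro V hV hxV
  obtain ⟨f, hf, hxf⟩ := hU.exists_basicOpen_le (V := ⟨V, hV⟩) ⟨x, hxV⟩ hx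
  exact hf (h f hxf)

theorem _root_.AlgebraicGeometry.IsAffineOpen.mem_basicOpen_fromSpec_iff {U : X.Opens}
    (hU : IsAffineOpen U) (q : PrimeSpectrum Γ(X, U)) (f : Γ(X, U)) :
    hU.fromSpec q ∈ X.basicOpen f ↔ f ∉ q.asIdeal := by
  have := hU.fromSpec_preimage_basicOpen f
  rw [← PrimeSpectrum.mem_basicOpen, ← this]
  rfl

theorem _root_.AlgebraicGeometry.IsAffineOpen.fromSpec_mem {U : X.Opens}
    (hU : IsAffineOpen U) (q : PrimeSpectrum Γ(X, U)) : hU.fromSpec q ∈ U := by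
  rw [← SetLike.mem_coe, ← hU.range_fromSpec]
  exact ⟨q, rfl⟩

theorem _root_.AlgebraicGeometry.IsAffineOpen.exists_germ_mul_eq {U : X.Opens}
    (hU : IsAffineOpen U) {x : X} (hx : x ∈ U) (z : X.presheaf.stalk x) :
    ∃ a b : Γ(X, U), x ∈ X.basicOpen b ∧
      z * (X.presheaf.germ U x hx).hom b = (X.presheaf.germ U x hx).hom a := by
  let _ := X.presheaf.algebra_section_stalk (⟨x, hx⟩ : U)
  have := hU.isLocalization_stalk ⟨x, hx⟩
  obtain ⟨⟨a, s⟩, h⟩ := IsLocalization.surj (hU.primeIdealOf ⟨x, hx⟩).asIdeal.primeCompl z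
  refine ⟨a, s, (mem_basicOpen_iff_isUnit_germ hx _).mpr ?_, h⟩
  exact IsLocalization.map_units (X.presheaf.stalk x) s

variable [IsIntegral X]

theorem genericPoint_mem {U : X.Opens} {x : X} (hx : x ∈ U) : genericPoint X ∈ U :=
  ((genericPoint_spec X).mem_open_set_iff U.isOpen).mpr ⟨x, trivial, hx⟩

/-- The rational function defined by a regular function on a nonempty open subset. -/
def toRat (U : X.Opens) (h : genericPoint X ∈ U) : Γ(X, U) →+* X.functionField :=
  (X.presheaf.germ U (genericPoint X) h).hom

theorem algebraMap_germ {U : X.Opens} {x : X} (hx : x ∈ U) (f : Γ(X, U)) :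
    algebraMap (X.presheaf.stalk x) X.functionField ((X.presheaf.germ U x hx).hom f) =
      toRat U (genericPoint_mem hx) f := by
  have : Nonempty U := ⟨⟨x, hx⟩⟩
  exact X.algebraMap_germ_eq_germToFunctionField hx f

theorem toRat_res {U V : X.Opens} (h : V ≤ U) (hV : genericPoint X ∈ V) (f : Γ(X, U)) :
    toRat V hV (res h f) = toRat U (h hV) f :=
  germ_res' h hV f

theorem toRat_injective {U : X.Opens} (h : genericPoint X ∈ U) : Function.Injective (toRat U h) :=
  germ_injective_of_isIntegral X _ h

/-- The rational function `u` is regular at `x`. -/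
def IsRegAt (x : X) (u : X.functionField) : Prop :=
  ∃ a, algebraMap (X.presheaf.stalk x) X.functionField a = u

/-- The rational function `u` is regular and nonzero at `x`. -/
def IsUnitAt (x : X) (u : X.functionField) : Prop :=
  ∃ a, IsUnit a ∧ algebraMap (X.presheaf.stalk x) X.functionField a = u

open Classical in
/-- The value at `x` of a rational function that is regular at `x`. -/
def valueAt (x : X) (u : X.functionField) : X.residueField x :=
  if h : IsRegAt x u then (X.residue x).hom h.choose else 0

theorem algebraMap_stalk_injective (x : X) :
    Function.Injective (algebraMap (X.presheaf.stalk x) X.functionField) :=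
  IsFractionRing.injective _ _

theorem valueAt_algebraMap (x : X) (a : X.presheaf.stalk x) :
    valueAt x (algebraMap _ _ a) = (X.residue x).hom a := by
  have h : IsRegAt x (algebraMap (X.presheaf.stalk x) X.functionField a) := ⟨a, rfl⟩
  rw [valueAt, dif_pos h]
  congr 1
  exact algebraMap_stalk_injective x h.choose_spec

theorem valueAt_toRat {U : X.Opens} {x : X} (hx : x ∈ U) (f : Γ(X, U)) :
    valueAt x (toRat U (genericPoint_mem hx) f) = (X.evaluation U x hx).hom f := by
  rw [← algebraMap_germ hx, valueAt_algebraMap]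
  rfl

theorem isRegAt_toRat {U : X.Opens} {x : X} (hx : x ∈ U) (f : Γ(X, U)) :
    IsRegAt x (toRat U (genericPoint_mem hx) f) := ⟨_, algebraMap_germ hx f⟩

variable {x : X} {u v : X.functionField}

theorem IsUnitAt.isRegAt (h : IsUnitAt x u) : IsRegAt x u := ⟨h.choose, h.choose_spec.2⟩

theorem IsUnitAt.ne_zero (h : IsUnitAt x u) : u ≠ 0 := by
  obtain ⟨a, ha, rfl⟩ := h
  exact (ha.map _).ne_zero

theorem IsRegAt.mul (hu : IsRegAt x u) (hv : IsRegAt x v) : IsRegAt x (u * v) := by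
  obtain ⟨a, rfl⟩ := hu
  obtain ⟨b, rfl⟩ := hv
  exact ⟨a * b, map_mul _ _ _⟩

theorem IsRegAt.pow (hu : IsRegAt x u) (m : ℕ) : IsRegAt x (u ^ m) := by
  obtain ⟨a, rfl⟩ := hu
  exact ⟨a ^ m, map_pow _ _ _⟩

theorem IsUnitAt.mul (hu : IsUnitAt x u) (hv : IsUnitAt x v) : IsUnitAt x (u * v) := by
  obtain ⟨a, ha, rfl⟩ := hu
  obtain ⟨b, hb, rfl⟩ := hv
  exact ⟨a * b, ha.mul hb, map_mul _ _ _⟩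

theorem IsUnitAt.inv (hu : IsUnitAt x u) : IsUnitAt x u⁻¹ := by
  obtain ⟨_, ⟨a, rfl⟩, rfl⟩ := hu
  exact ⟨↑a⁻¹, Units.isUnit _, by simp [map_units_inv]⟩

theorem IsUnitAt.div (hu : IsUnitAt x u) (hv : IsUnitAt x v) : IsUnitAt x (u / v) := by
  rw [div_eq_mul_inv]; exact hu.mul hv.inv

theorem isUnitAt_one : IsUnitAt x 1 := ⟨1, isUnit_one, map_one _⟩

theorem IsUnitAt.pow (hu : IsUnitAt x u) (m : ℕ) : IsUnitAt x (u ^ m) := by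
  obtain ⟨a, ha, rfl⟩ := hu
  exact ⟨a ^ m, ha.pow m, map_pow _ _ _⟩

theorem IsUnitAt.zpow (hu : IsUnitAt x u) (m : ℤ) : IsUnitAt x (u ^ m) := by
  cases m with
  | ofNat m => simpa using hu.pow m
  | negSucc m => rw [zpow_negSucc]; exact (hu.pow _).inv

theorem IsRegAt.isUnitAt (hu : IsRegAt x u) (h : valueAt x u ≠ 0) : IsUnitAt x u := by
  obtain ⟨a, rfl⟩ := hu
  refine ⟨a, ?_, rfl⟩
  rw [valueAt_algebraMap] at h
  by_contra hcon
  exact h (Ideal.Quotient.eq_zero_iff_mem.mpr ((IsLocalRing.mem_maximalIdeal a).mpr hcon))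

theorem isUnitAt_of_isRegAt_inv (h0 : u ≠ 0) (hu : IsRegAt x u) (hv : IsRegAt x u⁻¹) :
    IsUnitAt x u := by
  obtain ⟨a, ha⟩ := hu
  obtain ⟨b, hb⟩ := hv
  refine ⟨a, .of_mul_eq_one b (algebraMap_stalk_injective x ?_), ha⟩
  rw [map_mul, ha, hb, map_one, mul_inv_cancel₀ h0]

theorem valueAt_mul (hu : IsRegAt x u) (hv : IsRegAt x v) :
    valueAt x (u * v) = valueAt x u * valueAt x v := by
  obtain ⟨a, rfl⟩ := hu
  obtain ⟨b, rfl⟩ := hv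
  rw [← map_mul, valueAt_algebraMap, valueAt_algebraMap, valueAt_algebraMap, map_mul]

theorem valueAt_one : valueAt x (1 : X.functionField) = 1 := by
  rw [← map_one (algebraMap (X.presheaf.stalk x) X.functionField), valueAt_algebraMap, map_one]

theorem valueAt_pow (hu : IsRegAt x u) (m : ℕ) : valueAt x (u ^ m) = valueAt x u ^ m := by
  obtain ⟨a, rfl⟩ := hu
  rw [← map_pow, valueAt_algebraMap, valueAt_algebraMap, map_pow]

theorem IsUnitAt.valueAt_ne_zero (hu : IsUnitAt x u) : valueAt x u ≠ 0 := by
  obtain ⟨a, ha, rfl⟩ := hu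
  rw [valueAt_algebraMap]
  exact (ha.map _).ne_zero

theorem valueAt_inv (hu : IsUnitAt x u) : valueAt x u⁻¹ = (valueAt x u)⁻¹ := by
  apply eq_inv_of_mul_eq_one_left
  rw [← valueAt_mul hu.inv.isRegAt hu.isRegAt,
    inv_mul_cancel₀ hu.ne_zero, valueAt_one]

theorem valueAt_div (hu : IsRegAt x u) (hv : IsUnitAt x v) :
    valueAt x (u / v) = valueAt x u / valueAt x v := by
  rw [div_eq_mul_inv, valueAt_mul hu hv.inv.isRegAt, valueAt_inv hv, div_eq_mul_inv]

theorem valueAt_zpow (hu : IsUnitAt x u) (m : ℤ) : valueAt x (u ^ m) = valueAt x u ^ m := by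
  cases m with
  | ofNat m => simpa using valueAt_pow hu.isRegAt m
  | negSucc m => rw [zpow_negSucc, zpow_negSucc, valueAt_inv (hu.pow _), valueAt_pow hu.isRegAt]

theorem algebraMap_stalkSpecializes {y : X} (h : y ⤳ x) (a : X.presheaf.stalk x) :
    algebraMap (X.presheaf.stalk y) X.functionField ((X.presheaf.stalkSpecializes h).hom a) =
      algebraMap (X.presheaf.stalk x) X.functionField a := by
  simp only [RingHom.algebraMap_toAlgebra]
  rw [← CommRingCat.comp_apply, X.presheaf.stalkSpecializes_comp]

theorem IsRegAt.specializes {y : X} (h : y ⤳ x) (hu : IsRegAt x u) : IsRegAt y u := by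
  obtain ⟨a, rfl⟩ := hu
  exact ⟨_, algebraMap_stalkSpecializes h a⟩

theorem IsUnitAt.specializes {y : X} (h : y ⤳ x) (hu : IsUnitAt x u) : IsUnitAt y u := by
  obtain ⟨a, ha, rfl⟩ := hu
  exact ⟨_, ha.map _, algebraMap_stalkSpecializes h a⟩

theorem isUnitAt_toRat_iff {U : X.Opens} (hx : x ∈ U) (f : Γ(X, U)) :
    IsUnitAt x (toRat U (genericPoint_mem hx) f) ↔ x ∈ X.basicOpen f := by
  rw [mem_basicOpen_iff_isUnit_germ hx]
  constructor
  · rintro ⟨a, ha, h⟩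
    rw [← algebraMap_germ hx] at h
    rwa [← algebraMap_stalk_injective x h]
  · exact fun h ↦ ⟨_, h, algebraMap_germ hx f⟩

/-- A rational function that is regular at a point of an affine open subset is a fraction whose
denominator does not vanish at that point. -/
theorem IsRegAt.exists_eq_div {U : X.Opens} (hU : IsAffineOpen U) (hx : x ∈ U)
    (hu : IsRegAt x u) : ∃ a b : Γ(X, U), x ∈ X.basicOpen b ∧
      u * toRat U (genericPoint_mem hx) b = toRat U (genericPoint_mem hx) a := by
  obtain ⟨z, rfl⟩ := hu
  obtain ⟨a, b, hb, h⟩ := hU.exists_germ_mul_eq hx z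
  refine ⟨a, b, hb, ?_⟩
  rw [← algebraMap_germ hx, ← algebraMap_germ hx, ← map_mul, h]

end Rational

end ProjBundle

namespace ProjBundle

/-! ## Incidence of the charts -/

theorem isPreirreducible_of_isDomain {X : Scheme.{0}} {U : X.Opens} (hU : IsAffineOpen U)
    [IsDomain Γ(X, U)] : IsPreirreducible (U : Set X) := by
  rw [← hU.range_fromSpec, ← Set.image_univ]
  exact (PreirreducibleSpace.isPreirreducible_univ (X := Spec Γ(X, U))).image _
    hU.fromSpec.continuous.continuousOn

theorem _root_.AlgebraicGeometry.IsAffineOpen.exists_mem_basicOpen {X : Scheme.{0}} {U : X.Opens}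
    (hU : IsAffineOpen U) [IsDomain Γ(X, U)] {f : Γ(X, U)} (hf : f ≠ 0) :
    ∃ x, x ∈ X.basicOpen f :=
  ⟨hU.fromSpec (⊥ : PrimeSpectrum Γ(X, U)), (hU.mem_basicOpen_fromSpec_iff _ f).mpr hf⟩

/-- Stalks are localizations of domains, hence reduced. For irreducibility, a nonempty open set that
meets one chart meets its overlap with any other chart, because each chart is irreducible. -/
theorem isIntegral_of_affine_cover {X : Scheme.{0}} {ι : Type*} [Nonempty ι] (U : ι → X.Opens)
    (hcov : ∀ x, ∃ i, x ∈ U i) (hU : ∀ i, IsAffineOpen (U i)) [∀ i, IsDomain Γ(X, U i)]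
    (hne : ∀ i j, ((U i : Set X) ∩ U j).Nonempty) : IsIntegral X := by
  have hred : IsReduced X := by
    have : ∀ x, _root_.IsReduced (X.presheaf.stalk x) := fun x ↦ by
      obtain ⟨i, hx⟩ := hcov x
      let _ := X.presheaf.algebra_section_stalk (⟨x, hx⟩ : U i)
      have := (hU i).isLocalization_stalk ⟨x, hx⟩
      exact isReduced_localizationPreserves
        ((hU i).primeIdealOf ⟨x, hx⟩).asIdeal.primeCompl _ inferInstance
    exact isReduced_of_isReduced_stalk X
  have hirr : PreirreducibleSpace X := by
    refine ⟨fun V₁ V₂ h₁ h₂ ⟨x, _, hx⟩ ⟨y, _, hy⟩ ↦ ?_⟩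
    obtain ⟨i, hi⟩ := hcov x
    obtain ⟨j, hj⟩ := hcov y
    obtain ⟨z, hz, hz₁, hz₂⟩ := isPreirreducible_of_isDomain (hU i) V₁ (U j) h₁ (U j).isOpen
      ⟨x, hi, hx⟩ (hne i j)
    obtain ⟨w, hw, hw₁, hw₂⟩ := isPreirreducible_of_isDomain (hU j) V₁ V₂ h₁ h₂
      ⟨z, hz₂, hz₁⟩ ⟨y, hj, hy⟩
    exact ⟨w, trivial, hw₁, hw₂⟩
  have : Nonempty X := by
    obtain ⟨x, _⟩ := hne (Classical.arbitrary ι) (Classical.arbitrary ι)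
    exact ⟨x⟩
  have : IrreducibleSpace X := { toNonempty := this }
  exact isIntegral_of_irreducibleSpace_of_isReduced X

theorem mem_basicOpen_mul {X : Scheme.{0}} {U : X.Opens} {f g : Γ(X, U)} {x : X} :
    x ∈ X.basicOpen (f * g) ↔ x ∈ X.basicOpen f ∧ x ∈ X.basicOpen g := by
  rw [X.basicOpen_mul]; rfl

theorem basicOpen_appLE {X Y : Scheme.{0}} (f : X ⟶ Y) {U : Y.Opens} {V : X.Opens}
    (h : V ≤ f ⁻¹ᵁ U) (s : Γ(Y, U)) :
    X.basicOpen ((f.appLE U V h).hom s) = V ⊓ f ⁻¹ᵁ Y.basicOpen s := by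
  rw [Scheme.Hom.appLE, CommRingCat.comp_apply, Scheme.basicOpen_res, Scheme.preimage_basicOpen]

theorem _root_.Fin.eq_or_eq_add_one (i j : Fin 2) : j = i ∨ j = i + 1 := by decide +revert

theorem map_val_zpow {A F : Type*} [CommRing A] [Field F] (f : A →+* F) (u : Aˣ) (m : ℤ) :
    f ((u ^ m : Aˣ) : A) = f u ^ m := by
  have := congrArg Units.val (map_zpow (Units.map f.toMonoidHom) u m)
  rwa [Units.val_zpow_eq_zpow_val] at this

theorem appLE_res {X Y : Scheme.{0}} (f : X ⟶ Y) {U U' : Y.Opens} {V V' : X.Opens}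
    (h : V ≤ f ⁻¹ᵁ U) (h' : V' ≤ f ⁻¹ᵁ U') (hU : U' ≤ U) (hV : V' ≤ V) (s : Γ(Y, U)) :
    (f.appLE U' V' h').hom (res hU s) = res hV ((f.appLE U V h).hom s) := by
  rw [res, res, ← CommRingCat.comp_apply, ← CommRingCat.comp_apply,
    Scheme.Hom.map_appLE, Scheme.Hom.appLE_map]

theorem P1.mem_D_iff (i j : Fin 2) {x : P1} (hx : x ∈ P1.D i) :
    x ∈ P1.D j ↔ x ∈ P1.basicOpen (P1.ratio j i (P1.D i) le_rfl) := by
  rw [mem_basicOpen_iff_isUnit_germ hx]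
  constructor
  · intro h
    have h2 := ((P1.unit j i (P1.D i ⊓ P1.D j) inf_le_right inf_le_left).isUnit).map
      (P1.presheaf.germ (P1.D i ⊓ P1.D j) x ⟨hx, h⟩).hom
    have h3 := germ_res' (X := P1) (inf_le_left : P1.D i ⊓ P1.D j ≤ P1.D i) ⟨hx, h⟩
      (P1.ratio j i (P1.D i) le_rfl)
    rw [← h3]
    exact h2
  · intro h
    have h1 : IsUnit (P1.ratioAt j i (P1.D i) le_rfl ⟨x, hx⟩) := by
      have h2 := h.map (Proj.stalkIso' grading x)
      exact (congrArg IsUnit (Proj.stalkIso'_germ grading (P1.D i) x hx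
        (P1.ratio j i (P1.D i) le_rfl))).mp h2
    rw [← HomogeneousLocalization.isUnit_iff_isUnit_val, P1.ratioAt, HomogeneousLocalization.val_mk,
      Localization.mk_eq_mk', IsLocalization.AtPrime.isUnit_mk'_iff] at h1
    exact h1

section Chart

variable {n : ℕ} {d : Fin n → ℤ} (P : ProjectiveBundle (splitBundle d))

theorem exists_mem_chart (x : P.X) : ∃ i k, x ∈ chart P i k := by
  have h : P.π x ∈ ⨆ i, P1.D i := by rw [P1.iSup_D]; trivial
  obtain ⟨i, hi⟩ := TopologicalSpace.Opens.mem_iSup.mp h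
  have h2 : x ∈ ⨆ k, chart P i k := by rw [iSup_chart]; exact hi
  obtain ⟨k, hk⟩ := TopologicalSpace.Opens.mem_iSup.mp h2
  exact ⟨i, k, hk⟩

theorem mem_preimage_D_iff (i j : Fin 2) (k : Fin n) {x : P.X} (hx : x ∈ chart P i k) :
    P.π x ∈ P1.D j ↔ x ∈ P.X.basicOpen (baseRatio P i k j) := by
  rw [P1.mem_D_iff i j (chart_le P i k hx), baseRatio, basicOpen_appLE]
  exact ⟨fun h ↦ ⟨hx, h⟩, fun h ↦ h.2⟩

/-- The fraction `e⁽ʲ⁾ₗ / e⁽ⁱ⁾ₖ` on the part of `D₊(e⁽ⁱ⁾ₖ)` over `D₊(xⱼ)`. -/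
def mixedRatio (i : Fin 2) (k : Fin n) (j : Fin 2) (l : Fin n) :
    Γ(P.X, chart P i k ⊓ P.π ⁻¹ᵁ P1.D j) := P.s i k j l

/-- The invertible function `xⱼ / xᵢ` on the part of `D₊(e⁽ⁱ⁾ₖ)` over `D₊(xⱼ)`. -/
def baseUnit (i : Fin 2) (k : Fin n) (j : Fin 2) : Γ(P.X, chart P i k ⊓ P.π ⁻¹ᵁ P1.D j)ˣ :=
  Units.map (P.π.appLE (P1.D j ⊓ P1.D i) (chart P i k ⊓ P.π ⁻¹ᵁ P1.D j)
      (le_inf inf_le_right (inf_le_left.trans (chart_le P i k)))).hom.toMonoidHom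
    (P1.unit j i (P1.D j ⊓ P1.D i) inf_le_left inf_le_right)

theorem coe_baseUnit (i : Fin 2) (k : Fin n) (j : Fin 2) :
    (baseUnit P i k j : Γ(P.X, chart P i k ⊓ P.π ⁻¹ᵁ P1.D j)) =
      res inf_le_left (baseRatio P i k j) := by
  have h : P1.ratio j i (P1.D j ⊓ P1.D i) inf_le_right =
    res inf_le_right (P1.ratio j i (P1.D i) le_rfl) := rfl
  refine (congrArg (P.π.appLE (P1.D j ⊓ P1.D i) (chart P i k ⊓ P.π ⁻¹ᵁ P1.D j)
    (le_inf inf_le_right (inf_le_left.trans (chart_le P i k)))).hom h).trans ?_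
  exact appLE_res _ _ _ _ _ _

/-- The transition matrices are diagonal, so a single summand of `s_eq` survives. -/
theorem mixedRatio_eq (i : Fin 2) (k : Fin n) (j : Fin 2) (l : Fin n) :
    mixedRatio P i k j l = ((baseUnit P i k j ^ d l : _ˣ) : Γ(P.X, _)) *
      res inf_le_left (fiberRatio P i k l) := by
  refine (P.s_eq i k j l).trans ((Finset.sum_eq_single l (fun m _ hm ↦ ?_) (by simp)).trans ?_)
  · have h : ((splitBundle d).g j i).1 l m = 0 := Matrix.diagonal_apply_ne _ hm.symm
    rw [h, map_zero, zero_mul]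
  · have h : ((splitBundle d).g j i).1 l l = ((P1.unit j i (P1.D j ⊓ P1.D i) inf_le_left
        inf_le_right ^ d l : Γ(P1, P1.D j ⊓ P1.D i)ˣ) : Γ(P1, P1.D j ⊓ P1.D i)) :=
      Matrix.diagonal_apply_eq (fun k ↦ ((P1.unit j i (P1.D j ⊓ P1.D i) inf_le_left
        inf_le_right ^ d k : Γ(P1, P1.D j ⊓ P1.D i)ˣ) : Γ(P1, P1.D j ⊓ P1.D i))) l
    rw [h, baseUnit, ← map_zpow]
    rfl

theorem chart_inf_chart (i : Fin 2) (k : Fin n) (j : Fin 2) (l : Fin n) :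
    chart P i k ⊓ chart P j l = P.X.basicOpen (mixedRatio P i k j l) := P.overlap i k j l

theorem res_mixedRatio (i : Fin 2) (k : Fin n) (j : Fin 2) (l m : Fin n) :
    res (le_inf inf_le_left (inf_le_right.trans (chart_le P j l)) :
      chart P i k ⊓ chart P j l ≤ chart P i k ⊓ P.π ⁻¹ᵁ P1.D j) (mixedRatio P i k j m) =
    res (inf_le_right : chart P i k ⊓ chart P j l ≤ chart P j l) (fiberRatio P j l m) *
    res (le_inf inf_le_left (inf_le_right.trans (chart_le P j l)) :
      chart P i k ⊓ chart P j l ≤ chart P i k ⊓ P.π ⁻¹ᵁ P1.D j) (mixedRatio P i k j l) :=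
  P.transition i k j l m

/-- The overlap is the nonvanishing locus of the mixed ratio, in which the power of `xⱼ / xᵢ` is
invertible and can be dropped. -/
theorem mem_chart_iff (i : Fin 2) (k : Fin n) (j : Fin 2) (l : Fin n) {x : P.X}
    (hx : x ∈ chart P i k) :
    x ∈ chart P j l ↔ x ∈ P.X.basicOpen (baseRatio P i k j) ∧
      x ∈ P.X.basicOpen (fiberRatio P i k l) := by
  rw [← mem_preimage_D_iff P i j k hx]
  have h1 : x ∈ chart P j l ↔ x ∈ P.X.basicOpen (mixedRatio P i k j l) := by
    rw [← chart_inf_chart]; exact ⟨fun h ↦ ⟨hx, h⟩, fun h ↦ h.2⟩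
  rw [h1, mixedRatio_eq, mem_basicOpen_mul, Scheme.basicOpen_of_isUnit _ (Units.isUnit _),
    res, Scheme.basicOpen_res]
  exact ⟨fun h ↦ ⟨h.1.2, h.2.2⟩, fun h ↦ ⟨⟨hx, h.1⟩, ⟨⟨hx, h.1⟩, h.2⟩⟩⟩


theorem isDomain_chart (i : Fin 2) (k : Fin n) : IsDomain Γ(P.X, chart P i k) :=
  (RingEquiv.ofBijective _ (chartHom_bijective P i k)).symm.injective.isDomain
    (RingEquiv.ofBijective _ (chartHom_bijective P i k)).symm.toRingHom

theorem chartHom_C (i : Fin 2) (k : Fin n) (c : ℂ) :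
    chartHom P i k (MvPolynomial.C c) = constHom P.toSpec (chart P i k) c :=
  MvPolynomial.eval₂Hom_C _ _ _

theorem chartHom_X (i : Fin 2) (k l : Fin n) : chartHom P i k (MvPolynomial.X l) = coord P i k l :=
  MvPolynomial.eval₂Hom_X' _ _ _

theorem coord_ne_zero (i : Fin 2) (k l : Fin n) : coord P i k l ≠ 0 := by
  rw [← chartHom_X, Ne, map_eq_zero_iff _ (chartHom_bijective P i k).injective]
  exact MvPolynomial.X_ne_zero l

theorem baseRatio_self (i : Fin 2) (k : Fin n) : baseRatio P i k i = 1 := by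
  rw [baseRatio, P1.ratio_self, map_one]

theorem baseRatio_ne_zero (i : Fin 2) (k : Fin n) (j : Fin 2) : baseRatio P i k j ≠ 0 := by
  have := isDomain_chart P i k
  obtain rfl | rfl : j = i ∨ j = i + 1 := Fin.eq_or_eq_add_one i j
  · rw [baseRatio_self]; exact one_ne_zero
  · rw [← coord_self]; exact coord_ne_zero P i k k

theorem fiberRatio_ne_zero (i : Fin 2) (k l : Fin n) : fiberRatio P i k l ≠ 0 := by
  have := isDomain_chart P i k
  by_cases h : l = k
  · subst h; rw [fiberRatio_self]; exact one_ne_zero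
  · rw [← coord_of_ne P i h]; exact coord_ne_zero P i k l

/-- Any two charts meet: inside one chart the overlap is the nonvanishing locus of two nonzero
functions on a domain. `NeZero n` ensures that there is a chart. -/
instance isIntegral_projectiveBundle [NeZero n] : IsIntegral P.X := by
  have : ∀ a : Fin 2 × Fin n, IsDomain Γ(P.X, chart P a.1 a.2) := fun a ↦ isDomain_chart P a.1 a.2
  refine isIntegral_of_affine_cover (fun a : Fin 2 × Fin n ↦ chart P a.1 a.2)
    (fun x ↦ ?_) (fun a ↦ isAffineOpen_chart P a.1 a.2) fun a b ↦ ?_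
  · obtain ⟨i, k, h⟩ := exists_mem_chart P x
    exact ⟨(i, k), h⟩
  · obtain ⟨x, hx⟩ := (isAffineOpen_chart P a.1 a.2).exists_mem_basicOpen
      (mul_ne_zero (baseRatio_ne_zero P a.1 a.2 b.1) (fiberRatio_ne_zero P a.1 a.2 b.2))
    rw [mem_basicOpen_mul] at hx
    have hx' := P.X.basicOpen_le _ hx.1
    exact ⟨x, hx', (mem_chart_iff P _ _ _ _ hx').mpr hx⟩

variable [NeZero n]

theorem genericPoint_mem_chart (i : Fin 2) (k : Fin n) : genericPoint P.X ∈ chart P i k :=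
  have := isDomain_chart P i k
  have ⟨_, hx⟩ := (isAffineOpen_chart P i k).exists_mem_basicOpen (f := 1) one_ne_zero
  genericPoint_mem (P.X.basicOpen_le _ hx)

/-- The rational function defined by a regular function on a chart. -/
def chartRat (i : Fin 2) (k : Fin n) : Γ(P.X, chart P i k) →+* P.X.functionField :=
  toRat (chart P i k) (genericPoint_mem_chart P i k)

theorem chartRat_injective (i : Fin 2) (k : Fin n) : Function.Injective (chartRat P i k) :=
  toRat_injective _

/-- The rational function `xⱼ / x₀`. -/
def baseRat (j : Fin 2) : P.X.functionField := chartRat P 0 0 (baseRatio P 0 0 j)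

/-- The rational function `e⁽ⁱ⁾ₖ / e⁽⁰⁾₀`. -/
def fiberRat (i : Fin 2) (k : Fin n) : P.X.functionField :=
  baseRat P i ^ d k * chartRat P 0 0 (fiberRatio P 0 0 k)

theorem genericPoint_mem_D (i : Fin 2) : P.π (genericPoint P.X) ∈ P1.D i :=
  chart_le P i 0 (genericPoint_mem_chart P i 0)

/-- The right side does not mention `k`: a function pulled back from the base gives the same
rational function on every fibre chart. -/
theorem chartRat_baseRatio_eq (i : Fin 2) (k : Fin n) (j : Fin 2) :
    chartRat P i k (baseRatio P i k j) = toRat (P.π ⁻¹ᵁ P1.D i) (genericPoint_mem_D P i)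
      ((P.π.app (P1.D i)).hom (P1.ratio j i (P1.D i) le_rfl)) := by
  rw [chartRat, baseRatio, ← toRat_res (chart_le P i k) (genericPoint_mem_chart P i k)]
  rfl

theorem toRat_app_res {U V : P1.Opens} (h : V ≤ U) (hV : P.π (genericPoint P.X) ∈ V) (s : Γ(P1, U)) :
    toRat (P.π ⁻¹ᵁ V) hV ((P.π.app V).hom (res h s)) =
      toRat (P.π ⁻¹ᵁ U) (h hV) ((P.π.app U).hom s) := by
  rw [← toRat_res (P.π.preimage_mono h) hV]
  congr 1
  rw [res, res, ← CommRingCat.comp_apply, ← CommRingCat.comp_apply, Scheme.Hom.naturality]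
  rfl

theorem chartRat_baseRatio_mul (i j j' : Fin 2) (k k' : Fin n) :
    chartRat P j k (baseRatio P j k i) * chartRat P j' k' (baseRatio P j' k' j) =
      chartRat P j' k (baseRatio P j' k i) := by
  have hV : P.π (genericPoint P.X) ∈ P1.D j ⊓ P1.D j' :=
    ⟨genericPoint_mem_D P j, genericPoint_mem_D P j'⟩
  simp only [chartRat_baseRatio_eq]
  rw [← toRat_app_res P (inf_le_left : P1.D j ⊓ P1.D j' ≤ P1.D j) hV,
    ← toRat_app_res P (inf_le_right : P1.D j ⊓ P1.D j' ≤ P1.D j') hV,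
    ← toRat_app_res P (inf_le_right : P1.D j ⊓ P1.D j' ≤ P1.D j') hV, ← map_mul, ← map_mul]
  congr 2
  exact P1.ratio_mul i j j' (P1.D j ⊓ P1.D j') inf_le_left inf_le_right

theorem chartRat_baseRatio_ne_zero (i : Fin 2) (k : Fin n) (j : Fin 2) :
    chartRat P i k (baseRatio P i k j) ≠ 0 :=
  (map_ne_zero_iff _ (chartRat_injective P i k)).mpr (baseRatio_ne_zero P i k j)

theorem baseRat_ne_zero (j : Fin 2) : baseRat P j ≠ 0 := chartRat_baseRatio_ne_zero P 0 0 j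

theorem fiberRat_ne_zero (i : Fin 2) (k : Fin n) : fiberRat P i k ≠ 0 :=
  mul_ne_zero (zpow_ne_zero _ (baseRat_ne_zero P i))
    ((map_ne_zero_iff _ (chartRat_injective P 0 0)).mpr (fiberRatio_ne_zero P 0 0 k))

theorem baseRat_zero : baseRat P 0 = 1 := by rw [baseRat, baseRatio_self, map_one]

theorem fiberRat_zero_zero : fiberRat P 0 0 = 1 := by
  rw [fiberRat, fiberRatio_self, map_one, baseRat_zero, one_zpow, mul_one]

theorem fiberRat_eq (i j : Fin 2) (k : Fin n) :
    fiberRat P i k = (baseRat P i / baseRat P j) ^ d k * fiberRat P j k := by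
  rw [fiberRat, fiberRat, div_zpow, ← mul_assoc,
    div_mul_cancel₀ _ (zpow_ne_zero _ (baseRat_ne_zero P j))]

theorem chartRat_baseRatio (i : Fin 2) (k : Fin n) (j : Fin 2) :
    chartRat P i k (baseRatio P i k j) = baseRat P j / baseRat P i := by
  rw [eq_div_iff (baseRat_ne_zero P i), baseRat, baseRat, chartRat_baseRatio_mul,
    chartRat_baseRatio_eq, chartRat_baseRatio_eq]

theorem chartRat_transition (i : Fin 2) (k : Fin n) (j : Fin 2) (l m : Fin n) :
    chartRat P i k (baseRatio P i k j) ^ d m * chartRat P i k (fiberRatio P i k m) =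
      chartRat P j l (fiberRatio P j l m) * (chartRat P i k (baseRatio P i k j) ^ d l *
        chartRat P i k (fiberRatio P i k l)) := by
  have hη : genericPoint P.X ∈ chart P i k ⊓ chart P j l :=
    ⟨genericPoint_mem_chart P i k, genericPoint_mem_chart P j l⟩
  have hη' : genericPoint P.X ∈ chart P i k ⊓ P.π ⁻¹ᵁ P1.D j :=
    ⟨genericPoint_mem_chart P i k, genericPoint_mem_D P j⟩
  have h := congrArg (toRat _ hη) (res_mixedRatio P i k j l m)
  have key : ∀ m, toRat _ hη' (mixedRatio P i k j m) =
      chartRat P i k (baseRatio P i k j) ^ d m * chartRat P i k (fiberRatio P i k m) := by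
    intro m
    rw [mixedRatio_eq, map_mul, toRat_res, map_val_zpow, coe_baseUnit, toRat_res]
    rfl
  rw [map_mul, toRat_res, toRat_res, toRat_res, key, key] at h
  exact h

/-- The gluing relation between the chart `(0, 0)` and the chart `(i, k)`. Together with
`chartRat_baseRatio` it reduces computations with charts to arithmetic of `baseRat` and `fiberRat`
in one field. -/
theorem chartRat_fiberRatio (i : Fin 2) (k l : Fin n) :
    chartRat P i k (fiberRatio P i k l) = fiberRat P i l / fiberRat P i k := by
  rw [eq_div_iff (fiberRat_ne_zero P i k)]
  exact (chartRat_transition P 0 0 i k l).symm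

/-- The coordinate functions as rational functions. -/
def coordRat (i : Fin 2) (k l : Fin n) : P.X.functionField := chartRat P i k (coord P i k l)

theorem coordRat_self (i : Fin 2) (k : Fin n) :
    coordRat P i k k = baseRat P (i + 1) / baseRat P i := by
  rw [coordRat, coord_self, chartRat_baseRatio]

theorem coordRat_of_ne (i : Fin 2) {k l : Fin n} (h : l ≠ k) :
    coordRat P i k l = fiberRat P i l / fiberRat P i k := by
  rw [coordRat, coord_of_ne P i h, chartRat_fiberRatio]

theorem isUnitAt_chartRat_iff {i : Fin 2} {k : Fin n} {x : P.X} (hx : x ∈ chart P i k)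
    (f : Γ(P.X, chart P i k)) : IsUnitAt x (chartRat P i k f) ↔ x ∈ P.X.basicOpen f :=
  isUnitAt_toRat_iff hx f

theorem isRegAt_chartRat {i : Fin 2} {k : Fin n} {x : P.X} (hx : x ∈ chart P i k)
    (f : Γ(P.X, chart P i k)) : IsRegAt x (chartRat P i k f) :=
  isRegAt_toRat hx f

theorem isRegAt_baseRat {i : Fin 2} {k : Fin n} {x : P.X} (hx : x ∈ chart P i k) (j : Fin 2) :
    IsRegAt x (baseRat P j / baseRat P i) :=
  chartRat_baseRatio P i k j ▸ isRegAt_chartRat P hx _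

theorem isRegAt_fiberRat {i : Fin 2} {k : Fin n} {x : P.X} (hx : x ∈ chart P i k) (l : Fin n) :
    IsRegAt x (fiberRat P i l / fiberRat P i k) :=
  chartRat_fiberRatio P i k l ▸ isRegAt_chartRat P hx _

theorem mem_chart_iff_isUnitAt {i : Fin 2} {k : Fin n} {x : P.X} (hx : x ∈ chart P i k)
    (j : Fin 2) (l : Fin n) :
    x ∈ chart P j l ↔ IsUnitAt x (baseRat P j / baseRat P i) ∧
      IsUnitAt x (fiberRat P i l / fiberRat P i k) := by
  rw [mem_chart_iff P i k j l hx, ← isUnitAt_chartRat_iff P hx, ← isUnitAt_chartRat_iff P hx,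
    chartRat_baseRatio, chartRat_fiberRatio]

end Chart

end ProjBundle

namespace ProjBundle

/-! ## Function fields of curves and centers of places -/

section Field

variable {X : Scheme.{0}} (p : X ⟶ Spec (.of ℂ))

theorem germ_constHom {U : X.Opens} {x : X} (hx : x ∈ U) (c : ℂ) :
    (X.presheaf.germ U x hx).hom (constHom p U c) = stalkHom p x c := by
  have h : ∀ {R S : CommRingCat.{0}} (f : Spec S ⟶ Spec R), Spec.preimage f =
      (Scheme.ΓSpecIso R).inv ≫ f.appTop ≫ (Scheme.ΓSpecIso S).hom := by
    intro R S f
    obtain ⟨g, rfl⟩ := Spec.map_surjective f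
    rw [Spec.preimage_map, Scheme.ΓSpecIso_naturality, Iso.inv_hom_id_assoc]
  have h2 : Spec.preimage (X.fromSpecStalk x ≫ p) =
      CommRingCat.ofHom (constHom p U) ≫ X.presheaf.germ U x hx := by
    rw [h, Scheme.Hom.comp_appTop, constHom, CommRingCat.ofHom_hom, Scheme.fromSpecStalk_appTop]
    have e : (Spec (X.presheaf.stalk x)).presheaf.map (homOfLE (le_top (a := ⊤))).op = 𝟙 _ :=
      (Spec (X.presheaf.stalk x)).presheaf.map_id _
    have e2 : p.appLE ⊤ U (le_preimage_top p U) = p.appTop ≫ X.presheaf.map (homOfLE le_top).op := rfl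
    rw [e, Category.comp_id, e2]
    simp
  rw [stalkHom, h2]
  rfl

theorem evaluation_constHom {U : X.Opens} {x : X} (hx : x ∈ U) (c : ℂ) :
    (X.evaluation U x hx).hom (constHom p U c) = residueHom p x c :=
  congrArg (X.residue x).hom (germ_constHom p hx c)

variable {p} {η : X}

/-- Places are the normalized valuations of the function field. -/
def Place.equivNormVal (p : X ⟶ Spec (.of ℂ)) (η : X) :
    letI := (residueHom p η).toAlgebra
    Place p η ≃ FunctionField.NormVal ℂ (X.residueField η) :=
  letI := (residueHom p η).toAlgebra
  { toFun w := ⟨w.v, w.surjective, w.map_const⟩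
    invFun w := ⟨w.v, w.surjective, w.map_const⟩
    left_inv _ := rfl
    right_inv _ := rfl }

theorem Place.ord_mul (w : Place p η) {f g : X.residueField η} (hf : f ≠ 0) (hg : g ≠ 0) :
    w.ord (f * g) = w.ord f + w.ord g :=
  letI := (residueHom p η).toAlgebra
  (Place.equivNormVal p η w).ord_mul hf hg

theorem Place.ord_inv (w : Place p η) (f : X.residueField η) : w.ord f⁻¹ = -w.ord f :=
  letI := (residueHom p η).toAlgebra
  (Place.equivNormVal p η w).ord_inv f

theorem Place.ord_zpow (w : Place p η) (f : X.residueField η) (m : ℤ) :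
    w.ord (f ^ m) = m * w.ord f := by
  simp [Place.ord]

theorem Place.ord_nonneg (w : Place p η) {f : X.residueField η} (hf : w.v f ≤ 1) :
    0 ≤ w.ord f := by
  rw [Place.ord, Left.nonneg_neg_iff]
  by_cases h : f = 0
  · simp [h]
  · rw [WithZero.log_le_iff_le_exp (by simpa using h)]
    simpa using hf

theorem Place.ord_eq_zero (w : Place p η) {f : X.residueField η} (hf : w.v f = 1) :
    w.ord f = 0 := by
  rw [Place.ord, hf]; simp

/-- A prime ideal consisting of the functions of positive order at a place gives its center. -/
theorem Place.exists_isCenter (w : Place p η) {U : X.Opens} (hU : IsAffineOpen U) (hη : η ∈ U)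
    (h : ∀ f : Γ(X, U), w.v ((X.evaluation U η hη).hom f) ≤ 1) : ∃ x, w.IsCenter x := by
  let v' := w.v.comap (X.evaluation U η hη).hom
  let q : PrimeSpectrum Γ(X, U) := ⟨{
      carrier := {f | v' f < 1}
      add_mem' := fun {a b} ha hb ↦ v'.map_add_lt ha hb
      zero_mem' := by simp
      smul_mem' := fun a b hb ↦ by
        change v' (a * b) < 1
        rw [map_mul]
        exact (mul_le_of_le_one_left' (h a)).trans_lt hb },
    { ne_top' := by
        rw [Ideal.ne_top_iff_one]
        change ¬ (v' 1 < 1)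
        simp
      mem_or_mem' := fun {a b} hab ↦ by
        change v' (a * b) < 1 at hab
        change v' a < 1 ∨ v' b < 1
        by_contra! hcon
        have ha : v' a = 1 := (h a).antisymm hcon.1
        have hb : v' b = 1 := (h b).antisymm hcon.2
        rw [map_mul, ha, hb, one_mul] at hab
        exact hab.false }⟩
  have hmem : ∀ f, hU.fromSpec q ∈ X.basicOpen f ↔ w.v ((X.evaluation U η hη).hom f) = 1 := by
    intro f
    rw [hU.mem_basicOpen_fromSpec_iff]
    change ¬ (v' f < 1) ↔ _
    rw [not_lt]
    exact ⟨fun h' ↦ (h f).antisymm h', fun h' ↦ h'.ge⟩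
  have hx : hU.fromSpec q ∈ U := hU.fromSpec_mem q
  generalize hU.fromSpec q = x at hx hmem
  -- A function that does not vanish at `x` has value one at `w`, so it is nonzero at `η`.
  have hs : η ⤳ x := hU.specializes hx fun f hf ↦ by
    by_contra hcon
    rw [hmem, (X.evaluation_eq_zero_iff_notMem_basicOpen η hη f).mpr hcon] at hf
    simp at hf
  refine ⟨_, hs, fun z ↦ ?_⟩
  -- A germ is a fraction `a / b` with `b` nonvanishing at `x`. Then `b` has value one at `w`, so
  -- both claims about `z` become claims about `a`.
  obtain ⟨a, b, hb, hab⟩ := hU.exists_germ_mul_eq hx z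
  have e : ∀ f, (X.residue η).hom ((X.presheaf.stalkSpecializes hs).hom
      ((X.presheaf.germ U _ hx).hom f)) = (X.evaluation U η hη).hom f := by
    intro f
    have := congrArg (X.residue η).hom (congrArg (fun g ↦ g.hom f)
      (X.presheaf.germ_stalkSpecializes hx hs))
    exact this
  have h1 : w.v ((X.residue η).hom ((X.presheaf.stalkSpecializes hs).hom z)) =
      w.v ((X.evaluation U η hη).hom a) := by
    rw [← e a, ← hab, map_mul, map_mul, map_mul, e, (hmem b).mp hb, mul_one]
  refine ⟨h1.trans_le (h a), ?_⟩
  rw [h1, IsLocalRing.mem_maximalIdeal, mem_nonunits_iff]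
  rw [mem_basicOpen_iff_isUnit_germ hx] at hb
  have h2 : IsUnit z ↔ x ∈ X.basicOpen a := by
    rw [mem_basicOpen_iff_isUnit_germ hx, ← hab, IsUnit.mul_iff, and_iff_left hb]
  rw [h2, hmem]
  exact ⟨fun h' ↦ h'.ne, fun h' ↦ lt_of_le_of_ne (h a) h'⟩

variable [IsIntegral X] {w : Place p η} {x : X} {u : X.functionField}

theorem valueAt_specializes (h : η ⤳ x) (a : X.presheaf.stalk x) :
    (X.residue η).hom ((X.presheaf.stalkSpecializes h).hom a) =
      valueAt η (algebraMap (X.presheaf.stalk x) X.functionField a) := by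
  rw [← algebraMap_stalkSpecializes h, valueAt_algebraMap]

theorem Place.IsCenter.valueAt_le (h : w.IsCenter x) (hu : IsRegAt x u) :
    w.v (valueAt η u) ≤ 1 := by
  obtain ⟨hs, h⟩ := h
  obtain ⟨a, rfl⟩ := hu
  rw [← valueAt_specializes hs]
  exact (h a).1

theorem Place.IsCenter.valueAt_lt_iff (h : w.IsCenter x) (hu : IsRegAt x u) :
    w.v (valueAt η u) < 1 ↔ ¬ IsUnitAt x u := by
  obtain ⟨hs, h⟩ := h
  obtain ⟨a, rfl⟩ := hu
  rw [← valueAt_specializes hs, (h a).2, IsLocalRing.mem_maximalIdeal, mem_nonunits_iff, not_iff_not]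
  refine ⟨fun h' ↦ ⟨a, h', rfl⟩, fun ⟨b, hb, e⟩ ↦ ?_⟩
  rwa [← algebraMap_stalk_injective x e]

theorem Place.IsCenter.ord_nonneg (h : w.IsCenter x) (hu : IsRegAt x u) :
    0 ≤ w.ord (valueAt η u) := w.ord_nonneg (h.valueAt_le hu)

theorem Place.IsCenter.ord_eq_zero (h : w.IsCenter x) (hu : IsUnitAt x u) :
    w.ord (valueAt η u) = 0 := by
  refine w.ord_eq_zero ((h.valueAt_le hu.isRegAt).antisymm ?_)
  rw [← not_lt, h.valueAt_lt_iff hu.isRegAt, not_not]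
  exact hu

end Field

section Chart

variable {n : ℕ} {d : Fin n → ℤ} (P : ProjectiveBundle (splitBundle d))

/-- The value at a point of a chart of a polynomial in the coordinate functions. -/
def chartEval {i : Fin 2} {k : Fin n} {η : P.X} (hη : η ∈ chart P i k) :
    MvPolynomial (Fin n) ℂ →+* P.X.residueField η :=
  (P.X.evaluation (chart P i k) η hη).hom.comp (chartHom P i k)

theorem chartEval_C {i : Fin 2} {k : Fin n} {η : P.X} (hη : η ∈ chart P i k) (c : ℂ) :
    chartEval P hη (MvPolynomial.C c) = residueHom P.toSpec η c := by
  rw [chartEval, RingHom.comp_apply, chartHom_C, evaluation_constHom]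

theorem exists_mul_chartEval {i : Fin 2} {k : Fin n} {η : P.X} (hη : η ∈ chart P i k)
    (z : P.X.residueField η) : ∃ a b, chartEval P hη b ≠ 0 ∧ z * chartEval P hη b =
      chartEval P hη a := by
  obtain ⟨z, rfl⟩ := P.X.residue_surjective η z
  obtain ⟨a, b, hb, hab⟩ := (isAffineOpen_chart P i k).exists_germ_mul_eq hη z
  obtain ⟨a, rfl⟩ := (chartHom_bijective P i k).surjective a
  obtain ⟨b, rfl⟩ := (chartHom_bijective P i k).surjective b
  refine ⟨a, b, fun h ↦ ?_, ?_⟩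
  · exact (P.X.evaluation_eq_zero_iff_notMem_basicOpen η hη _).mp h hb
  · exact (map_mul (P.X.residue η).hom _ _).symm.trans (congrArg _ hab)

/-- The residue field consists of fractions of values of polynomials in the chart coordinates. -/
theorem essFiniteType_residueField (η : P.X) :
    letI := (residueHom P.toSpec η).toAlgebra
    Algebra.EssFiniteType ℂ (P.X.residueField η) := by
  let _ := (residueHom P.toSpec η).toAlgebra
  obtain ⟨i, k, hη⟩ := exists_mem_chart P η
  let χ : MvPolynomial (Fin n) ℂ →ₐ[ℂ] P.X.residueField η :=
    { chartEval P hη with commutes' := chartEval_C P hη }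
  classical
  refine ⟨Finset.univ.image fun l ↦ χ (MvPolynomial.X l), ?_⟩
  rw [Algebra.essFiniteType_cond_iff]
  have hr : Algebra.adjoin ℂ (Finset.univ.image fun l ↦ χ (MvPolynomial.X l) : Finset _) =
      χ.range := by
    rw [Finset.coe_image, Finset.coe_univ, Set.image_univ, Algebra.adjoin_range_eq_range_aeval]
    congr 1
    exact (MvPolynomial.aeval_unique χ).symm
  rw [hr]
  intro z
  obtain ⟨a, b, hb, hab⟩ := exists_mul_chartEval P hη z
  exact ⟨χ b, ⟨b, rfl⟩, (IsUnit.mk0 _ hb), hab ▸ ⟨a, rfl⟩⟩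

theorem finite_ord_ne_zero {η : P.X} (hη : IsCurve P.toSpec η) (f : P.X.residueField η) :
    {w : Place P.toSpec η | w.ord f ≠ 0}.Finite := by
  let _ := (residueHom P.toSpec η).toAlgebra
  have := essFiniteType_residueField P η
  exact (FunctionField.finite_ord_and_finsum_ord (k := ℂ) hη f).1.preimage
    (Place.equivNormVal P.toSpec η).injective.injOn

theorem finsum_ord {η : P.X} (hη : IsCurve P.toSpec η) (f : P.X.residueField η) :
    ∑ᶠ w : Place P.toSpec η, w.ord f = 0 := by
  let _ := (residueHom P.toSpec η).toAlgebra
  have := essFiniteType_residueField P η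
  rw [← (FunctionField.finite_ord_and_finsum_ord (k := ℂ) hη f).2]
  exact finsum_eq_of_bijective _ (Place.equivNormVal P.toSpec η).bijective fun _ ↦ rfl

theorem exists_ord_pos {η : P.X} (hη : IsCurve P.toSpec η) (f : P.X.residueField η)
    (hf : letI := (residueHom P.toSpec η).toAlgebra; Transcendental ℂ f) :
    ∃ w : Place P.toSpec η, 0 < w.ord f := by
  let _ := (residueHom P.toSpec η).toAlgebra
  have := essFiniteType_residueField P η
  obtain ⟨w, hw⟩ := FunctionField.exists_zero (k := ℂ) hη f hf
  exact ⟨(Place.equivNormVal P.toSpec η).symm w, hw⟩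

theorem Place.map_residueHom_le {X : Scheme.{0}} {p : X ⟶ Spec (.of ℂ)} {η : X} (w : Place p η)
    (c : ℂ) : w.v (residueHom p η c) ≤ 1 :=
  letI := (residueHom p η).toAlgebra
  (Place.equivNormVal p η w).map_const_le c

theorem Place.map_chartEval_le {i : Fin 2} {k : Fin n} {η : P.X} (hη : η ∈ chart P i k)
    (w : Place P.toSpec η) (h : ∀ l, w.v (chartEval P hη (MvPolynomial.X l)) ≤ 1)
    (f : MvPolynomial (Fin n) ℂ) : w.v (chartEval P hη f) ≤ 1 := by
  induction f using MvPolynomial.induction_on with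
  | C c => rw [chartEval_C]; exact w.map_residueHom_le c
  | add p q hp hq => rw [map_add]; exact w.v.map_add_le hp hq
  | mul_X p l hp => rw [map_mul, map_mul]; exact mul_le_one' hp (h l)

variable [NeZero n]

theorem evaluation_eq_valueAt {i : Fin 2} {k : Fin n} {η : P.X} (hη : η ∈ chart P i k)
    (f : Γ(P.X, chart P i k)) :
    (P.X.evaluation (chart P i k) η hη).hom f = valueAt η (chartRat P i k f) :=
  (valueAt_toRat hη f).symm

theorem chartEval_X {i : Fin 2} {k : Fin n} {η : P.X} (hη : η ∈ chart P i k) (l : Fin n) :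
    chartEval P hη (MvPolynomial.X l) = valueAt η (coordRat P i k l) := by
  rw [chartEval, RingHom.comp_apply, chartHom_X, evaluation_eq_valueAt]
  rfl

/-- This is the valuative criterion of properness for a projective bundle. One chooses the base
chart in which the base coordinate is integral, then the fibre chart whose homogeneous coordinate
has the largest value. All chart coordinates are then integral at `w`, so `w` is centred in that
chart. -/
theorem Place.isCenter_center {η : P.X} (w : Place P.toSpec η) : w.IsCenter w.center := by
  suffices h : ∃ x, w.IsCenter x by
    rw [Place.center, dif_pos h]
    exact h.choose_spec
  obtain ⟨i, k₀, hη, hi⟩ : ∃ i k₀, η ∈ chart P i k₀ ∧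
      w.v (valueAt η (baseRat P (i + 1) / baseRat P i)) ≤ 1 := by
    obtain ⟨i, k₀, hη⟩ := exists_mem_chart P η
    by_cases h : w.v (valueAt η (baseRat P (i + 1) / baseRat P i)) ≤ 1
    · exact ⟨i, k₀, hη, h⟩
    · have h0 : valueAt η (baseRat P (i + 1) / baseRat P i) ≠ 0 := by
        intro h0; rw [h0] at h; simp at h
      have hu := (isRegAt_baseRat P hη (i + 1)).isUnitAt h0
      refine ⟨i + 1, k₀, (mem_chart_iff_isUnitAt P hη _ _).mpr ⟨hu, ?_⟩, ?_⟩
      · rw [div_self (fiberRat_ne_zero P i k₀)]; exact isUnitAt_one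
      · have e : i + 1 + 1 = i := by clear * -; decide +revert
        rw [e, ← inv_div, valueAt_inv hu, map_inv₀]
        exact inv_le_one_of_one_le₀ (not_le.mp h).le
  -- The maximum is at least the value one attained at `k₀`, so the coordinate with index `k` is
  -- nonzero at `η` and `η` lies in the new chart.
  obtain ⟨k, -, hk⟩ := Finset.exists_max_image Finset.univ
    (fun k ↦ w.v (valueAt η (fiberRat P i k / fiberRat P i k₀))) ⟨k₀, Finset.mem_univ _⟩
  have h1 := hk k₀ (Finset.mem_univ _)
  rw [div_self (fiberRat_ne_zero P i k₀), valueAt_one, map_one] at h1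
  have hk0 : valueAt η (fiberRat P i k / fiberRat P i k₀) ≠ 0 := by
    intro h0; rw [h0] at h1; simp at h1
  have hu := (isRegAt_fiberRat P hη k).isUnitAt hk0
  have hηk : η ∈ chart P i k := (mem_chart_iff_isUnitAt P hη _ _).mpr ⟨by
    rw [div_self (baseRat_ne_zero P i)]; exact isUnitAt_one, hu⟩
  refine w.exists_isCenter (isAffineOpen_chart P i k) hηk fun f ↦ ?_
  obtain ⟨f, rfl⟩ := (chartHom_bijective P i k).surjective f
  refine w.map_chartEval_le P hηk (fun l ↦ ?_) f
  rw [chartEval_X]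
  by_cases hl : l = k
  · rw [hl, coordRat_self]; exact hi
  · rw [coordRat_of_ne P i hl, ← div_div_div_cancel_right₀ (fiberRat_ne_zero P i k₀),
      valueAt_div (isRegAt_fiberRat P hη l) hu, map_div₀]
    exact div_le_one_of_le₀ (hk l (Finset.mem_univ _)) zero_le

theorem Place.specializes_center {η : P.X} (w : Place P.toSpec η) : η ⤳ w.center :=
  (Place.isCenter_center P w).1

end Chart

end ProjBundle

namespace ProjBundle

/-! ## Degrees of line bundles -/

section LineBundle

variable {X : Scheme.{0}} (L : LineBundle X)

theorem isUnit_frame (i j : L.ι) : IsUnit ((L.g i j).1 0 0) := by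
  have h : (L.g i j).1.det = (L.g i j).1 0 0 := Matrix.det_fin_one _
  rw [← h, ← Matrix.isUnit_iff_isUnit_det]
  exact (L.g i j).isUnit

theorem mem_idx (x : X) : x ∈ L.U (L.idx x) := (L.exists_mem x).choose_spec

theorem isUnit_res_of_le_basicOpen {U V : X.Opens} (h : V ≤ U) {f : Γ(X, U)}
    (hf : V ≤ X.basicOpen f) : IsUnit (res h f) := by
  have h1 := X.toRingedSpace.isUnit_res_basicOpen f
  have h2 := h1.map (X.presheaf.map (homOfLE hf).op).hom
  have h3 : res hf (res (X.basicOpen_le f) f) = res h f := res_res _ _ f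
  rw [← h3]
  exact h2

variable [IsIntegral X]

open Classical in
/-- The quotient `e⁽ⁱ⁾ / e⁽ʲ⁾` of two frames as a rational function. -/
def frameRat (i j : L.ι) : X.functionField :=
  if h : genericPoint X ∈ L.U i ⊓ L.U j then toRat _ h ((L.g i j).1 0 0) else 1

theorem frameRat_of_mem {i j : L.ι} (h : genericPoint X ∈ L.U i ⊓ L.U j) :
    frameRat L i j = toRat _ h ((L.g i j).1 0 0) := dif_pos h

theorem frameRat_mul {i j k : L.ι} (hi : genericPoint X ∈ L.U i) (hj : genericPoint X ∈ L.U j)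
    (hk : genericPoint X ∈ L.U k) : frameRat L i k = frameRat L i j * frameRat L j k := by
  have h := congrArg (fun M ↦ M.1 0 0) (L.cocycle i j k)
  simp only [Units.val_mul, Matrix.mul_apply, Fin.sum_univ_one] at h
  have h' : res _ ((L.g i k).1 0 0) = res _ ((L.g i j).1 0 0) * res _ ((L.g j k).1 0 0) := h
  have hη : genericPoint X ∈ L.U i ⊓ L.U j ⊓ L.U k := ⟨⟨hi, hj⟩, hk⟩
  have h'' := congrArg (toRat (L.U i ⊓ L.U j ⊓ L.U k) hη) h'
  rw [map_mul, toRat_res, toRat_res, toRat_res] at h''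
  rwa [frameRat_of_mem L ⟨hi, hk⟩, frameRat_of_mem L ⟨hi, hj⟩, frameRat_of_mem L ⟨hj, hk⟩]

theorem isUnitAt_frameRat {x : X} {i j : L.ι} (hi : x ∈ L.U i) (hj : x ∈ L.U j) :
    IsUnitAt x (frameRat L i j) := by
  have h : x ∈ L.U i ⊓ L.U j := ⟨hi, hj⟩
  rw [frameRat_of_mem L (genericPoint_mem h), isUnitAt_toRat_iff h,
    Scheme.basicOpen_of_isUnit _ (isUnit_frame L i j)]
  exact h

theorem valueAt_frameRat {x : X} {i j : L.ι} (hi : x ∈ L.U i) (hj : x ∈ L.U j) :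
    valueAt x (frameRat L i j) = transitionAt L i j x := by
  have h : x ∈ L.U i ⊓ L.U j := ⟨hi, hj⟩
  rw [frameRat_of_mem L (genericPoint_mem h), valueAt_toRat h, transitionAt, dif_pos h]

/-- The line bundle with the given transition functions, which are quotients of rational
functions. -/
def lineBundleOfRat {ι : Type} (U : ι → X.Opens) (hU : ⨆ i, U i = ⊤)
    (hη : ∀ i, genericPoint X ∈ U i) (u : ∀ i j, Γ(X, U i ⊓ U j)ˣ) (H : ι → X.functionField)
    (h0 : ∀ i, H i ≠ 0) (h : ∀ i j (hij : genericPoint X ∈ U i ⊓ U j), toRat (U i ⊓ U j) hij (u i j).1 = H i / H j) : LineBundle X where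
  ι := ι
  U := U
  iSup_U := hU
  g i j := Units.map (Matrix.scalar (Fin 1)).toMonoidHom (u i j)
  cocycle i j k := by
    apply Units.ext
    refine Matrix.ext fun a b ↦ ?_
    have hη' : genericPoint X ∈ U i ⊓ U j ⊓ U k := ⟨⟨hη i, hη j⟩, hη k⟩
    apply toRat_injective hη'
    obtain rfl := Subsingleton.elim a 0
    obtain rfl := Subsingleton.elim b 0
    have e : ∀ i j, (Matrix.scalar (Fin 1) (u i j).1) 0 0 = (u i j).1 := fun i j ↦ by simp
    rw [Units.val_mul, Matrix.mul_apply, Fin.sum_univ_one, map_mul]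
    change toRat _ _ (res _ ((Matrix.scalar (Fin 1) (u i k).1) 0 0)) =
      toRat _ _ (res _ ((Matrix.scalar (Fin 1) (u i j).1) 0 0)) *
      toRat _ _ (res _ ((Matrix.scalar (Fin 1) (u j k).1) 0 0))
    rw [e, e, e, toRat_res, toRat_res, toRat_res, h, h, h, div_mul_div_cancel₀ (h0 j)]

theorem frameRat_lineBundleOfRat {ι : Type} (U : ι → X.Opens) (hU : ⨆ i, U i = ⊤)
    (hη : ∀ i, genericPoint X ∈ U i) (u : ∀ i j, Γ(X, U i ⊓ U j)ˣ) (H : ι → X.functionField)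
    (h0 : ∀ i, H i ≠ 0) (h : ∀ i j (hij : genericPoint X ∈ U i ⊓ U j), toRat (U i ⊓ U j) hij (u i j).1 = H i / H j) (i j : ι) :
    frameRat (lineBundleOfRat U hU hη u H h0 h) i j = H i / H j := by
  rw [← h i j ⟨hη i, hη j⟩]
  refine (frameRat_of_mem _ ⟨hη i, hη j⟩).trans (congrArg (toRat (U i ⊓ U j) ⟨hη i, hη j⟩) ?_)
  change (Matrix.scalar (Fin 1) (u i j).1) 0 0 = (u i j).1
  simp

end LineBundle

section Chart

variable {n : ℕ} {d : Fin n → ℤ} (P : ProjectiveBundle (splitBundle d))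

theorem exists_mem_chart' (x : P.X) : ∃ a : Fin 2 × Fin n, x ∈ chart P a.1 a.2 :=
  have ⟨i, k, h⟩ := exists_mem_chart P x
  ⟨(i, k), h⟩

/-- A chart that contains `x`. -/
def chartIdx (x : P.X) : Fin 2 × Fin n := (exists_mem_chart' P x).choose

theorem mem_chartIdx (x : P.X) : x ∈ chart P (chartIdx P x).1 (chartIdx P x).2 :=
  (exists_mem_chart' P x).choose_spec

theorem iSup_chart' : ⨆ a : Fin 2 × Fin n, chart P a.1 a.2 = ⊤ := by
  rw [eq_top_iff]
  intro x _
  exact TopologicalSpace.Opens.mem_iSup.mpr (exists_mem_chart' P x)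

variable [NeZero n]

/-- The degree on the curve `closure {η}` of the line bundle with the local frames `H`. -/
def frameDegree (H : Fin 2 × Fin n → P.X.functionField) (η : P.X) : ℤ :=
  ∑ᶠ w : Place P.toSpec η, w.ord (valueAt η (H (chartIdx P η) / H (chartIdx P w.center)))

/-- The chart at the centre varies with the place, but only among finitely many, and a fixed
rational function has finitely many zeros and poles. -/
theorem finite_support_ord_div (u : P.X.functionField) (H : Fin 2 × Fin n → P.X.functionField)
    {η : P.X} (hη : IsCurve P.toSpec η) : (Function.support fun w : Place P.toSpec η ↦
      w.ord (valueAt η (u / H (chartIdx P w.center)))).Finite := by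
  have h : (⋃ a : Fin 2 × Fin n, {w : Place P.toSpec η | w.ord (valueAt η (u / H a)) ≠ 0}).Finite :=
    Set.finite_iUnion fun a ↦ finite_ord_ne_zero P hη _
  refine h.subset fun w hw ↦ Set.mem_iUnion.mpr ⟨chartIdx P w.center, ?_⟩
  exact hw

theorem finite_support_frameDegree (H : Fin 2 × Fin n → P.X.functionField) {η : P.X}
    (hη : IsCurve P.toSpec η) : (Function.support fun w : Place P.toSpec η ↦
      w.ord (valueAt η (H (chartIdx P η) / H (chartIdx P w.center)))).Finite :=
  finite_support_ord_div P _ H hη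

/-- The functions `H` are local frames of the line bundle `L`, up to a global rational function. -/
def IsFrameSystem (L : LineBundle P.X) (H : Fin 2 × Fin n → P.X.functionField) : Prop :=
  ∀ (x : P.X) (j : L.ι) (a : Fin 2 × Fin n), x ∈ L.U j → x ∈ chart P a.1 a.2 →
    IsUnitAt x (frameRat L (L.idx (genericPoint P.X)) j * H a)

/-- At each place the two summands differ by the order of the fixed function `G⁻¹`, whose total
degree is zero, and by the order of a unit at the centre, which is zero. The comparison of frames is
required only at points of `closure {η}`; this matters for the canonical bundle, whose frames are
computed only near the zero section. -/
theorem intersectionNumber_eq_frameDegree (L : LineBundle P.X)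
    {H : Fin 2 × Fin n → P.X.functionField} {η : P.X}
    (h : ∀ (x : P.X) (j : L.ι) (a : Fin 2 × Fin n), η ⤳ x → x ∈ L.U j → x ∈ chart P a.1 a.2 →
      IsUnitAt x (frameRat L (L.idx (genericPoint P.X)) j * H a))
    (hη : IsCurve P.toSpec η) : intersectionNumber P.toSpec L η = frameDegree P H η := by
  let i₁ := L.idx (genericPoint P.X)
  let G := frameRat L i₁ (L.idx η) * H (chartIdx P η)
  have hG : IsUnitAt η G := h η _ _ specializes_rfl (mem_idx L η) (mem_chartIdx P η)
  have key : ∀ w : Place P.toSpec η, w.ord (transitionAt L (L.idx η) (L.idx w.center) η) =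
      w.ord (valueAt η G⁻¹) +
        w.ord (valueAt η (H (chartIdx P η) / H (chartIdx P w.center))) := by
    intro w
    have hs := Place.specializes_center P w
    have hc := Place.isCenter_center P w
    have h1 := h w.center _ _ hs (mem_idx L _) (mem_chartIdx P _)
    have hj : η ∈ L.U (L.idx w.center) := hs.mem_open (L.U _).2 (mem_idx L _)
    have ha := hs.mem_open (chart P _ _).2 (mem_chartIdx P w.center)
    have h2 : IsUnitAt η (H (chartIdx P η) / H (chartIdx P w.center)) := by
      have h3 := h η _ _ specializes_rfl (mem_idx L η) ha
      rw [← mul_div_mul_left _ _ (left_ne_zero_of_mul hG.ne_zero)]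
      exact hG.div h3
    have e : frameRat L (L.idx η) (L.idx w.center) =
        frameRat L i₁ (L.idx w.center) * H (chartIdx P w.center) * (G⁻¹ *
          (H (chartIdx P η) / H (chartIdx P w.center))) := by
      have e1 := frameRat_mul L (mem_idx L (genericPoint P.X)) (genericPoint_mem (mem_idx L η))
        (genericPoint_mem hj)
      have n1 := left_ne_zero_of_mul hG.ne_zero
      have n2 := right_ne_zero_of_mul hG.ne_zero
      have n3 := right_ne_zero_of_mul h1.ne_zero
      rw [e1]
      simp only [G]
      field_simp
      rfl
    rw [← valueAt_frameRat L (mem_idx L η) hj, e,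
      valueAt_mul (h1.specializes hs).isRegAt (hG.inv.mul h2).isRegAt,
      valueAt_mul hG.inv.isRegAt h2.isRegAt, w.ord_mul (h1.specializes hs).valueAt_ne_zero
        (mul_ne_zero hG.inv.valueAt_ne_zero h2.valueAt_ne_zero),
      w.ord_mul hG.inv.valueAt_ne_zero h2.valueAt_ne_zero, hc.ord_eq_zero h1, zero_add]
  rw [intersectionNumber, finsum_congr key, finsum_add_distrib
    (finite_ord_ne_zero P hη _) (finite_support_frameDegree P H hη), finsum_ord P hη, zero_add]
  rfl

/-- Local frames of the tautological quotient `𝒪(1)`. -/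
def tautFrame (a : Fin 2 × Fin n) : P.X.functionField := fiberRat P a.1 a.2

/-- Local frames of the pull-back of `𝒪(1)` from the base. -/
def baseFrame (a : Fin 2 × Fin n) : P.X.functionField := baseRat P a.1

theorem isUnitAt_baseFrame_div {x : P.X} {a b : Fin 2 × Fin n} (ha : x ∈ chart P a.1 a.2)
    (hb : x ∈ chart P b.1 b.2) : IsUnitAt x (baseFrame P a / baseFrame P b) :=
  ((mem_chart_iff_isUnitAt P hb _ _).mp ha).1

theorem isUnitAt_tautFrame_div {x : P.X} {a b : Fin 2 × Fin n} (ha : x ∈ chart P a.1 a.2)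
    (hb : x ∈ chart P b.1 b.2) : IsUnitAt x (tautFrame P a / tautFrame P b) := by
  obtain ⟨h1, h2⟩ := (mem_chart_iff_isUnitAt P hb _ _).mp ha
  rw [tautFrame, tautFrame, fiberRat_eq P a.1 b.1, mul_div_assoc]
  exact (h1.zpow _).mul h2

theorem frameDegree_mul_zpow (c : P.X.functionField) (hc : c ≠ 0) (m l : ℤ) {η : P.X}
    (hη : IsCurve P.toSpec η) :
    frameDegree P (fun a ↦ c * tautFrame P a ^ m * baseFrame P a ^ l) η =
      m * frameDegree P (tautFrame P) η + l * frameDegree P (baseFrame P) η := by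
  rw [frameDegree, frameDegree, frameDegree, mul_finsum,
    mul_finsum, ← finsum_add_distrib]
  · refine finsum_congr fun w ↦ ?_
    have ha := (Place.specializes_center P w).mem_open (chart P _ _).2 (mem_chartIdx P w.center)
    have h1 := isUnitAt_tautFrame_div P (mem_chartIdx P η) ha
    have h2 := isUnitAt_baseFrame_div P (mem_chartIdx P η) ha
    rw [← w.ord_zpow, ← w.ord_zpow, ← valueAt_zpow h1, ← valueAt_zpow h2,
      ← w.ord_mul (h1.zpow m).valueAt_ne_zero (h2.zpow l).valueAt_ne_zero,
      ← valueAt_mul (h1.zpow m).isRegAt (h2.zpow l).isRegAt, div_zpow, div_zpow,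
      mul_div_mul_comm, mul_div_mul_left _ _ hc]
  · exact (finite_support_frameDegree P _ hη).subset fun w hw ↦ right_ne_zero_of_mul hw
  · exact (finite_support_frameDegree P _ hη).subset fun w hw ↦ right_ne_zero_of_mul hw

theorem toRat_mixedRatio (a b : Fin 2 × Fin n) (hη : genericPoint P.X ∈
    chart P a.1 a.2 ⊓ P.π ⁻¹ᵁ P1.D b.1) : toRat _ hη (mixedRatio P a.1 a.2 b.1 b.2) =
      tautFrame P b / tautFrame P a := by
  rw [mixedRatio_eq, map_mul, toRat_res, map_val_zpow, coe_baseUnit, toRat_res]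
  refine (congrArg₂ (fun u v ↦ u ^ d b.2 * v) (chartRat_baseRatio P a.1 a.2 b.1)
    (chartRat_fiberRatio P a.1 a.2 b.2)).trans ?_
  rw [tautFrame, tautFrame, fiberRat_eq P b.1 a.1, mul_div_assoc]

/-- The tautological quotient line bundle `𝒪(1)`. -/
def tautBundle : LineBundle P.X :=
  lineBundleOfRat (fun a : Fin 2 × Fin n ↦ chart P a.1 a.2) (iSup_chart' P)
    (fun a ↦ genericPoint_mem_chart P a.1 a.2)
    -- The mixed ratio is the frame of `b` over the frame of `a`, while the transition function is
    -- the opposite quotient; hence the inverse.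
    (fun a b ↦ (isUnit_res_of_le_basicOpen (V := chart P a.1 a.2 ⊓ chart P b.1 b.2)
      (le_inf inf_le_left (inf_le_right.trans (chart_le P b.1 b.2)))
      (chart_inf_chart P a.1 a.2 b.1 b.2).le).unit⁻¹)
    (tautFrame P) (fun a ↦ fiberRat_ne_zero P a.1 a.2) fun a b hab ↦ by
      rw [map_units_inv, IsUnit.unit_spec, toRat_res, toRat_mixedRatio, inv_div]

/-- The pull-back of `𝒪(1)` from the base. -/
def baseBundle : LineBundle P.X :=
  lineBundleOfRat (fun a : Fin 2 × Fin n ↦ chart P a.1 a.2) (iSup_chart' P)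
    (fun a ↦ genericPoint_mem_chart P a.1 a.2)
    (fun a b ↦ (Units.map (res (le_inf inf_le_left (inf_le_right.trans (chart_le P b.1 b.2)) :
      chart P a.1 a.2 ⊓ chart P b.1 b.2 ≤ _)).toMonoidHom (baseUnit P a.1 a.2 b.1))⁻¹)
    (baseFrame P) (fun a ↦ baseRat_ne_zero P a.1) fun a b hab ↦ by
      rw [map_units_inv]
      change (toRat _ _ (res _ (baseUnit P a.1 a.2 b.1).1))⁻¹ = _
      rw [toRat_res, coe_baseUnit, toRat_res]
      refine (congrArg _ (chartRat_baseRatio P a.1 a.2 b.1)).trans (inv_div _ _)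

theorem intersectionNumber_lineBundleOfRat {L : LineBundle P.X}
    {H : Fin 2 × Fin n → P.X.functionField}
    (h0 : ∀ a, H a ≠ 0) (h : ∀ x a b, x ∈ chart P a.1 a.2 → x ∈ chart P b.1 b.2 →
      IsUnitAt x (H a / H b)) (f : L.ι → Fin 2 × Fin n)
    (hf : ∀ j, L.U j = chart P (f j).1 (f j).2)
    (hL : ∀ i j, frameRat L i j = H (f i) / H (f j)) {η : P.X}
    (hη : IsCurve P.toSpec η) : intersectionNumber P.toSpec L η = frameDegree P H η := by
  -- The frames of `L` are compared through its frame at the generic point; `c` accounts for this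
  -- normalization and cancels in all quotients.
  let c := (H (f (L.idx (genericPoint P.X))))⁻¹
  have hc : c ≠ 0 := inv_ne_zero (h0 _)
  rw [intersectionNumber_eq_frameDegree P L (H := fun a ↦ c * H a) (fun x j a _ hj ha ↦ ?_) hη,
    frameDegree, frameDegree]
  · refine finsum_congr fun w ↦ ?_
    rw [mul_div_mul_left _ _ hc]
  · rw [hL, div_mul_eq_mul_div, ← mul_assoc, mul_inv_cancel₀ (h0 _), one_mul]
    exact h x a _ ha (hf j ▸ hj)

theorem intersectionNumber_tautBundle {η : P.X} (hη : IsCurve P.toSpec η) :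
    intersectionNumber P.toSpec (tautBundle P) η = frameDegree P (tautFrame P) η :=
  intersectionNumber_lineBundleOfRat P (fun a ↦ fiberRat_ne_zero P a.1 a.2)
    (fun _ _ _ ↦ isUnitAt_tautFrame_div P) (fun a : Fin 2 × Fin n ↦ a) (fun _ ↦ rfl)
    (fun _ _ ↦ frameRat_lineBundleOfRat _ _ _ _ _ _ _ _ _) hη

theorem intersectionNumber_baseBundle {η : P.X} (hη : IsCurve P.toSpec η) :
    intersectionNumber P.toSpec (baseBundle P) η = frameDegree P (baseFrame P) η :=
  intersectionNumber_lineBundleOfRat P (fun a ↦ baseRat_ne_zero P a.1)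
    (fun _ _ _ ↦ isUnitAt_baseFrame_div P) (fun a : Fin 2 × Fin n ↦ a) (fun _ ↦ rfl)
    (fun _ _ ↦ frameRat_lineBundleOfRat _ _ _ _ _ _ _ _ _) hη

end Chart

end ProjBundle

namespace ProjBundle

/-! ## Line bundles on factorial affine schemes -/

/-- An element of a factorial ring is a product of a divisor of a power of `h` and an element prime
to `h`. -/
theorem exists_mul_dvd_pow_isRelPrime {A : Type*} [CommRing A] [IsDomain A]
    [UniqueFactorizationMonoid A] (h : A) {a : A} (ha : a ≠ 0) :
    ∃ b c m, a = b * c ∧ b ∣ h ^ m ∧ IsRelPrime c h := by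
  induction a using UniqueFactorizationMonoid.induction_on_prime with
  | h₁ => exact absurd rfl ha
  | h₂ x hx => exact ⟨1, x, 0, by simp, by simp, hx.isRelPrime_left⟩
  | h₃ a p ha0 hp ih =>
    obtain ⟨b, c, m, rfl, hb, hc⟩ := ih ha0
    by_cases hph : p ∣ h
    · exact ⟨p * b, c, m + 1, by ring, by rw [pow_succ']; exact mul_dvd_mul hph hb, hc⟩
    · exact ⟨b, p * c, m, by ring, hb, .mul_left (hp.irreducible.isRelPrime_iff_not_dvd.mpr hph) hc⟩

section Factorial

variable {X : Scheme.{0}} {U : X.Opens} (hU : IsAffineOpen U)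

include hU in
theorem exists_dvd_pow_of_basicOpen {h c : Γ(X, U)}
    (hc : ∀ x, x ∈ X.basicOpen h → x ∈ X.basicOpen c) : ∃ m : ℕ, c ∣ h ^ m := by
  have h1 : PrimeSpectrum.basicOpen h ≤ PrimeSpectrum.basicOpen c := fun q hq ↦ by
    have := hc (hU.fromSpec q)
    rw [hU.mem_basicOpen_fromSpec_iff, hU.mem_basicOpen_fromSpec_iff] at this
    exact this hq
  rw [PrimeSpectrum.basicOpen_le_basicOpen_iff] at h1
  obtain ⟨m, hm⟩ := h1
  exact ⟨m, Ideal.mem_span_singleton.mp hm⟩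

theorem mem_basicOpen_of_dvd {b c : Γ(X, U)} (h : b ∣ c) {x : X} (hx : x ∈ X.basicOpen c) :
    x ∈ X.basicOpen b := by
  obtain ⟨e, rfl⟩ := h
  exact (mem_basicOpen_mul.mp hx).1

theorem mem_basicOpen_pow {b : Γ(X, U)} {x : X} (hx : x ∈ X.basicOpen b) (m : ℕ) :
    x ∈ X.basicOpen (b ^ m) := by
  have hxU := X.basicOpen_le _ hx
  rw [mem_basicOpen_iff_isUnit_germ hxU] at hx ⊢
  rw [map_pow]
  exact hx.pow m

variable [IsIntegral X] (hη : genericPoint X ∈ U) [IsDomain Γ(X, U)]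
  [UniqueFactorizationMonoid Γ(X, U)]

include hU in
-- With `a / b` in lowest terms, regularity at `x` means `a e = b c` for some `e` that does not
-- vanish at `x`. Coprimality gives `b ∣ e`, so `b` does not vanish there either; the inverse
-- fraction handles `a`.
theorem exists_reduced_fraction {u : X.functionField} (hu : u ≠ 0) :
    ∃ a b : Γ(X, U), a ≠ 0 ∧ b ≠ 0 ∧ u = toRat U hη a / toRat U hη b ∧
      ∀ x ∈ U, IsUnitAt x u → x ∈ X.basicOpen a ∧ x ∈ X.basicOpen b := by
  have : Nonempty U := ⟨⟨_, hη⟩⟩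
  have := functionField_isFractionRing_of_isAffineOpen X U hU
  obtain ⟨a, ⟨b, hb⟩, hab, rfl⟩ := IsFractionRing.exists_reduced_fraction (A := Γ(X, U)) u
  have hb0 := nonZeroDivisors.ne_zero hb
  have e : IsLocalization.mk' X.functionField a ⟨b, hb⟩ = toRat U hη a / toRat U hη b :=
    IsFractionRing.mk'_eq_div ..
  rw [e] at hu ⊢
  have ha0 : a ≠ 0 := by rintro rfl; simp at hu
  have hinj := toRat_injective hη
  have hta : toRat U hη a ≠ 0 := (map_ne_zero_iff _ hinj).mpr ha0
  have htb : toRat U hη b ≠ 0 := (map_ne_zero_iff _ hinj).mpr hb0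
  refine ⟨a, b, ha0, hb0, rfl, fun x hx hxu ↦ ?_⟩
  have key : ∀ {a b : Γ(X, U)}, IsRelPrime a b → toRat U hη b ≠ 0 →
      IsUnitAt x (toRat U hη a / toRat U hη b) → x ∈ X.basicOpen b := by
    intro a b hab htb hxu
    obtain ⟨c, e, he, hce⟩ := hxu.isRegAt.exists_eq_div hU hx
    have hce' : toRat U hη a / toRat U hη b * toRat U hη e = toRat U hη c := hce
    rw [div_mul_eq_mul_div, div_eq_iff htb, ← map_mul, ← map_mul] at hce'
    have h1 := hinj hce'
    exact mem_basicOpen_of_dvd (hab.symm.dvd_of_dvd_mul_left (h1 ▸ dvd_mul_left b c)) he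
  refine ⟨key hab.symm hta ?_, key hab htb hxu⟩
  rw [← inv_div]
  exact hxu.inv

include hU hη in
/-- A line bundle has a frame over a factorial affine open subset. -/
theorem exists_frame {J : Type*} (V : J → X.Opens) (hV : ∀ x ∈ U, ∃ j, x ∈ V j)
    (f : J → X.functionField) (hf : ∀ x i j, x ∈ V i → x ∈ V j → IsUnitAt x (f i / f j))  :
    ∃ F : X.functionField, F ≠ 0 ∧ ∀ x ∈ U, ∀ j, x ∈ V j → IsUnitAt x (f j * F) := by
  -- Induction over finitely many basic opens, each contained in a member of the cover: the frame
  -- found so far is corrected on the next basic open without being spoiled on the earlier ones.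
  have step : ∀ S : Finset (Γ(X, U) × J), (∀ s ∈ S, X.basicOpen s.1 ≤ V s.2) →
      ∃ F : X.functionField, F ≠ 0 ∧ ∀ s ∈ S, ∀ x ∈ X.basicOpen s.1, IsUnitAt x (f s.2 * F) := by
    classical
    intro S
    induction S using Finset.induction_on with
    | empty => exact fun _ ↦ ⟨1, one_ne_zero, by simp⟩
    | insert s S hs ih =>
      intro hS
      obtain ⟨F, hF0, hF⟩ := ih fun t ht ↦ hS t (Finset.mem_insert_of_mem ht)
      have hsV := hS s (Finset.mem_insert_self s S)
      -- Since `f / f` must be a unit at every point of its open set, `f s.2 = 0` means that this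
      -- basic open has no points.
      by_cases hfs : f s.2 = 0
      · refine ⟨F, hF0, fun t ht x hx ↦ ?_⟩
        obtain rfl | ht := Finset.mem_insert.mp ht
        · exact absurd (hf x _ _ (hsV hx) (hsV hx)).ne_zero (by simp [hfs])
        · exact hF t ht x hx
      -- Factors of `a` and `b` that divide a power of `s.1` are already units on the new basic
      -- open. The parts `a''` and `b''` prime to `s.1` are the obstruction, and `F` is multiplied
      -- by `b'' / a''`.
      obtain ⟨a, b, ha0, hb0, hab, hunit⟩ := exists_reduced_fraction hU hη (mul_ne_zero hfs hF0)
      obtain ⟨a', a'', m, rfl, ha', ha''⟩ := exists_mul_dvd_pow_isRelPrime s.1 ha0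
      obtain ⟨b', b'', m', rfl, hb', hb''⟩ := exists_mul_dvd_pow_isRelPrime s.1 hb0
      have hinj := toRat_injective hη
      have n1 : toRat U hη a'' ≠ 0 := (map_ne_zero_iff _ hinj).mpr (right_ne_zero_of_mul ha0)
      have n2 : toRat U hη b'' ≠ 0 := (map_ne_zero_iff _ hinj).mpr (right_ne_zero_of_mul hb0)
      have hu : ∀ {x} {c : Γ(X, U)}, x ∈ X.basicOpen c → IsUnitAt x (toRat U hη c) :=
        fun {x c} hx ↦ (isUnitAt_toRat_iff (X.basicOpen_le _ hx) c).mpr hx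
      refine ⟨F * (toRat U hη b'' / toRat U hη a''),
        mul_ne_zero hF0 (div_ne_zero n2 n1), fun t ht x hx ↦ ?_⟩
      rw [← mul_assoc]
      obtain rfl | ht := Finset.mem_insert.mp ht
      · rw [hab, map_mul, map_mul, ← mul_div_mul_comm, mul_assoc, mul_assoc,
          mul_comm (toRat U hη b''), mul_div_mul_right _ _ (mul_ne_zero n1 n2)]
        exact (hu (mem_basicOpen_of_dvd ha' (mem_basicOpen_pow hx m))).div
          (hu (mem_basicOpen_of_dvd hb' (mem_basicOpen_pow hx m')))
      -- On an earlier basic open the correction is harmless: it has no zeros where `s.1 * t.1` is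
      -- invertible, so its factors divide a power of `s.1 * t.1`, and being prime to `s.1` they
      -- divide a power of `t.1`.
      · have key : ∀ {c' c'' : Γ(X, U)}, IsRelPrime c'' s.1 → (∀ y, y ∈ U → IsUnitAt y (f s.2 * F) →
            y ∈ X.basicOpen (c' * c'')) → IsUnitAt x (toRat U hη c'') := by
          intro c' c'' hc hcu
          have hcy : ∀ y, y ∈ X.basicOpen (s.1 * t.1) → y ∈ X.basicOpen c'' := fun y hy ↦ by
            obtain ⟨hy1, hy2⟩ := mem_basicOpen_mul.mp hy
            refine (mem_basicOpen_mul.mp (hcu y (X.basicOpen_le _ hy1) ?_)).2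
            have hft := hF t ht y hy2
            have := (hf y s.2 t.2 (hsV hy1)
              (hS t (Finset.mem_insert_of_mem ht) hy2)).mul hft
            rwa [← mul_assoc, div_mul_cancel₀ _ (left_ne_zero_of_mul hft.ne_zero)] at this
          obtain ⟨M, hM⟩ := exists_dvd_pow_of_basicOpen hU hcy
          rw [mul_pow] at hM
          exact hu (mem_basicOpen_of_dvd (hc.pow_right.dvd_of_dvd_mul_left hM)
            (mem_basicOpen_pow hx M))
        exact (hF t ht x hx).mul ((key hb'' fun y hy h ↦ (hunit y hy h).2).div
          (key ha'' fun y hy h ↦ (hunit y hy h).1))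
  have hcov : ∀ x : U, ∃ s : Γ(X, U) × J, x.1 ∈ X.basicOpen s.1 ∧ X.basicOpen s.1 ≤ V s.2 := by
    rintro ⟨x, hx⟩
    obtain ⟨j, hj⟩ := hV x hx
    obtain ⟨h, hh, hxh⟩ := hU.exists_basicOpen_le (V := V j) ⟨x, hj⟩ hx
    exact ⟨(h, j), hxh, hh⟩
  choose s hs hsV using hcov
  obtain ⟨T, hT⟩ := hU.isCompact.elim_finite_subcover (fun x : U ↦ (X.basicOpen (s x).1 : Set X))
    (fun x ↦ (X.basicOpen _).2) fun x hx ↦ Set.mem_iUnion.mpr ⟨⟨x, hx⟩, hs ⟨x, hx⟩⟩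
  classical
  obtain ⟨F, hF0, hF⟩ := step (T.image s) fun t ht ↦ by
    obtain ⟨x, -, rfl⟩ := Finset.mem_image.mp ht
    exact hsV x
  refine ⟨F, hF0, fun x hx j hj ↦ ?_⟩
  obtain ⟨y, hy, hxy⟩ := Set.mem_iUnion₂.mp (hT hx)
  have h1 := hF (s y) (Finset.mem_image_of_mem _ hy) x hxy
  have h2 := (hf x j (s y).2 hj (hsV y hxy)).mul h1
  rwa [← mul_assoc, div_mul_cancel₀ _ (left_ne_zero_of_mul h1.ne_zero)] at h2

include hU in
/-- A rational function without zeros and poles outside of the zero set of a prime element is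
a power of this element times a unit. -/
theorem exists_isUnitAt_div_zpow {π : Γ(X, U)} (hπ : Prime π) {u : X.functionField}
    (hne : ∃ x, x ∈ X.basicOpen π) (hu : ∀ x ∈ X.basicOpen π, IsUnitAt x u) :
    ∃ m : ℤ, ∀ x ∈ U, IsUnitAt x (u / toRat U hη π ^ m) := by
  obtain ⟨x₀, hx₀⟩ := hne
  obtain ⟨a, b, ha0, hb0, rfl, hab⟩ := exists_reduced_fraction hU hη (hu x₀ hx₀).ne_zero
  have key : ∀ {c : Γ(X, U)}, (∀ x ∈ X.basicOpen π, x ∈ X.basicOpen c) →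
      ∃ (m : ℕ) (e : Γ(X, U)), IsUnit e ∧ c = e * π ^ m := by
    intro c hc
    obtain ⟨M, hM⟩ := exists_dvd_pow_of_basicOpen hU hc
    obtain ⟨m, -, e, he⟩ := (dvd_prime_pow hπ M).mp hM
    exact ⟨m, ↑e⁻¹, Units.isUnit _, by rw [← he, mul_comm c, Units.inv_mul_cancel_left]⟩
  obtain ⟨m, e, he, rfl⟩ := key fun x hx ↦ (hab x (X.basicOpen_le _ hx) (hu x hx)).1
  obtain ⟨m', e', he', rfl⟩ := key fun x hx ↦ (hab x (X.basicOpen_le _ hx) (hu x hx)).2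
  refine ⟨m - m', fun x hx ↦ ?_⟩
  have n0 : toRat U hη π ≠ 0 := (map_ne_zero_iff _ (toRat_injective hη)).mpr hπ.ne_zero
  have h1 : ∀ {e}, IsUnit e → IsUnitAt x (toRat U hη e) := fun {e} he ↦
    (isUnitAt_toRat_iff hx e).mpr (by rwa [Scheme.basicOpen_of_isUnit _ he])
  have := (h1 he).div (h1 he')
  convert this using 1
  have n1 := (h1 he').ne_zero
  rw [map_mul, map_mul, map_pow, map_pow, zpow_sub₀ n0, zpow_natCast, zpow_natCast]
  field_simp

end Factorial

end ProjBundle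

namespace ProjBundle

/-! ## The Picard group of a projective bundle over the projective line -/

section GlobalUnit

variable (X : Scheme.{0}) [IsIntegral X]

/-- The group of rational functions without zeros and poles. -/
def globalUnits : Subgroup X.functionFieldˣ where
  carrier := {u | ∀ x, IsUnitAt x u.1}
  mul_mem' hu hv x := (hu x).mul (hv x)
  one_mem' _ := isUnitAt_one
  inv_mem' {u} hu x := by
    rw [Units.val_inv_eq_inv_val]
    exact (hu x).inv

/-- The group of principal divisors. -/
def PrincipalDivisor := Additive (X.functionFieldˣ ⧸ globalUnits X)

instance : AddCommGroup (PrincipalDivisor X) :=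
  inferInstanceAs (AddCommGroup (Additive (X.functionFieldˣ ⧸ globalUnits X)))

variable {X}

/-- The divisor of an invertible rational function. -/
def unitDivisor : Additive X.functionFieldˣ →+ PrincipalDivisor X :=
  (QuotientGroup.mk' (globalUnits X)).toAdditive

open Classical in
/-- The divisor of a nonzero rational function. -/
def principal (u : X.functionField) : PrincipalDivisor X :=
  if h : u = 0 then 0 else unitDivisor (.ofMul (Units.mk0 u h))

variable {u v : X.functionField}

theorem principal_mul (hu : u ≠ 0) (hv : v ≠ 0) : principal (u * v) = principal u + principal v := by
  rw [principal, principal, principal, dif_neg hu, dif_neg hv, dif_neg (mul_ne_zero hu hv),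
    ← map_add, ← ofMul_mul]
  congr 2
  exact Units.ext rfl

theorem principal_zpow (hu : u ≠ 0) (m : ℤ) : principal (u ^ m) = m • principal u := by
  rw [principal, principal, dif_neg hu, dif_neg (zpow_ne_zero m hu), ← map_zsmul, ← ofMul_zpow]
  congr 2
  exact Units.ext (by simp)

theorem principal_eq_zero_iff (hu : u ≠ 0) : principal u = 0 ↔ ∀ x, IsUnitAt x u := by
  rw [principal, dif_neg hu]
  exact QuotientGroup.eq_one_iff (Units.mk0 u hu)

theorem principal_one : principal (1 : X.functionField) = 0 :=
  (principal_eq_zero_iff one_ne_zero).mpr fun _ ↦ isUnitAt_one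

theorem principal_inv (hu : u ≠ 0) : principal u⁻¹ = -principal u := by
  rw [eq_neg_iff_add_eq_zero, ← principal_mul (inv_ne_zero hu) hu, inv_mul_cancel₀ hu,
    principal_one]

theorem principal_div (hu : u ≠ 0) (hv : v ≠ 0) : principal (u / v) = principal u - principal v := by
  rw [div_eq_mul_inv, principal_mul hu (inv_ne_zero hv), principal_inv hv, sub_eq_add_neg]

end GlobalUnit

section Chart

variable {n : ℕ} {d : Fin n → ℤ} (P : ProjectiveBundle (splitBundle d))

/-- The point of a chart where a homomorphism from the polynomial ring to a domain is centered. -/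
def chartPoint (i : Fin 2) (k : Fin n) {F : Type*} [CommRing F] [IsDomain F] (ψ : MvPolynomial (Fin n) ℂ →+* F) :
    P.X :=
  (isAffineOpen_chart P i k).fromSpec ⟨RingHom.ker (ψ.comp
    (RingEquiv.ofBijective _ (chartHom_bijective P i k)).symm.toRingHom), RingHom.ker_isPrime _⟩

theorem chartPoint_mem (i : Fin 2) (k : Fin n) {F : Type*} [CommRing F] [IsDomain F]
    (ψ : MvPolynomial (Fin n) ℂ →+* F) : chartPoint P i k ψ ∈ chart P i k :=
  (isAffineOpen_chart P i k).fromSpec_mem _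

theorem chartPoint_mem_basicOpen_iff (i : Fin 2) (k : Fin n) {F : Type*} [CommRing F] [IsDomain F]
    (ψ : MvPolynomial (Fin n) ℂ →+* F) (f : MvPolynomial (Fin n) ℂ) :
    chartPoint P i k ψ ∈ P.X.basicOpen (chartHom P i k f) ↔ ψ f ≠ 0 := by
  rw [chartPoint, (isAffineOpen_chart P i k).mem_basicOpen_fromSpec_iff]
  change ¬ (ψ _ = 0) ↔ _
  have : (RingEquiv.ofBijective _ (chartHom_bijective P i k)).symm.toRingHom (chartHom P i k f) = f :=
    (RingEquiv.ofBijective _ (chartHom_bijective P i k)).symm_apply_apply f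
  rw [this]

theorem uniqueFactorizationMonoid_chart (i : Fin 2) (k : Fin n) :
    UniqueFactorizationMonoid Γ(P.X, chart P i k) :=
  (RingEquiv.ofBijective _ (chartHom_bijective P i k)).toMulEquiv.uniqueFactorizationMonoid
    inferInstance

theorem prime_coord (i : Fin 2) (k l : Fin n) : Prime (coord P i k l) := by
  rw [← chartHom_X]
  exact (MulEquiv.prime_iff (RingEquiv.ofBijective _ (chartHom_bijective P i k)).toMulEquiv).mpr
    (MvPolynomial.X_prime)

variable [NeZero n]

theorem coordRat_ne_zero (i : Fin 2) (k l : Fin n) : coordRat P i k l ≠ 0 :=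
  (map_ne_zero_iff _ (chartRat_injective P i k)).mpr (coord_ne_zero P i k l)

theorem isUnitAt_coordRat_iff {i : Fin 2} {k : Fin n} {x : P.X} (hx : x ∈ chart P i k) (l : Fin n) :
    IsUnitAt x (coordRat P i k l) ↔ x ∈ P.X.basicOpen (coord P i k l) :=
  isUnitAt_chartRat_iff P hx _

theorem isUnitAt_coordRat_chartPoint (i : Fin 2) (k : Fin n) {F : Type*} [CommRing F] [IsDomain F]
    (ψ : MvPolynomial (Fin n) ℂ →+* F) (l : Fin n) :
    IsUnitAt (chartPoint P i k ψ) (coordRat P i k l) ↔ ψ (MvPolynomial.X l) ≠ 0 := by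
  rw [isUnitAt_coordRat_iff P (chartPoint_mem P i k ψ), ← chartHom_X, chartPoint_mem_basicOpen_iff]

/-- The hyperplanes of two coordinates are different: at the point where coordinate `l` is zero and
the others are one, the second factor is a unit, so a nonzero power of the first would have to be a
unit as well. -/
theorem coordRat_independent (i : Fin 2) (k : Fin n) {l l' : Fin n} (h : l ≠ l') {a b : ℤ}
    (hab : a • principal (coordRat P i k l) + b • principal (coordRat P i k l') = 0) : a = 0 := by
  have n1 := coordRat_ne_zero P i k l
  have n2 := coordRat_ne_zero P i k l'
  rw [← principal_zpow n1, ← principal_zpow n2, ← principal_mul (zpow_ne_zero _ n1)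
    (zpow_ne_zero _ n2), principal_eq_zero_iff (mul_ne_zero (zpow_ne_zero _ n1)
    (zpow_ne_zero _ n2))] at hab
  classical
  let ψ : MvPolynomial (Fin n) ℂ →+* ℂ := MvPolynomial.eval fun j ↦ if j = l then 0 else 1
  have hx := hab (chartPoint P i k ψ)
  have h1 : ¬ IsUnitAt (chartPoint P i k ψ) (coordRat P i k l) := by
    rw [isUnitAt_coordRat_chartPoint]; simp [ψ]
  have h2 : IsUnitAt (chartPoint P i k ψ) (coordRat P i k l') := by
    rw [isUnitAt_coordRat_chartPoint]; simp [ψ, h.symm]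
  have h3 := hx.div (h2.zpow b)
  rw [mul_div_cancel_right₀ _ (zpow_ne_zero _ n2)] at h3
  have hreg : IsRegAt (chartPoint P i k ψ) (coordRat P i k l) :=
    isRegAt_chartRat P (chartPoint_mem P i k ψ) _
  by_contra ha
  refine h1 (isUnitAt_of_isRegAt_inv n1 hreg ?_)
  rcases lt_or_gt_of_ne ha with ha | ha
  · have e : (coordRat P i k l)⁻¹ = coordRat P i k l ^ a * coordRat P i k l ^ (-a - 1).toNat := by
      rw [← zpow_natCast, Int.toNat_of_nonneg (by omega), ← zpow_add₀ n1, ← zpow_neg_one]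
      congr 1; ring
    rw [e]
    exact h3.isRegAt.mul (hreg.pow _)
  · have e : (coordRat P i k l)⁻¹ = (coordRat P i k l ^ a)⁻¹ * coordRat P i k l ^ (a - 1).toNat := by
      rw [← zpow_natCast, Int.toNat_of_nonneg (by omega), ← zpow_neg, ← zpow_add₀ n1, ← zpow_neg_one]
      congr 1; ring
    rw [e]
    exact h3.inv.isRegAt.mul (hreg.pow _)

theorem isUnitAt_toRat_constHom {U : P.X.Opens} (hη : genericPoint P.X ∈ U) {c : ℂ} (hc : c ≠ 0)
    (x : P.X) : IsUnitAt x (toRat U hη (constHom P.toSpec U c)) := by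
  obtain ⟨i, k, hx⟩ := exists_mem_chart P x
  have e : toRat U hη (constHom P.toSpec U c) = chartRat P i k (constHom P.toSpec _ c) :=
    (germ_constHom P.toSpec hη c).trans
      (germ_constHom P.toSpec (genericPoint_mem_chart P i k) c).symm
  rw [e, isUnitAt_chartRat_iff P hx, Scheme.basicOpen_of_isUnit]
  · exact hx
  · exact (isUnit_iff_ne_zero.mpr hc).map _

/-- A rational function without zeros and poles on a chart has no zeros and poles at all. -/
theorem isUnitAt_of_forall_mem_chart (i : Fin 2) (k : Fin n) {u : P.X.functionField}
    (hu : ∀ x ∈ chart P i k, IsUnitAt x u) (x : P.X) : IsUnitAt x u := by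
  have := isDomain_chart P i k
  have := uniqueFactorizationMonoid_chart P i k
  have hU := isAffineOpen_chart P i k
  have hη := genericPoint_mem_chart P i k
  obtain ⟨a, b, ha0, hb0, rfl, hab⟩ := exists_reduced_fraction hU hη (hu _ hη).ne_zero
  -- A function without zeros on the chart is a unit of a polynomial ring over `ℂ`, hence a
  -- constant.
  have key : ∀ {c}, (∀ x ∈ chart P i k, x ∈ P.X.basicOpen c) →
      IsUnitAt x (toRat (chart P i k) hη c) := by
    intro c hc
    obtain ⟨m, hm⟩ := exists_dvd_pow_of_basicOpen (h := 1) hU fun y hy ↦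
      hc y (P.X.basicOpen_le _ hy)
    rw [one_pow] at hm
    obtain ⟨c, rfl⟩ := (chartHom_bijective P i k).surjective c
    have h1 : IsUnit c := (MulEquiv.isUnit_map
      (RingEquiv.ofBijective _ (chartHom_bijective P i k)).toMulEquiv).mp (isUnit_of_dvd_one hm)
    obtain ⟨r, hr, rfl⟩ := MvPolynomial.isUnit_iff_eq_C_of_isReduced.mp h1
    rw [chartHom_C]
    exact isUnitAt_toRat_constHom P hη hr.ne_zero x
  exact (key fun y hy ↦ (hab y hy (hu y hy)).1).div (key fun y hy ↦ (hab y hy (hu y hy)).2)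

/-- A function that differs from another one only along a coordinate hyperplane. -/
theorem exists_principal_coordRat (i : Fin 2) (k l : Fin n) {u : P.X.functionField}
    (hu : ∀ x ∈ chart P i k, IsUnitAt x (coordRat P i k l) → IsUnitAt x u) :
    ∃ m : ℤ, principal u = m • principal (coordRat P i k l) := by
  have := isDomain_chart P i k
  have := uniqueFactorizationMonoid_chart P i k
  have hU := isAffineOpen_chart P i k
  obtain ⟨x₀, hx₀⟩ := hU.exists_mem_basicOpen (coord_ne_zero P i k l)
  have hu' : ∀ x ∈ P.X.basicOpen (coord P i k l), IsUnitAt x u := fun x hx ↦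
    hu x (P.X.basicOpen_le _ hx) ((isUnitAt_coordRat_iff P (P.X.basicOpen_le _ hx) l).mpr hx)
  obtain ⟨m, hm⟩ := exists_isUnitAt_div_zpow hU (genericPoint_mem_chart P i k)
    (prime_coord P i k l) ⟨x₀, hx₀⟩ hu'
  have n0 := zpow_ne_zero m (coordRat_ne_zero P i k l)
  have n1 := (hu' x₀ hx₀).ne_zero
  refine ⟨m, ?_⟩
  rw [← principal_zpow (coordRat_ne_zero P i k l), ← sub_eq_zero, ← principal_div n1 n0,
    principal_eq_zero_iff (div_ne_zero n1 n0)]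
  exact isUnitAt_of_forall_mem_chart P i k hm

/-- The frames of a line bundle are, up to a global rational function, products of powers of
the frames of the two standard line bundles. -/
theorem exists_isFrameSystem (L : LineBundle P.X) : ∃ (c : P.X.functionField) (m l : ℤ), c ≠ 0 ∧
    IsFrameSystem P L fun a ↦ c * tautFrame P a ^ m * baseFrame P a ^ l := by
  let i₁ := L.idx (genericPoint P.X)
  -- The charts are factorial, so `L` has a frame on each. Below, the frames of charts that differ
  -- in one index are compared; their quotient has zeros and poles only along one coordinate
  -- hyperplane of the chart.
  have hloc : ∀ a : Fin 2 × Fin n, ∃ F : P.X.functionField, F ≠ 0 ∧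
      ∀ x ∈ chart P a.1 a.2, ∀ j, x ∈ L.U j → IsUnitAt x (frameRat L i₁ j * F) := by
    intro a
    have := isDomain_chart P a.1 a.2
    have := uniqueFactorizationMonoid_chart P a.1 a.2
    refine exists_frame (isAffineOpen_chart P a.1 a.2) (genericPoint_mem_chart P a.1 a.2) L.U
      (fun x _ ↦ L.exists_mem x) (frameRat L i₁) fun x i j hi hj ↦ ?_
    have hη := mem_idx L (genericPoint P.X)
    have h1 := frameRat_mul L hη (genericPoint_mem hj) (genericPoint_mem hi)
    have h2 := isUnitAt_frameRat L hj hi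
    have h3 : IsUnitAt (genericPoint P.X) (frameRat L i₁ j) :=
      isUnitAt_frameRat L hη (genericPoint_mem hj)
    change IsUnitAt x (frameRat L i₁ i / frameRat L i₁ j)
    rw [h1, mul_div_cancel_left₀ _ h3.ne_zero]
    exact h2
  choose F hF0 hF using hloc
  have hdiv : ∀ a b x, x ∈ chart P a.1 a.2 → x ∈ chart P b.1 b.2 → IsUnitAt x (F a / F b) := by
    intro a b x ha hb
    obtain ⟨j, hj⟩ := L.exists_mem x
    have h1 := hF a x ha j hj
    rw [← mul_div_mul_left _ _ (left_ne_zero_of_mul h1.ne_zero)]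
    exact h1.div (hF b x hb j hj)
  have hfib : ∀ i k l, k ≠ l → ∃ m : ℤ, principal (F (i, l)) - principal (F (i, k)) =
      m • (principal (fiberRat P i l) - principal (fiberRat P i k)) := by
    intro i k l hkl
    obtain ⟨m, hm⟩ := exists_principal_coordRat P i k l (u := F (i, l) / F (i, k)) fun x hx hu ↦
      hdiv (i, l) (i, k) x ((mem_chart_iff_isUnitAt P hx i l).mpr ⟨by
        rw [div_self (baseRat_ne_zero P i)]; exact isUnitAt_one,
          coordRat_of_ne P i hkl.symm ▸ hu⟩) hx
    rw [principal_div (hF0 _) (hF0 _), coordRat_of_ne P i hkl.symm,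
      principal_div (fiberRat_ne_zero P _ _) (fiberRat_ne_zero P _ _)] at hm
    exact ⟨m, hm⟩
  have hbase : ∀ k, ∃ m : ℤ, principal (F (1, k)) - principal (F (0, k)) =
      m • principal (baseRat P 1) := by
    intro k
    have e : coordRat P 0 k k = baseRat P 1 := by
      rw [coordRat_self, baseRat_zero, div_one, zero_add]
    obtain ⟨m, hm⟩ := exists_principal_coordRat P 0 k k (u := F (1, k) / F (0, k)) fun x hx hu ↦
      hdiv (1, k) (0, k) x ((mem_chart_iff_isUnitAt P hx 1 k).mpr ⟨by
        rw [baseRat_zero, div_one, ← e]; exact hu, by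
        rw [div_self (fiberRat_ne_zero P 0 k)]; exact isUnitAt_one⟩) hx
    rw [principal_div (hF0 _) (hF0 _), e] at hm
    exact ⟨m, hm⟩
  have hb0 : principal (baseRat P 0) = 0 := by rw [baseRat_zero, principal_one]
  have he0 : principal (fiberRat P 0 0) = 0 := by rw [fiberRat_zero_zero, principal_one]
  have he1 : ∀ k, principal (fiberRat P 1 k) =
      d k • principal (baseRat P 1) + principal (fiberRat P 0 k) := by
    intro k
    rw [fiberRat_eq P 1 0, baseRat_zero, div_one, principal_mul
      (zpow_ne_zero _ (baseRat_ne_zero P 1)) (fiberRat_ne_zero P 0 k),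
      principal_zpow (baseRat_ne_zero P 1)]
  have hy : ∀ k, k ≠ 0 → coordRat P 0 0 k = fiberRat P 0 k := fun k hk ↦ by
    rw [coordRat_of_ne P 0 hk, fiberRat_zero_zero, div_one]
  have ht : coordRat P 0 0 0 = baseRat P 1 := by
    rw [coordRat_self, baseRat_zero, div_one, zero_add]
  obtain ⟨n₀, hn₀⟩ := hbase 0
  -- Going around the square of charts `(0, 0)`, `(0, k)`, `(1, k)`, `(1, 0)`, independence of the
  -- two coordinate divisors forces the same fibre exponent over both base charts. The base exponent
  -- is `n₀ - m * d 0` because the tautological frame of `(1, 0)` already contains the base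
  -- coordinate to the power `d 0`.
  have hk0 : ∀ k, k ≠ 0 → ∃ m : ℤ,
      principal (F (0, k)) = principal (F (0, 0)) + m • principal (fiberRat P 0 k) ∧
      principal (F (1, k)) = principal (F (0, 0)) + m • principal (fiberRat P 1 k) +
        (n₀ - m * d 0) • principal (baseRat P 1) := by
    intro k hk
    obtain ⟨m, hm⟩ := hfib 0 0 k hk.symm
    obtain ⟨m', hm'⟩ := hfib 1 0 k hk.symm
    obtain ⟨n', hn'⟩ := hbase k
    rw [he1, he1] at hm'
    rw [he0, sub_zero] at hm
    rw [he0] at hm'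
    have h1 : m' - m = 0 := by
      refine coordRat_independent P 0 0 hk (b := n₀ + m' * (d k - d 0) - n') ?_
      rw [hy k hk, ht]
      linear_combination (norm := module) hm - hm' + hn' - hn₀
    obtain rfl : m' = m := by omega
    refine ⟨m', ?_, ?_⟩
    · linear_combination (norm := module) hm
    · rw [he1]
      linear_combination (norm := module) hm' + hn₀
  -- The exponents found for different `k` agree, by comparison of the charts `(0, k)` and `(0, l)`
  -- directly and through `(0, 0)`.
  obtain ⟨m, hm⟩ : ∃ m : ℤ, ∀ k,
      principal (F (0, k)) = principal (F (0, 0)) + m • principal (fiberRat P 0 k) ∧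
      principal (F (1, k)) = principal (F (0, 0)) + m • principal (fiberRat P 1 k) +
        (n₀ - m * d 0) • principal (baseRat P 1) := by
    have hzero : ∀ m : ℤ,
        principal (F (0, 0)) = principal (F (0, 0)) + m • principal (fiberRat P 0 0) ∧
        principal (F (1, 0)) = principal (F (0, 0)) + m • principal (fiberRat P 1 0) +
          (n₀ - m * d 0) • principal (baseRat P 1) := by
      intro m
      rw [he1, he0, smul_zero]
      refine ⟨by abel, ?_⟩
      linear_combination (norm := module) hn₀
    by_cases h : ∃ k : Fin n, k ≠ 0
    · obtain ⟨k, hk⟩ := h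
      obtain ⟨m, hm⟩ := hk0 k hk
      refine ⟨m, fun l ↦ ?_⟩
      by_cases hl : l = 0
      · exact hl ▸ hzero m
      by_cases hlk : k = l
      · exact hlk ▸ hm
      obtain ⟨m', hm'⟩ := hk0 l hl
      obtain ⟨m'', hm''⟩ := hfib 0 k l hlk
      have h1 : m' - m'' = 0 := by
        refine coordRat_independent P 0 0 (Ne.symm hlk) (b := m'' - m) ?_
        rw [hy k hk, hy l hl]
        linear_combination (norm := module) hm.1 - hm'.1 + hm''
      have h2 : m'' - m = 0 := by
        refine coordRat_independent P 0 0 hlk (b := m' - m'') ?_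
        rw [hy k hk, hy l hl]
        linear_combination (norm := module) hm.1 - hm'.1 + hm''
      obtain rfl : m' = m := by omega
      exact hm'
    -- In rank one there are no fibre coordinates and any exponent works.
    · push Not at h
      refine ⟨0, fun l ↦ ?_⟩
      rw [h l]
      exact hzero 0
  refine ⟨F (0, 0), m, n₀ - m * d 0, hF0 _, fun x j a hj ha ↦ ?_⟩
  have key : principal (F a) = principal (F (0, 0)) + m • principal (tautFrame P a) +
      (n₀ - m * d 0) • principal (baseFrame P a) := by
    obtain ⟨i, k⟩ := a
    obtain rfl | rfl := Fin.eq_or_eq_add_one 0 i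
    · rw [tautFrame, baseFrame, hb0, smul_zero, add_zero]
      exact (hm k).1
    · exact (hm k).2
  have n1 := zpow_ne_zero m (fiberRat_ne_zero P a.1 a.2)
  have n2 := zpow_ne_zero (n₀ - m * d 0) (baseRat_ne_zero P a.1)
  have n3 : F (0, 0) * tautFrame P a ^ m * baseFrame P a ^ (n₀ - m * d 0) ≠ 0 :=
    mul_ne_zero (mul_ne_zero (hF0 _) n1) n2
  have n1 : tautFrame P a ^ m ≠ 0 := n1
  have n2 : baseFrame P a ^ (n₀ - m * d 0) ≠ 0 := n2
  rw [← principal_zpow (u := tautFrame P a) (fiberRat_ne_zero P a.1 a.2),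
    ← principal_zpow (u := baseFrame P a) (baseRat_ne_zero P a.1),
    ← principal_mul (hF0 _) n1, ← principal_mul (mul_ne_zero (hF0 _) n1) n2, ← sub_eq_zero,
    ← principal_div (hF0 _) n3, principal_eq_zero_iff (div_ne_zero (hF0 _) n3)] at key
  have h1 := (hF a x ha j hj).div (key x)
  have n4 := hF0 a
  have e : ∀ u v w : P.X.functionField, v ≠ 0 → w ≠ 0 → u * v / (v / w) = u * w := by
    intro u v w hv hw
    field_simp
  rwa [e _ _ _ n4 n3] at h1

/-- The intersection numbers of all line bundles with a curve are determined by two of them. -/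
theorem exists_intersectionNumber_eq (L : LineBundle P.X) : ∃ m l : ℤ, ∀ η,
    IsCurve P.toSpec η → intersectionNumber P.toSpec L η =
      m * frameDegree P (tautFrame P) η + l * frameDegree P (baseFrame P) η := by
  obtain ⟨c, m, l, hc, h⟩ := exists_isFrameSystem P L
  exact ⟨m, l, fun η hη ↦ (intersectionNumber_eq_frameDegree P L (fun x j a _ ↦ h x j a) hη).trans
    (frameDegree_mul_zpow P c hc m l hη)⟩

end Chart

end ProjBundle

namespace ProjBundle

/-! ## Sections and lines -/

section Chart

variable {n : ℕ} {d : Fin n → ℤ} (P : ProjectiveBundle (splitBundle d))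

theorem chartEval_eq_zero_iff {i : Fin 2} {k : Fin n} {η : P.X} (hη : η ∈ chart P i k)
    (f : MvPolynomial (Fin n) ℂ) : chartEval P hη f = 0 ↔ η ∉ P.X.basicOpen (chartHom P i k f) :=
  P.X.evaluation_eq_zero_iff_notMem_basicOpen η hη _

/-- The parametrization of the affine line through `b` in the direction `c`. -/
def lineHom (b c : Fin n → ℂ) : MvPolynomial (Fin n) ℂ →+* Polynomial ℂ :=
  MvPolynomial.eval₂Hom Polynomial.C fun l ↦ Polynomial.C (b l) + Polynomial.C (c l) * Polynomial.X

/-- The generic point of the affine line through `b` in the direction `c`. -/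
def chartLine (i : Fin 2) (k : Fin n) (b c : Fin n → ℂ) : P.X := chartPoint P i k (lineHom b c)

theorem chartLine_mem (i : Fin 2) (k : Fin n) (b c : Fin n → ℂ) :
    chartLine P i k b c ∈ chart P i k := chartPoint_mem P i k _

theorem chartEval_chartLine_eq_zero_iff (i : Fin 2) (k : Fin n) (b c : Fin n → ℂ)
    (f : MvPolynomial (Fin n) ℂ) :
    chartEval P (chartLine_mem P i k b c) f = 0 ↔ lineHom b c f = 0 := by
  rw [chartEval_eq_zero_iff, chartLine, chartPoint_mem_basicOpen_iff, not_not]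

theorem chartEval_chartLine_eq (i : Fin 2) (k : Fin n) (b c : Fin n → ℂ)
    {f g : MvPolynomial (Fin n) ℂ} (h : lineHom b c f = lineHom b c g) :
    chartEval P (chartLine_mem P i k b c) f = chartEval P (chartLine_mem P i k b c) g := by
  rw [← sub_eq_zero, ← map_sub, chartEval_chartLine_eq_zero_iff, map_sub, h, sub_self]

theorem transcendental_chartEval_chartLine (i : Fin 2) (k : Fin n) (b c : Fin n → ℂ) {l : Fin n}
    (hl : c l ≠ 0) :
    letI := (residueHom P.toSpec (chartLine P i k b c)).toAlgebra
    Transcendental ℂ (chartEval P (chartLine_mem P i k b c) (MvPolynomial.X l)) := by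
  let _ := (residueHom P.toSpec (chartLine P i k b c)).toAlgebra
  rw [transcendental_iff]
  intro f hf
  have h1 : Polynomial.aeval (chartEval P (chartLine_mem P i k b c) (MvPolynomial.X l)) f =
      chartEval P (chartLine_mem P i k b c) (Polynomial.aeval (MvPolynomial.X l) f) := by
    rw [Polynomial.aeval_def, Polynomial.aeval_def, Polynomial.hom_eval₂]
    congr 1
    exact RingHom.ext fun c ↦ (chartEval_C P _ c).symm
  rw [h1, chartEval_chartLine_eq_zero_iff, Polynomial.aeval_def, Polynomial.hom_eval₂] at hf
  have h2 : f.comp (Polynomial.C (b l) + Polynomial.C (c l) * Polynomial.X) = 0 := by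
    rw [← hf, Polynomial.comp, lineHom, MvPolynomial.eval₂Hom_X']
    congr 1
    exact RingHom.ext fun c ↦ (MvPolynomial.eval₂Hom_C _ _ c).symm
  rw [Polynomial.comp_eq_zero_iff] at h2
  refine h2.resolve_right fun h ↦ hl ?_
  simpa using congrArg (fun q ↦ q.coeff 1) h.2

/-- On the line every coordinate is an affine function of one coordinate `T` along which the line
moves, so the residue field is algebraic over the field generated by `T`, and `T` is transcendental.
-/
theorem isCurve_chartLine (i : Fin 2) (k : Fin n) (b : Fin n → ℂ) {c : Fin n → ℂ} (hc : c ≠ 0) :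
    IsCurve P.toSpec (chartLine P i k b c) := by
  obtain ⟨l, hl⟩ := Function.ne_iff.mp hc
  let _ := (residueHom P.toSpec (chartLine P i k b c)).toAlgebra
  let T := chartEval P (chartLine_mem P i k b c) (MvPolynomial.X l)
  have hT : Transcendental ℂ T := transcendental_chartEval_chartLine P i k b c hl
  have hmem : ∀ f, chartEval P (chartLine_mem P i k b c) f ∈
      Algebra.adjoin ℂ (Set.range fun _ : Unit ↦ T) := by
    intro f
    let χ : MvPolynomial (Fin n) ℂ →ₐ[ℂ] P.X.residueField (chartLine P i k b c) :=
      { chartEval P (chartLine_mem P i k b c) with commutes' := chartEval_C P _ }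
    change χ f ∈ _
    induction f using MvPolynomial.induction_on with
    | C r =>
      rw [← MvPolynomial.algebraMap_eq, AlgHom.commutes]
      exact Subalgebra.algebraMap_mem _ r
    | add p q hp hq => rw [map_add]; exact add_mem hp hq
    | mul_X p m hp =>
      rw [map_mul]
      refine mul_mem hp ?_
      have h1 : χ (MvPolynomial.X m) = χ (MvPolynomial.C (b m - c m / c l * b l) +
          MvPolynomial.C (c m / c l) * MvPolynomial.X l) := by
        refine chartEval_chartLine_eq P i k b c ?_
        simp only [lineHom, map_add, map_mul, MvPolynomial.eval₂Hom_X', MvPolynomial.eval₂Hom_C,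
          Polynomial.C_sub]
        have e : Polynomial.C (c m) = Polynomial.C (c m / c l) * Polynomial.C (c l) := by
          rw [← Polynomial.C_mul, div_mul_cancel₀ _ hl]
        linear_combination Polynomial.X * e
      rw [h1, map_add, map_mul, ← MvPolynomial.algebraMap_eq, AlgHom.commutes, AlgHom.commutes]
      exact add_mem (Subalgebra.algebraMap_mem _ _) (mul_mem (Subalgebra.algebraMap_mem _ _)
        (Algebra.subset_adjoin ⟨(), rfl⟩))
  have hb : IsTranscendenceBasis ℂ (fun _ : Unit ↦ T) := by
    rw [isTranscendenceBasis_iff_algebraicIndependent_isAlgebraic]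
    refine ⟨(algebraicIndependent_unique_type_iff (x := fun _ : Unit ↦ T)).mpr hT, ⟨fun z ↦ ?_⟩⟩
    obtain ⟨f, g, hg, hfg⟩ := exists_mul_chartEval P (chartLine_mem P i k b c) z
    rw [eq_div_of_mul_eq hg hfg]
    have h2 : ∀ f, IsAlgebraic (Algebra.adjoin ℂ (Set.range fun _ : Unit ↦ T))
      (chartEval P (chartLine_mem P i k b c) f) := fun f ↦
        isAlgebraic_algebraMap (⟨_, hmem f⟩ : Algebra.adjoin ℂ (Set.range fun _ : Unit ↦ T))
    rw [div_eq_mul_inv]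
    exact (h2 f).mul (h2 g).inv
  have h3 := hb.cardinalMk_eq_trdeg
  rw [Cardinal.mk_unit] at h3
  exact h3.symm

/-- The closed point of a chart with the given coordinates. -/
def closedPoint (i : Fin 2) (k : Fin n) (b : Fin n → ℂ) : P.X :=
  chartPoint P i k (MvPolynomial.eval b : MvPolynomial (Fin n) ℂ →+* ℂ)

theorem closedPoint_mem (i : Fin 2) (k : Fin n) (b : Fin n → ℂ) :
    closedPoint P i k b ∈ chart P i k := chartPoint_mem P i k _

theorem chartLine_specializes (i : Fin 2) (k : Fin n) (b c : Fin n → ℂ) (s : ℂ) :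
    chartLine P i k b c ⤳ closedPoint P i k (b + s • c) := by
  refine (isAffineOpen_chart P i k).specializes (closedPoint_mem P i k _) fun f hf ↦ ?_
  obtain ⟨f, rfl⟩ := (chartHom_bijective P i k).surjective f
  rw [closedPoint, chartPoint_mem_basicOpen_iff] at hf
  rw [chartLine, chartPoint_mem_basicOpen_iff]
  intro h
  apply hf
  have e : (MvPolynomial.eval (b + s • c) : MvPolynomial (Fin n) ℂ →+* ℂ) =
      (Polynomial.evalRingHom s).comp (lineHom b c) := by
    apply MvPolynomial.ringHom_ext
    · intro r; simp [lineHom]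
    · intro l; simp [lineHom]; ring
  rw [e, RingHom.comp_apply, h, map_zero]

variable [NeZero n]

/-- Replacing the frame at `η` by another adds the divisor of a rational function on the curve,
which has degree zero. -/
theorem frameDegree_eq {H : Fin 2 × Fin n → P.X.functionField}
    (hH : ∀ x a b, x ∈ chart P a.1 a.2 → x ∈ chart P b.1 b.2 → IsUnitAt x (H a / H b))
    {η : P.X} (hη : IsCurve P.toSpec η) {a : Fin 2 × Fin n} (ha : η ∈ chart P a.1 a.2) :
    frameDegree P H η =
      ∑ᶠ w : Place P.toSpec η, w.ord (valueAt η (H a / H (chartIdx P w.center))) := by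
  have hu := hH _ _ _ ha (mem_chartIdx P η)
  have hH0 : ∀ a, H a ≠ 0 := fun a h ↦ by
    have := (hH _ a a (genericPoint_mem_chart P a.1 a.2) (genericPoint_mem_chart P a.1 a.2)).ne_zero
    simp [h] at this
  have key : ∀ w : Place P.toSpec η, w.ord (valueAt η (H a / H (chartIdx P w.center))) =
      w.ord (valueAt η (H a / H (chartIdx P η))) +
        w.ord (valueAt η (H (chartIdx P η) / H (chartIdx P w.center))) := by
    intro w
    have hb := (Place.specializes_center P w).mem_open (chart P _ _).2 (mem_chartIdx P w.center)
    have h2 := hH _ _ _ (mem_chartIdx P η) hb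
    rw [← w.ord_mul hu.valueAt_ne_zero h2.valueAt_ne_zero, ← valueAt_mul hu.isRegAt h2.isRegAt,
      div_mul_div_cancel₀ (hH0 _)]
  rw [finsum_congr key, finsum_add_distrib (finite_ord_ne_zero P hη _)
    (finite_support_frameDegree P H hη), finsum_ord P hη, zero_add]
  rfl

/-- The hypothesis says that every frame is a global section of the line bundle, so no summand is
negative: the bundle is globally generated by its frames. -/
theorem frameDegree_nonneg {H : Fin 2 × Fin n → P.X.functionField}
    (hH : ∀ x a b, x ∈ chart P b.1 b.2 → IsRegAt x (H a / H b)) (η : P.X) :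
    0 ≤ frameDegree P H η :=
  finsum_nonneg fun w ↦ (Place.isCenter_center P w).ord_nonneg (hH _ _ _ (mem_chartIdx P _))

/-- Two sections with nonconstant quotient on the curve: at a pole of `H m / H a` the section `H a`
vanishes to higher order than `H m`, so its order there is positive. -/
theorem frameDegree_pos {H : Fin 2 × Fin n → P.X.functionField} (h0 : ∀ a, H a ≠ 0)
    (hH : ∀ x a b, x ∈ chart P b.1 b.2 → IsRegAt x (H a / H b))
    {η : P.X} (hη : IsCurve P.toSpec η) {a m : Fin 2 × Fin n} (ha : η ∈ chart P a.1 a.2)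
    (ht : letI := (residueHom P.toSpec η).toAlgebra; Transcendental ℂ (valueAt η (H m / H a))) :
    0 < frameDegree P H η := by
  have hH' : ∀ x a b, x ∈ chart P a.1 a.2 → x ∈ chart P b.1 b.2 → IsUnitAt x (H a / H b) :=
    fun x a b ha hb ↦ isUnitAt_of_isRegAt_inv (div_ne_zero (h0 a) (h0 b)) (hH _ _ _ hb) (by
      rw [inv_div]; exact hH _ _ _ ha)
  rw [frameDegree_eq P hH' hη ha]
  have hv0 : valueAt η (H m / H a) ≠ 0 := by
    let _ := (residueHom P.toSpec η).toAlgebra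
    exact fun h ↦ ht (h ▸ isAlgebraic_zero)
  have hu := (hH η m a ha).isUnitAt hv0
  obtain ⟨w, hw⟩ := exists_ord_pos P hη (valueAt η (H m / H a))⁻¹ (by
    let _ := (residueHom P.toSpec η).toAlgebra
    exact fun h ↦ ht (by simpa using h.inv))
  refine finsum_pos (fun w ↦ ?_) ⟨w, ?_⟩ ?_
  · exact (Place.isCenter_center P w).ord_nonneg (hH _ _ _ (mem_chartIdx P _))
  · have hc := Place.isCenter_center P w
    have hs := Place.specializes_center P w
    have hb := hs.mem_open (chart P _ _).2 (mem_chartIdx P w.center)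
    have h1 := hH w.center m _ (mem_chartIdx P w.center)
    have h2 := hH' _ _ _ ha hb
    have e : H a / H (chartIdx P w.center) =
        (H m / H a)⁻¹ * (H m / H (chartIdx P w.center)) := by
      rw [inv_div, div_mul_div_cancel₀ (h0 m)]
    have h3 : valueAt η (H m / H (chartIdx P w.center)) ≠ 0 := by
      have : H m / H (chartIdx P w.center) = H m / H a * (H a / H (chartIdx P w.center)) := by
        rw [div_mul_div_cancel₀ (h0 a)]
      rw [this]
      exact (hu.mul h2).valueAt_ne_zero
    rw [e, valueAt_mul hu.inv.isRegAt (h1.specializes hs), w.ord_mul hu.inv.valueAt_ne_zero h3,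
      valueAt_inv hu]
    exact add_pos_of_pos_of_nonneg hw (hc.ord_nonneg h1)
  · exact finite_support_ord_div P _ H hη

theorem isRegAt_baseFrame_div (x : P.X) (a b : Fin 2 × Fin n) (hb : x ∈ chart P b.1 b.2) :
    IsRegAt x (baseFrame P a / baseFrame P b) := isRegAt_baseRat P hb _

/-- The quotient contains the power `d` of `xᵢ / xⱼ`, which is regular because the twists are
nonnegative. This is the nefness of `𝒪(1)`. -/
theorem isRegAt_tautFrame_div (hd : ∀ k, 0 ≤ d k) (x : P.X) (a b : Fin 2 × Fin n)
    (hb : x ∈ chart P b.1 b.2) : IsRegAt x (tautFrame P a / tautFrame P b) := by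
  rw [tautFrame, tautFrame, fiberRat_eq P a.1 b.1, mul_div_assoc, ← Int.toNat_of_nonneg (hd a.2),
    zpow_natCast]
  exact ((isRegAt_baseRat P hb _).pow _).mul (isRegAt_fiberRat P hb _)

/-- The zero section, given by the coordinate `e₀`. -/
def zeroSection : P.X := chartLine P 0 0 0 (Pi.single 0 1)

theorem isCurve_zeroSection : IsCurve P.toSpec (zeroSection P) :=
  isCurve_chartLine P 0 0 0 (Function.ne_iff.mpr ⟨0, by simp⟩)

theorem valueAt_coordRat (i : Fin 2) (k : Fin n) (b c : Fin n → ℂ) (l : Fin n) :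
    valueAt (chartLine P i k b c) (coordRat P i k l) =
      chartEval P (chartLine_mem P i k b c) (MvPolynomial.X l) := (chartEval_X P _ l).symm

theorem isUnitAt_coordRat_chartLine (i : Fin 2) (k : Fin n) (b c : Fin n → ℂ) (l : Fin n) :
    IsUnitAt (chartLine P i k b c) (coordRat P i k l) ↔ b l ≠ 0 ∨ c l ≠ 0 := by
  rw [chartLine, isUnitAt_coordRat_chartPoint, lineHom, MvPolynomial.eval₂Hom_X', Ne,
    ← not_and_or, not_iff_not]
  constructor
  · intro h
    have h0 := congrArg (fun q ↦ q.coeff 0) h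
    have h1 := congrArg (fun q ↦ q.coeff 1) h
    simp at h0 h1
    exact ⟨h0, h1⟩
  · rintro ⟨h0, h1⟩; simp [h0, h1]

theorem frameDegree_baseFrame_zeroSection_pos :
    0 < frameDegree P (baseFrame P) (zeroSection P) := by
  refine frameDegree_pos P (H := baseFrame P) (fun a ↦ baseRat_ne_zero P a.1) (isRegAt_baseFrame_div P)
    (isCurve_zeroSection P) (a := (0, 0)) (m := (1, 0)) (chartLine_mem P _ _ _ _) ?_
  have e : baseFrame P (1, 0) / baseFrame P (0, 0) = coordRat P 0 0 0 := (coordRat_self P 0 0).symm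
  rw [e, zeroSection, valueAt_coordRat]
  exact transcendental_chartEval_chartLine P _ _ _ _ (by simp)

/-- All `eₗ` with `l ≠ 0` vanish on the zero section, so only the two charts with fibre index zero
matter along it. -/
theorem eq_zero_of_zeroSection_mem {a : Fin 2 × Fin n} (ha : zeroSection P ∈ chart P a.1 a.2) :
    a.2 = 0 := by
  by_contra hk
  have h1 : IsUnitAt (chartLine P 0 0 0 (Pi.single 0 1)) _ :=
    ((mem_chart_iff_isUnitAt P (chartLine_mem P _ _ _ _) _ _).mp ha).2
  rw [← coordRat_of_ne P 0 hk, isUnitAt_coordRat_chartLine] at h1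
  simp [hk] at h1

/-- The restriction of `𝒪(1)` is the trivial quotient: since `d 0 = 0`, the frame `e₀` is the same
over both base charts. -/
theorem frameDegree_tautFrame_zeroSection (hd0 : d 0 = 0) :
    frameDegree P (tautFrame P) (zeroSection P) = 0 := by
  have h0 : zeroSection P ∈ chart P 0 0 := chartLine_mem P _ _ _ _
  rw [frameDegree_eq P (fun _ _ _ ↦ isUnitAt_tautFrame_div P) (isCurve_zeroSection P)
    (a := (0, 0)) h0]
  refine finsum_eq_zero_of_forall_eq_zero fun w ↦ ?_
  have hb := (Place.specializes_center P w).mem_open (chart P _ _).2 (mem_chartIdx P w.center)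
  have hk := eq_zero_of_zeroSection_mem P hb
  have e : ∀ i, tautFrame P (i, 0) = 1 := fun i ↦ by
    rw [tautFrame, fiberRat_eq P i 0, hd0, zpow_zero, one_mul, fiberRat_zero_zero]
  have e' : tautFrame P (chartIdx P w.center) = 1 := by
    rw [← e (chartIdx P w.center).1, ← hk]
  rw [e, e', div_one, valueAt_one]
  exact w.ord_eq_zero (map_one _)

theorem Place.ord_residueHom {X : Scheme.{0}} {p : X ⟶ Spec (.of ℂ)} {η : X} (w : Place p η)
    (c : ℂ) : w.ord (residueHom p η c) = 0 := by
  by_cases hc : c = 0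
  · simp [hc, Place.ord]
  · exact w.ord_eq_zero (w.map_const c hc)

theorem frameDegree_tautFrame_chartLine_pos (hd : ∀ k, 0 ≤ d k) (i : Fin 2) (b c : Fin n → ℂ)
    {l : Fin n} (hl : l ≠ 0) (hc : c l ≠ 0) :
    0 < frameDegree P (tautFrame P) (chartLine P i 0 b c) := by
  refine frameDegree_pos P (H := tautFrame P) (fun a ↦ fiberRat_ne_zero P a.1 a.2) (isRegAt_tautFrame_div P hd)
    (isCurve_chartLine P i 0 b (Function.ne_iff.mpr ⟨l, hc⟩)) (a := (i, 0)) (m := (i, l))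
    (chartLine_mem P _ _ _ _) ?_
  have e : tautFrame P (i, l) / tautFrame P (i, 0) = coordRat P i 0 l :=
    (coordRat_of_ne P i hl).symm
  rw [e, valueAt_coordRat]
  exact transcendental_chartEval_chartLine P _ _ _ _ hc

/-- The coordinate with index zero is the base coordinate, so `c 0 = 0` puts the line in a fibre,
where the quotients of base frames are constants. -/
theorem frameDegree_baseFrame_chartLine (i : Fin 2) (b : Fin n → ℂ) {c : Fin n → ℂ}
    (hc : c ≠ 0) (hc0 : c 0 = 0) :
    frameDegree P (baseFrame P) (chartLine P i 0 b c) = 0 := by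
  have h0 := chartLine_mem P i 0 b c
  rw [frameDegree_eq P (fun _ _ _ ↦ isUnitAt_baseFrame_div P) (isCurve_chartLine P i 0 b hc)
    (a := (i, 0)) h0]
  refine finsum_eq_zero_of_forall_eq_zero fun w ↦ ?_
  have hb := (Place.specializes_center P w).mem_open (chart P _ _).2 (mem_chartIdx P w.center)
  have hu := ((mem_chart_iff_isUnitAt P h0 _ _).mp hb).1
  rw [baseFrame, baseFrame, ← inv_div, valueAt_inv hu, w.ord_inv, neg_eq_zero]
  obtain h | h := Fin.eq_or_eq_add_one i (chartIdx P w.center).1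
  · rw [h, div_self (baseRat_ne_zero P i), valueAt_one]
    exact w.ord_eq_zero (map_one _)
  · rw [h, ← coordRat_self P i 0, valueAt_coordRat, chartEval_chartLine_eq (g := .C (b 0)),
      chartEval_C, w.ord_residueHom]
    simp [lineHom, hc0]

end Chart

end ProjBundle

namespace ProjBundle

/-! ## Jacobian determinants -/

section Jacobian

open KaehlerDifferential

/-- Localization is formally étale, so the differentials of the variables, a basis over the
polynomial ring, base change to a basis. -/
theorem exists_basis_of_isLocalization {k σ S : Type*} [CommRing k] [CommRing S] [Algebra k S]
    [Algebra (MvPolynomial σ k) S] [IsScalarTower k (MvPolynomial σ k) S]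
    (M : Submonoid (MvPolynomial σ k)) [IsLocalization M S] :
    ∃ b : Module.Basis σ S Ω[S⁄k], ∀ l, b l =
      D k S (algebraMap (MvPolynomial σ k) S (MvPolynomial.X l)) := by
  have := Algebra.FormallyEtale.of_isLocalization (Rₘ := S) M
  refine ⟨((mvPolynomialBasis k σ).baseChange S).map
    (tensorKaehlerEquivOfFormallyEtale k (MvPolynomial σ k) S), fun l ↦ ?_⟩
  rw [Module.Basis.map_apply, Module.Basis.baseChange_apply, mvPolynomialBasis_apply,
    ← tensorKaehlerEquivOfFormallyEtale_symm_D_algebraMap, LinearEquiv.apply_symm_apply]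

/-- Jacobian determinants with respect to corresponding coordinates commute with ring homomorphisms.
It carries the Jacobians from the stalks to the function field. -/
theorem det_map_D {k S T ι : Type*} [CommRing k] [CommRing S] [CommRing T] [Algebra k S]
    [Algebra k T] [Fintype ι] [DecidableEq ι] (g : S →ₐ[k] T) (b : Module.Basis ι S Ω[S⁄k])
    (b' : Module.Basis ι T Ω[T⁄k]) (x : ι → S) (hb : ∀ l, b l = D k S (x l))
    (hb' : ∀ l, b' l = D k T (g (x l))) (t : ι → S) :
    b'.det (fun l ↦ D k T (g (t l))) = g (b.det fun l ↦ D k S (t l)) := by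
  let _ := g.toAlgebra
  have : IsScalarTower k S T := .of_algebraMap_eq fun c ↦ (g.commutes c).symm
  rw [Module.Basis.det_apply, Module.Basis.det_apply]
  refine Eq.trans ?_ (RingHom.map_det g.toRingHom _).symm
  congr 1
  ext l m
  have h1 := congrArg (map k k S T) (b.sum_repr (D k S (t m)))
  simp only [map_sum, map_smul, hb, map_D] at h1
  change ∑ l, _ • D k T (g (x l)) = D k T (g (t m)) at h1
  simp only [← hb'] at h1
  rw [Module.Basis.toMatrix_apply, ← h1]
  have h2 : ∀ l, b.repr (D k S (t m)) l • b' l = g (b.repr (D k S (t m)) l) • b' l :=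
    fun l ↦ rfl
  simp only [h2]
  rw [Module.Basis.repr_sum_self]
  rfl

/-- The determinant factors through the top exterior power, so a transition function of the
canonical bundle becomes a quotient of Jacobians. -/
theorem det_eq_mul_det_of_ιMulti {S M : Type*} [CommRing S] [AddCommGroup M] [Module S M] {n : ℕ}
    (b : Module.Basis (Fin n) S M) {v w : Fin n → M} {g : S}
    (h : exteriorPower.ιMulti S n v = g • exteriorPower.ιMulti S n w) : b.det v = g * b.det w := by
  have h1 := congrArg (exteriorPower.alternatingMapLinearEquiv b.det) h
  rwa [map_smul, exteriorPower.alternatingMapLinearEquiv_apply_ιMulti,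
    exteriorPower.alternatingMapLinearEquiv_apply_ιMulti] at h1

theorem det_mul_det {S M : Type*} [CommRing S] [AddCommGroup M] [Module S M] {n : ℕ}
    (b b' : Module.Basis (Fin n) S M) (v : Fin n → M) : b.det v = b.det b' * b'.det v := by
  rw [Module.Basis.det_apply, Module.Basis.det_apply, Module.Basis.det_apply, ← Matrix.det_mul,
    Module.Basis.toMatrix_mul_toMatrix]

/-- This is the coordinate change along the zero section: `t ↦ t⁻¹` on the base and `yₗ ↦ t ^ dₗ yₗ`
in the fibres. The Jacobian matrix is triangular with diagonal entries `-t⁻²` and `t ^ dₗ`; the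
exponent `∑ dₗ - 2` is the source of the bound on the twists. -/
theorem det_monomial_change {k K : Type*} [Field k] [Field K] [Algebra k K] {n : ℕ} [NeZero n]
    (b : Module.Basis (Fin n) K Ω[K⁄k]) (x : Fin n → K) (hb : ∀ l, b l = D k K (x l))
    (h0 : x 0 ≠ 0) (d : Fin n → ℤ) (hd0 : d 0 = 0) :
    b.det (fun l ↦ D k K (if l = 0 then (x 0)⁻¹ else x 0 ^ d l * x l)) =
      - x 0 ^ (∑ l, d l - 2) := by
  have hr : ∀ l m, b.repr (D k K (x l)) m = if l = m then 1 else 0 := fun l ↦ by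
    intro m
    rw [← hb, b.repr_self, Finsupp.single_apply]
  have hentry : ∀ l m, b.toMatrix (fun l ↦ D k K (if l = 0 then (x 0)⁻¹ else x 0 ^ d l * x l)) l m =
      if m = 0 then -(x 0)⁻¹ ^ 2 * (if 0 = l then 1 else 0) else
        x 0 ^ d m * (if m = l then 1 else 0) +
          x m * (d m • (x 0 ^ (d m - 1) * (if 0 = l then 1 else 0))) := by
    intro l m
    rw [Module.Basis.toMatrix_apply]
    split_ifs with hm <;>
    simp [Derivation.leibniz, Derivation.leibniz_inv, Derivation.leibniz_zpow, *]
    all_goals exact .inl (mul_comm _ _)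
  rw [Module.Basis.det_apply, Matrix.det_of_isUpperTriangular]
  · have hdiag : ∀ m, b.toMatrix (fun l ↦ D k K (if l = 0 then (x 0)⁻¹ else x 0 ^ d l * x l)) m m =
        x 0 ^ d m * (if m = 0 then -(x 0)⁻¹ ^ 2 else 1) := by
      intro m
      rw [hentry]
      by_cases hm : m = 0
      · simp [hm, hd0]
      · simp [hm, Ne.symm hm]
    have hsum : ∀ s : Finset (Fin n), ∏ m ∈ s, x 0 ^ d m = x 0 ^ ∑ m ∈ s, d m := by
      intro s
      induction s using Finset.cons_induction with
      | empty => simp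
      | cons a s ha ih => rw [Finset.prod_cons, Finset.sum_cons, ih, zpow_add₀ h0]
    simp only [hdiag]
    rw [Finset.prod_mul_distrib, hsum, Finset.prod_ite_eq' Finset.univ (0 : Fin n) _,
      if_pos (Finset.mem_univ _), zpow_sub₀ h0]
    simp [div_eq_mul_inv]
  · intro l m hlm
    have h1 : m ≠ l := ne_of_lt hlm
    have h2 : (0 : Fin n) ≠ l := fun h ↦ by
      rw [← h] at hlm
      exact absurd hlm (Fin.not_lt_zero m)
    rw [hentry]
    simp [h1, h2]

end Jacobian

section Chart

variable {n : ℕ} {d : Fin n → ℤ} (P : ProjectiveBundle (splitBundle d))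

theorem exists_basis_stalk {i : Fin 2} {k : Fin n} {x : P.X} (hx : x ∈ chart P i k) :
    letI := (stalkHom P.toSpec x).toAlgebra
    ∃ b : Module.Basis (Fin n) (P.X.presheaf.stalk x) (Ω[P.X.presheaf.stalk x⁄ℂ]), ∀ l,
      b l = KaehlerDifferential.D ℂ (P.X.presheaf.stalk x)
        ((P.X.presheaf.germ (chart P i k) x hx).hom (coord P i k l)) := by
  let _ := (stalkHom P.toSpec x).toAlgebra
  let e := RingEquiv.ofBijective _ (chartHom_bijective P i k)
  let _ := P.X.presheaf.algebra_section_stalk (⟨x, hx⟩ : chart P i k)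
  have h1 := (isAffineOpen_chart P i k).isLocalization_stalk ⟨x, hx⟩
  let _ : Algebra (MvPolynomial (Fin n) ℂ) (P.X.presheaf.stalk x) :=
    ((algebraMap Γ(P.X, chart P i k) (P.X.presheaf.stalk x)).comp e.symm.symm.toRingHom).toAlgebra
  have h2 := IsLocalization.isLocalization_of_base_ringEquiv
    ((isAffineOpen_chart P i k).primeIdealOf ⟨x, hx⟩).asIdeal.primeCompl
    (P.X.presheaf.stalk x) e.symm
  have h3 : ∀ f, algebraMap (MvPolynomial (Fin n) ℂ) (P.X.presheaf.stalk x) f =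
    (P.X.presheaf.germ (chart P i k) x hx).hom (chartHom P i k f) := fun f ↦ rfl
  have : IsScalarTower ℂ (MvPolynomial (Fin n) ℂ) (P.X.presheaf.stalk x) :=
    .of_algebraMap_eq fun c ↦ by
      rw [MvPolynomial.algebraMap_eq, h3, chartHom_C, germ_constHom]
      rfl
  obtain ⟨b, hb⟩ := exists_basis_of_isLocalization (k := ℂ) (σ := Fin n)
    (S := P.X.presheaf.stalk x) (((isAffineOpen_chart P i k).primeIdealOf ⟨x, hx⟩).asIdeal.primeCompl.map e.symm)
  refine ⟨b, fun l ↦ ?_⟩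
  rw [hb, h3, chartHom_X]

variable [NeZero n]

theorem algebraMap_stalkHom (x : P.X) (c : ℂ) :
    algebraMap (P.X.presheaf.stalk x) P.X.functionField (stalkHom P.toSpec x c) =
      stalkHom P.toSpec (genericPoint P.X) c := by
  obtain ⟨i, k, hx⟩ := exists_mem_chart P x
  rw [← germ_constHom P.toSpec hx, algebraMap_germ hx]
  exact germ_constHom P.toSpec (genericPoint_mem hx) c

/-- A frame of `K` is the coordinate volume form of the chart times the Jacobian of its local
coordinates, and that Jacobian is a unit at each point. The volume forms of the two charts `(i, 0)`
differ by `± (x₁ / x₀) ^ (∑ d - 2)`, so up to sign and units the frames of `K` are powers of the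
base frames. -/
theorem exists_canonicalFrame (hd0 : d 0 = 0) (K : LineBundle P.X)
    (hK : IsCanonicalBundle P.toSpec K) : ∃ c : P.X.functionField, c ≠ 0 ∧
      ∀ (x : P.X) (j : K.ι) (i : Fin 2), x ∈ K.U j → x ∈ chart P i 0 →
        IsUnitAt x (frameRat K (K.idx (genericPoint P.X)) j *
          (c * baseRat P i ^ (∑ l, d l - 2))) := by
  obtain ⟨n', t, hb, hw⟩ := hK
  let η := genericPoint P.X
  let _ : Algebra ℂ (P.X.presheaf.stalk η) := (stalkHom P.toSpec η).toAlgebra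
  let _ : Field (P.X.presheaf.stalk η) := inferInstanceAs (Field P.X.functionField)
  have hη : ∀ i, η ∈ chart P i 0 := fun i ↦ genericPoint_mem_chart P i 0
  obtain ⟨b₁, hb₁⟩ := hb _ _ (mem_idx K η)
  have hB := fun i ↦ exists_basis_stalk P (hη i)
  choose B hB using hB
  -- The number of local coordinates in `hK` is not given, but it is the rank of the differentials
  -- at the generic point.
  obtain rfl : n' = n := by
    have h1 := Module.finrank_eq_card_basis b₁
    have h2 := Module.finrank_eq_card_basis (B 0)
    simp only [Fintype.card_fin] at h1 h2
    exact h1.symm.trans h2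
  let D := KaehlerDifferential.D ℂ (P.X.presheaf.stalk η)
  let J : ∀ j, η ∈ K.U j → P.X.functionField := fun j hj ↦
    (B 0).det fun k ↦ D ((P.X.presheaf.germ (K.U j) η hj).hom (t j k))
  have hgerm : ∀ {U : P.X.Opens} {x : P.X} (hx : x ∈ U) (f : Γ(P.X, U)),
      algebraMap (P.X.presheaf.stalk x) P.X.functionField ((P.X.presheaf.germ U x hx).hom f) =
        (P.X.presheaf.germ U η (genericPoint_mem hx)).hom f := fun hx f ↦ algebraMap_germ hx f
  -- At the stalk of `x` both families of differentials are bases, so their determinant is a unit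
  -- there; its image in the function field is the Jacobian.
  have hunit : ∀ (x : P.X) (j : K.ι) (i : Fin 2) (hj : x ∈ K.U j), x ∈ chart P i 0 →
      IsUnitAt x ((B i).det fun k ↦ D ((P.X.presheaf.germ (K.U j) η
        (genericPoint_mem hj)).hom (t j k))) := by
    intro x j i hj hx
    let _ : Algebra ℂ (P.X.presheaf.stalk x) := (stalkHom P.toSpec x).toAlgebra
    obtain ⟨b, hb'⟩ := exists_basis_stalk P hx
    obtain ⟨b', hb''⟩ := hb j x hj
    let g : P.X.presheaf.stalk x →ₐ[ℂ] P.X.presheaf.stalk η :=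
      { algebraMap (P.X.presheaf.stalk x) P.X.functionField with
        commutes' := algebraMap_stalkHom P x }
    have h1 := det_map_D g b (B i) _ hb' (fun l ↦ (hB i l).trans
      (congrArg D (hgerm hx (coord P i 0 l)).symm))
      (fun k ↦ (P.X.presheaf.germ (K.U j) x hj).hom (t j k))
    refine ⟨b.det b', b.isUnit_det b', ?_⟩
    rw [show (⇑b' : Fin n' → _) = _ from funext hb'']
    refine h1.symm.trans ?_
    congr 1
    funext k
    exact congrArg D (hgerm hj (t j k))
  have hJ0 : ∀ j hj, J j hj ≠ 0 := fun j hj ↦ (hunit η j 0 hj (hη 0)).ne_zero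
  have hframe : ∀ i j (hi : η ∈ K.U i) (hj : η ∈ K.U j), J i hi = frameRat K i j * J j hj := by
    intro i j hi hj
    rw [frameRat_of_mem K ⟨hi, hj⟩]
    exact det_eq_mul_det_of_ιMulti (B 0) (hw i j η hi hj)
  have hdet : ∀ i, ∃ ε : P.X.functionField, (ε = 1 ∨ ε = -1) ∧
      (B 0).det (B i) = ε * baseRat P i ^ (∑ l, d l - 2) := by
    intro i
    obtain rfl | rfl := Fin.eq_or_eq_add_one 0 i
    · refine ⟨1, .inl rfl, ?_⟩
      rw [baseRat_zero, one_zpow, one_mul, Module.Basis.det_self]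
    · refine ⟨-1, .inr rfl, ?_⟩
      have h1 : coordRat P 0 0 0 = baseRat P 1 := by
        rw [coordRat_self, baseRat_zero, div_one, zero_add]
      have h2 := det_monomial_change (k := ℂ) (K := P.X.presheaf.stalk η) (B 0) (coordRat P 0 0)
        (hB 0) (coordRat_ne_zero P 0 0 0) d hd0
      rw [h1] at h2
      rw [zero_add, neg_one_mul]
      refine Eq.trans ?_ h2
      congr 1
      funext l
      refine (hB (0 + 1) l).trans (congrArg D ?_)
      change coordRat P 1 0 l = _
      split_ifs with hl
      · subst hl
        have e : (1 : Fin 2) + 1 = 0 := rfl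
        rw [coordRat_self, e, baseRat_zero, one_div]
      · rw [coordRat_of_ne P 1 hl, coordRat_of_ne P 0 hl, fiberRat_zero_zero, fiberRat_eq P 1 0 l,
          fiberRat_eq P 1 0 0, hd0, fiberRat_zero_zero, baseRat_zero]
        simp
  refine ⟨(J _ (mem_idx K η))⁻¹, inv_ne_zero (hJ0 _ _), fun x j i hj hx ↦ ?_⟩
  have hjη := genericPoint_mem hj
  have h1 := hunit x j i hj hx
  obtain ⟨ε, hε, hD⟩ := hdet i
  have h2 : J j hjη = ε * baseRat P i ^ (∑ l, d l - 2) * _ :=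
    (det_mul_det (B 0) (B i) _).trans (congrArg (· * _) hD)
  have hεu : IsUnitAt x ε := by
    obtain rfl | rfl := hε
    · exact isUnitAt_one
    · exact ⟨-1, isUnit_one.neg, by simp⟩
  convert (hεu.mul h1).inv using 1
  rw [hframe _ j (mem_idx K η) hjη, h2]
  have n1 := h1.ne_zero
  have n2 := hεu.ne_zero
  have n3 := zpow_ne_zero (∑ l, d l - 2) (baseRat_ne_zero P i)
  have n4 : frameRat K (K.idx η) j ≠ 0 := fun h ↦ hJ0 _ (mem_idx K η) (by
    rw [hframe _ j (mem_idx K η) hjη, h, zero_mul])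
  have e : ∀ f ε β u : P.X.functionField, f ≠ 0 → ε ≠ 0 → β ≠ 0 → u ≠ 0 →
      f * ((f * (ε * β * u))⁻¹ * β) = (ε * u)⁻¹ := by
    intro f ε β u h1 h2 h3 h4
    field_simp
  exact e _ _ _ _ n4 n2 n3 n1

/-- Along the zero section `K` behaves like the power `∑ d - 2` of the pull-back of `𝒪(1)`. The
canonical frames are available only on the charts `(i, 0)`, and these are all the charts the curve
meets. -/
theorem intersectionNumber_canonical_zeroSection (hd0 : d 0 = 0) (K : LineBundle P.X)
    (hK : IsCanonicalBundle P.toSpec K) : intersectionNumber P.toSpec K (zeroSection P) =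
      (∑ l, d l - 2) * frameDegree P (baseFrame P) (zeroSection P) := by
  obtain ⟨c, hc, h⟩ := exists_canonicalFrame P hd0 K hK
  rw [intersectionNumber_eq_frameDegree P K (H := fun a ↦ c * tautFrame P a ^ (0 : ℤ) *
      baseFrame P a ^ (∑ l, d l - 2)) (fun x j a hs hj ha ↦ ?_) (isCurve_zeroSection P),
    frameDegree_mul_zpow P c hc _ _ (isCurve_zeroSection P), zero_mul, zero_add]
  rw [zpow_zero, mul_one]
  have h0 := eq_zero_of_zeroSection_mem P (hs.mem_open (chart P a.1 a.2).2 ha)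
  rw [h0] at ha
  exact h x j a.1 hj ha

end Chart

end ProjBundle

namespace ProjBundle

/-! ## Extremal rays of a cone of curves spanned by two classes -/

section Cone

variable {X : Scheme.{0}} {p : X ⟶ Spec (.of ℂ)}

theorem Curve.degree_cls (C : Curve p) (L : LineBundle X) :
    degree L C.cls = intersectionNumber p L C.1 := by
  simp [degree, Curve.cls, numericalClass]

theorem Curve.cls_mem (C : Curve p) : C.cls ∈ closedConeOfCurves p :=
  subset_closure (Submodule.subset_span ⟨C, rfl⟩)

theorem smul_mem_closedConeOfCurves (c : NNReal) {z : N1 p} (hz : z ∈ closedConeOfCurves p) :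
    c • z ∈ closedConeOfCurves p :=
  (Submodule.span NNReal (Set.range (Curve.cls (p := p)))).topologicalClosure.smul_mem c hz

theorem continuous_degree (L : LineBundle X) : Continuous fun z : N1 p ↦ degree L z :=
  (continuous_apply L).comp continuous_subtype_val

theorem closedConeOfCurves_induction {T : Set (N1 p)} (hT : IsClosed T) (h0 : (0 : N1 p) ∈ T)
    (hadd : ∀ u ∈ T, ∀ w ∈ T, u + w ∈ T) (hsmul : ∀ (c : NNReal), ∀ u ∈ T, c • u ∈ T)
    (hcls : ∀ C : Curve p, C.cls ∈ T) : closedConeOfCurves p ⊆ T := by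
  refine closure_minimal (fun z hz ↦ ?_) hT
  refine Submodule.span_induction ?_ h0 (fun u w _ _ hu hw ↦ hadd u hu w hw)
    (fun c u _ hu ↦ hsmul c u hu) hz
  rintro _ ⟨C, rfl⟩
  exact hcls C

theorem degree_nonneg_of_mem {L : LineBundle X}
    (hL : ∀ η, IsCurve p η → 0 ≤ intersectionNumber p L η) {z : N1 p}
    (hz : z ∈ closedConeOfCurves p) : 0 ≤ degree L z := by
  refine closedConeOfCurves_induction (T := {z | 0 ≤ degree L z})
    (isClosed_le continuous_const (continuous_degree L)) (le_refl (0 : ℝ))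
    (fun u hu w hw ↦ (add_nonneg hu hw : 0 ≤ degree L u + degree L w))
    (fun c u hu ↦ (mul_nonneg c.2 hu : 0 ≤ (c : ℝ) * degree L u)) (fun C ↦ ?_) hz
  rw [Set.mem_ofPred_eq, C.degree_cls]
  exact_mod_cast hL C.1 C.2

theorem degree_eq_of_mem {L L₁ L₂ : LineBundle X} {m l : ℤ}
    (h : ∀ η, IsCurve p η → intersectionNumber p L η =
      m * intersectionNumber p L₁ η + l * intersectionNumber p L₂ η) {z : N1 p}
    (hz : z ∈ closedConeOfCurves p) : degree L z = m * degree L₁ z + l * degree L₂ z := by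
  refine closedConeOfCurves_induction
    (T := {z | degree L z = m * degree L₁ z + l * degree L₂ z})
    (isClosed_eq (continuous_degree L) (((continuous_degree L₁).const_mul _).add
      ((continuous_degree L₂).const_mul _))) ?_ (fun u hu w hw ↦ ?_) (fun c u hu ↦ ?_)
    (fun C ↦ ?_) hz
  · simp [degree]
  · have e : ∀ L : LineBundle X, degree L (u + w) = degree L u + degree L w := fun _ ↦ rfl
    rw [Set.mem_ofPred_eq] at *
    rw [e, e, e, hu, hw]; ring
  · have e : ∀ L : LineBundle X, degree L (c • u) = c * degree L u := fun _ ↦ rfl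
    rw [Set.mem_ofPred_eq] at *
    rw [e, e, e, hu]; ring
  · rw [Set.mem_ofPred_eq, C.degree_cls, C.degree_cls, C.degree_cls]
    exact_mod_cast h C.1 C.2

/-- If the classes of curves are determined by their degrees on two nef line bundles `L₁` and `L₂`,
then a curve `σ` with `L₁ · σ = 0 < L₂ · σ` and a curve `ℓ` with `L₂ · ℓ = 0 < L₁ · ℓ` span the cone
of curves. If `K · σ ≥ 0`, then every `K`-negative extremal ray is spanned by `ℓ`. -/
theorem IsExtremalRay.cls_mem {L₁ L₂ : LineBundle X}
    (h₁ : ∀ η, IsCurve p η → 0 ≤ intersectionNumber p L₁ η)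
    (h₂ : ∀ η, IsCurve p η → 0 ≤ intersectionNumber p L₂ η)
    (h : ∀ L : LineBundle X, ∃ m l : ℤ, ∀ η, IsCurve p η → intersectionNumber p L η =
      m * intersectionNumber p L₁ η + l * intersectionNumber p L₂ η)
    {K : LineBundle X} {R : Set (N1 p)} (hR : IsExtremalRay (closedConeOfCurves p) R)
    (hneg : ∀ z ∈ R, z ≠ 0 → degree K z < 0) {σ ℓ : Curve p}
    (hσ₁ : intersectionNumber p L₁ σ.1 = 0) (hσ₂ : 0 < intersectionNumber p L₂ σ.1)
    (hσ : 0 ≤ intersectionNumber p K σ.1)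
    (hℓ₁ : 0 < intersectionNumber p L₁ ℓ.1) (hℓ₂ : intersectionNumber p L₂ ℓ.1 = 0) :
    ℓ.cls ∈ R := by
  obtain ⟨⟨z, hz, hz0, rfl⟩, hext⟩ := hR
  have hzR : z ∈ {u | ∃ c : ℝ, 0 ≤ c ∧ u = c • z} := ⟨1, zero_le_one, (one_smul _ _).symm⟩
  have hz₁ := degree_nonneg_of_mem h₁ hz
  have hz₂ := degree_nonneg_of_mem h₂ hz
  have hℓ₁' : (0 : ℝ) < intersectionNumber p L₁ ℓ.1 := by exact_mod_cast hℓ₁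
  have hσ₂' : (0 : ℝ) < intersectionNumber p L₂ σ.1 := by exact_mod_cast hσ₂
  -- If `L₁ · z = 0`, then `K · z` is a multiple of `L₂ · z`, with a coefficient that `K · σ ≥ 0`
  -- makes nonnegative; this contradicts negativity.
  have hpos : 0 < degree L₁ z := by
    refine hz₁.lt_of_ne fun h0 ↦ (hneg z hzR hz0).not_ge ?_
    obtain ⟨m, l, hK⟩ := h K
    rw [degree_eq_of_mem hK hz, ← h0, mul_zero, zero_add]
    rw [hK σ.1 σ.2, hσ₁, mul_zero, zero_add] at hσ
    refine mul_nonneg ?_ hz₂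
    exact_mod_cast nonneg_of_mul_nonneg_left hσ hσ₂
  -- Since `L₁ · σ = L₂ · ℓ = 0`, the coefficients of `z` in terms of `ℓ` and `σ` are these two
  -- quotients; equality holds because `L₁` and `L₂` determine all degrees.
  obtain ⟨s, hs⟩ : ∃ s : NNReal, (s : ℝ) = degree L₁ z / intersectionNumber p L₁ ℓ.1 :=
    ⟨⟨_, by positivity⟩, rfl⟩
  obtain ⟨t, ht⟩ : ∃ t : NNReal, (t : ℝ) = degree L₂ z / intersectionNumber p L₂ σ.1 :=
    ⟨⟨_, by positivity⟩, rfl⟩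
  have e : s • ℓ.cls + t • σ.cls = z := by
    refine Subtype.ext (funext fun L ↦ ?_)
    obtain ⟨m, l, hL⟩ := h L
    change (s : ℝ) * degree L ℓ.cls + (t : ℝ) * degree L σ.cls = degree L z
    rw [degree_eq_of_mem hL hz, degree_eq_of_mem hL ℓ.cls_mem, degree_eq_of_mem hL σ.cls_mem]
    simp only [Curve.degree_cls, hσ₁, hℓ₂, hs, ht, Int.cast_zero, mul_zero, add_zero, zero_add]
    field_simp
  obtain ⟨⟨c, hc, hcz⟩, -⟩ := hext _ (smul_mem_closedConeOfCurves s ℓ.cls_mem) _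
    (smul_mem_closedConeOfCurves t σ.cls_mem) (e ▸ hzR)
  have hs : (0 : ℝ) < s := hs ▸ div_pos hpos hℓ₁'
  refine ⟨(s : ℝ)⁻¹ * c, by positivity, ?_⟩
  rw [mul_smul, ← hcz]
  change _ = (s : ℝ)⁻¹ • ((s : ℝ) • ℓ.cls)
  rw [inv_smul_smul₀ hs.ne']

end Cone

section Bundle

variable {n : ℕ} [NeZero n] {d : Fin n → ℤ} (P : ProjectiveBundle (splitBundle d))

/-- Here `K · σ ≥ 0`, while nonzero classes in `R` are negative on `K`. The class of `σ` is nonzero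
because the pull-back of `𝒪(1)` has positive degree on it. -/
theorem cls_zeroSection_notMem (hd0 : d 0 = 0) (hd : 2 ≤ ∑ k, d k) {K : LineBundle P.X}
    (hK : IsCanonicalBundle P.toSpec K) {R : Set (N1 P.toSpec)}
    (hneg : ∀ z ∈ R, z ≠ 0 → degree K z < 0) :
    Curve.cls (⟨zeroSection P, isCurve_zeroSection P⟩ : Curve P.toSpec) ∉ R := by
  intro h
  have hpos := frameDegree_baseFrame_zeroSection_pos P
  refine (hneg _ h fun h0 ↦ ?_).not_ge ?_
  · have := Curve.degree_cls ⟨zeroSection P, isCurve_zeroSection P⟩ (baseBundle P)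
    rw [h0, intersectionNumber_baseBundle P (isCurve_zeroSection P)] at this
    have h1 : (0 : ℝ) = frameDegree P (baseFrame P) (zeroSection P) := this
    norm_cast at h1
    omega
  · rw [Curve.degree_cls, intersectionNumber_canonical_zeroSection P hd0 K hK]
    exact_mod_cast mul_nonneg (sub_nonneg.mpr hd) hpos.le

/-- Any line in any fibre can serve as `ℓ` in `IsExtremalRay.cls_mem`, with the two standard nef
bundles as `L₁` and `L₂`; so all of them are contracted. -/
theorem cls_chartLine_mem (hd : ∀ k, 0 ≤ d k) (hd0 : d 0 = 0) (hd2 : 2 ≤ ∑ k, d k)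
    {K : LineBundle P.X} (hK : IsCanonicalBundle P.toSpec K) {R : Set (N1 P.toSpec)}
    (hR : IsExtremalRay (closedConeOfCurves P.toSpec) R)
    (hneg : ∀ z ∈ R, z ≠ 0 → degree K z < 0) (i : Fin 2) (b : Fin n → ℂ) {c : Fin n → ℂ}
    (hc : c ≠ 0) (hc0 : c 0 = 0) :
    Curve.cls (⟨chartLine P i 0 b c, isCurve_chartLine P i 0 b hc⟩ : Curve P.toSpec) ∈ R := by
  have hσ := isCurve_zeroSection P
  have hℓ := isCurve_chartLine P i 0 b hc
  obtain ⟨l, hl⟩ := Function.ne_iff.mp hc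
  refine IsExtremalRay.cls_mem (L₁ := tautBundle P) (L₂ := baseBundle P) (K := K)
    (σ := ⟨zeroSection P, hσ⟩) (fun η hη ↦ ?_) (fun η hη ↦ ?_) (fun L ↦ ?_) hR hneg ?_ ?_ ?_ ?_ ?_
  · rw [intersectionNumber_tautBundle P hη]
    exact frameDegree_nonneg P (isRegAt_tautFrame_div P hd) η
  · rw [intersectionNumber_baseBundle P hη]
    exact frameDegree_nonneg P (isRegAt_baseFrame_div P) η
  · obtain ⟨m, l, h⟩ := exists_intersectionNumber_eq P L
    refine ⟨m, l, fun η hη ↦ ?_⟩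
    rw [intersectionNumber_tautBundle P hη, intersectionNumber_baseBundle P hη, h η hη]
  · rw [intersectionNumber_tautBundle P hσ, frameDegree_tautFrame_zeroSection P hd0]
  · rw [intersectionNumber_baseBundle P hσ]
    exact frameDegree_baseFrame_zeroSection_pos P
  · rw [intersectionNumber_canonical_zeroSection P hd0 K hK]
    exact mul_nonneg (sub_nonneg.mpr hd2) (frameDegree_baseFrame_zeroSection_pos P).le
  · rw [intersectionNumber_tautBundle P hℓ]
    exact frameDegree_tautFrame_chartLine_pos P hd i b c (by rintro rfl; exact hl hc0) hl
  · rw [intersectionNumber_baseBundle P hℓ]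
    exact frameDegree_baseFrame_chartLine P i b hc hc0

end Bundle

end ProjBundle

namespace ProjBundle

/-! ## Finite birational morphisms and the geometry of the projective line -/

theorem isIso_of_isAffineHom_of_bijective_app {X Y : Scheme.{0}} (f : X ⟶ Y) [IsAffineHom f]
    (h : ∀ V : Y.Opens, Function.Bijective (f.app V).hom) : IsIso f := by
  have := instHasAffinePropertyIsomorphismsSchemeAndIsAffineIsIsoCommRingCatAppTop.{0}
  refine (this.iff_of_iSup_eq_top (fun V : Y.affineOpens ↦ V) (iSup_affineOpens_eq_top Y)).mpr
    fun V ↦ ⟨V.2.preimage f, ?_⟩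
  have h1 : IsIso (f.app ((V : Y.Opens).ι ''ᵁ ⊤)) :=
    (ConcreteCategory.isIso_iff_bijective _).mpr (h _)
  rw [Scheme.Hom.appTop, morphismRestrict_app]
  refine @IsIso.comp_isIso _ _ _ _ _ _ _ h1 ?_
  exact @Functor.map_isIso _ _ _ _ _ _ X.presheaf _ (isIso_op _)

/-- A proper quasi-finite morphism is finite, hence affine, and an affine morphism that is bijective
on functions is an isomorphism. -/
theorem isIso_of_isProper_of_finite_preimage {X Y : Scheme.{0}} (f : X ⟶ Y) [IsProper f]
    (hf : ∀ y : Y, (f ⁻¹' {y}).Finite)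
    (h : ∀ V : Y.Opens, Function.Bijective (f.app V).hom) : IsIso f := by
  have := LocallyQuasiFinite.of_finite_preimage_singleton f hf
  have := IsFinite.of_isProper_of_locallyQuasiFinite f
  exact isIso_of_isAffineHom_of_bijective_app f h

section P1

theorem bijective_algebraMap_grading_zero : Function.Bijective (algebraMap ℂ (grading 0)) := by
  constructor
  · intro a b h
    exact MvPolynomial.C_injective (Fin 2) ℂ (congrArg Subtype.val h)
  · rintro ⟨p, hp⟩
    refine ⟨p.coeff 0, Subtype.ext ?_⟩
    exact (MvPolynomial.totalDegree_eq_zero_iff_eq_C.mp (Nat.le_zero.mp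
      (MvPolynomial.IsHomogeneous.totalDegree_le hp))).symm

instance : IsProper P1.toSpec := by
  have h1 : Algebra.FiniteType (grading 0) (MvPolynomial (Fin 2) ℂ) :=
    by
    have : IsScalarTower ℂ (grading 0) (MvPolynomial (Fin 2) ℂ) :=
      ⟨fun a b c ↦ smul_assoc a (b : MvPolynomial (Fin 2) ℂ) c⟩
    exact Algebra.FiniteType.of_restrictScalars_finiteType ℂ _ _
  have h2 : IsIso (CommRingCat.ofHom (algebraMap ℂ (grading 0))) :=
    (ConcreteCategory.isIso_iff_bijective _).mpr bijective_algebraMap_grading_zero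
  have h3 : IsProper (Proj.toSpecZero grading) := inferInstance
  have h4 : IsProper (Spec.map (CommRingCat.ofHom (algebraMap ℂ (grading 0)))) := inferInstance
  exact MorphismProperty.comp_mem @IsProper _ _ h3 h4

instance (i : Fin 2) : IsDomain Γ(P1, P1.D i) :=
  (RingEquiv.ofBijective _ (P1.chartHom_bijective i)).symm.injective.isDomain
    (RingEquiv.ofBijective _ (P1.chartHom_bijective i)).symm.toRingHom

instance (i : Fin 2) : IsPrincipalIdealRing Γ(P1, P1.D i) :=
  IsPrincipalIdealRing.of_surjective _ (P1.chartHom_bijective i).surjective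

theorem P1.exists_mem_D (x : P1) : ∃ i, x ∈ P1.D i := by
  have h : x ∈ (⨆ i, P1.D i) := by rw [P1.iSup_D]; trivial
  simpa using h

theorem P1.ratio_ne_zero (i j : Fin 2) : P1.ratio i j (P1.D j) le_rfl ≠ 0 := by
  obtain rfl | rfl := Fin.eq_or_eq_add_one j i
  · rw [P1.ratio_self]; exact one_ne_zero
  · have h : P1.chartHom j Polynomial.X = P1.ratio (j + 1) j (P1.D j) le_rfl := by
      simp [P1.chartHom]
    rw [← h, Ne, map_eq_zero_iff _ (P1.chartHom_bijective j).injective]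
    exact Polynomial.X_ne_zero

instance : IsIntegral P1 := by
  refine isIntegral_of_affine_cover P1.D P1.exists_mem_D P1.isAffineOpen_D fun i j ↦ ?_
  obtain ⟨x, hx⟩ := (P1.isAffineOpen_D i).exists_mem_basicOpen (P1.ratio_ne_zero j i)
  have hx' := P1.basicOpen_le _ hx
  exact ⟨x, hx', (P1.mem_D_iff i j hx').mpr hx⟩

/-- The points outside are prime ideals containing `f`, which correspond to the finitely many prime
factors of `(f)`. -/
theorem _root_.AlgebraicGeometry.IsAffineOpen.finite_sdiff_basicOpen {X : Scheme.{0}}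
    {U : X.Opens} (hU : IsAffineOpen U) [IsDomain Γ(X, U)] [IsPrincipalIdealRing Γ(X, U)]
    {f : Γ(X, U)} (hf : f ≠ 0) : {x | x ∈ U ∧ x ∉ X.basicOpen f}.Finite := by
  have h := Ideal.finite_factors (R := Γ(X, U)) (I := Ideal.span {f}) (by simpa using hf)
  refine (h.image fun v ↦ hU.fromSpec (⟨v.asIdeal, v.isPrime⟩ : PrimeSpectrum _)).subset ?_
  rintro x ⟨hxU, hx⟩
  rw [← SetLike.mem_coe, ← hU.range_fromSpec] at hxU
  obtain ⟨q, rfl⟩ := hxU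
  have hfq : f ∈ (q : PrimeSpectrum Γ(X, U)).asIdeal := by
    by_contra hfq
    exact hx ((hU.mem_basicOpen_fromSpec_iff q f).mpr hfq)
  refine ⟨⟨(q : PrimeSpectrum Γ(X, U)).asIdeal, (q : PrimeSpectrum Γ(X, U)).isPrime, fun h0 ↦ hf ?_⟩, ?_, rfl⟩
  · rwa [h0] at hfq
  · exact Ideal.dvd_span_singleton.mpr hfq

theorem P1.finite_of_isClosed {Z : Set P1} (hZ : IsClosed Z) (hη : genericPoint P1 ∉ Z) :
    Z.Finite := by
  have h : ∀ i, {x | x ∈ P1.D i ∧ x ∈ Z}.Finite := fun i ↦ by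
    have hηD : genericPoint P1 ∈ P1.D i :=
      ((genericPoint_spec P1).mem_open_set_iff (P1.D i).2).mpr (by
        obtain ⟨x, hx⟩ := (P1.isAffineOpen_D i).exists_mem_basicOpen (one_ne_zero)
        exact ⟨x, trivial, P1.basicOpen_le _ hx⟩)
    obtain ⟨f, hf, hηf⟩ := (P1.isAffineOpen_D i).exists_basicOpen_le
      (V := ⟨Zᶜ, hZ.isOpen_compl⟩) ⟨genericPoint P1, hη⟩ hηD
    have hf0 : f ≠ 0 := by
      rintro rfl
      simp at hηf
    exact ((P1.isAffineOpen_D i).finite_sdiff_basicOpen hf0).subset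
      fun x hx ↦ ⟨hx.1, fun hxf ↦ hf hxf hx.2⟩
  refine (Set.finite_iUnion h).subset fun x hx ↦ ?_
  obtain ⟨i, hi⟩ := P1.exists_mem_D x
  exact Set.mem_iUnion.mpr ⟨i, hi, hx⟩

theorem P1.jacobsonSpace : JacobsonSpace P1 := LocallyOfFiniteType.jacobsonSpace P1.toSpec

/-- The closure of a nongeneric point is finite, and by the Jacobson property its closed points are
dense in it. A finite set of closed points is closed, so it is the whole closure. -/
theorem P1.isClosed_singleton {x : P1} (hx : x ≠ genericPoint P1) : IsClosed {x} := by
  have hfin : (closure {x}).Finite := P1.finite_of_isClosed isClosed_closure fun h ↦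
    hx ((genericPoint_specializes x).antisymm (specializes_iff_mem_closure.mpr h)).eq.symm
  have := P1.jacobsonSpace
  have h1 : closure (closure {x} ∩ closedPoints P1) = closure {x} :=
    JacobsonSpace.closure_inter_closedPoints_eq_closure isClosed_closure.isLocallyClosed |>.trans
      closure_closure
  have h2 : IsClosed (closure {x} ∩ closedPoints P1) := by
    rw [← Set.biUnion_of_singleton (closure {x} ∩ closedPoints P1)]
    exact (hfin.subset Set.inter_subset_left).isClosed_biUnion fun y hy ↦ hy.2
  have h3 : x ∈ closure {x} ∩ closedPoints P1 := by
    rw [← h2.closure_eq, h1]; exact subset_closure rfl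
  exact h3.2

/-- A closed preimage without the generic point is finite. If the generic point lies over `closure
{y}` and the fibre has a nongeneric point, then the generic point maps to `y` as well; but `y` is
the image of a closed point under a closed map, hence closed, which is excluded. -/
theorem P1.finite_preimage {Y : Scheme.{0}} (f : P1 ⟶ Y) (hf : IsClosedMap f)
    (h : ¬ IsClosed {f (genericPoint P1)}) (y : Y) : (f ⁻¹' {y}).Finite := by
  by_cases hy : genericPoint P1 ∈ f ⁻¹' closure {y}
  · refine (Set.finite_singleton (genericPoint P1)).subset fun x hx ↦ ?_
    by_contra hxη
    have h1 : f x = y := hx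
    have h2 : f (genericPoint P1) = y := ((genericPoint_specializes x).map f.continuous).antisymm
      (specializes_iff_mem_closure.mpr (h1.symm ▸ hy)) |>.eq.trans h1
    apply h
    rw [h2, ← h1, ← Set.image_singleton]
    exact hf _ (P1.isClosed_singleton hxη)
  · exact (P1.finite_of_isClosed (isClosed_closure.preimage f.continuous) hy).subset
      (Set.preimage_mono subset_closure)

end P1

end ProjBundle

namespace ProjBundle

/-! ## Morphisms that contract the lines in the fibres -/

/-- The Nullstellensatz: closed points have residue field `ℂ`, and so are given by complex
coordinates. -/
theorem bijective_residueHom {X : Scheme.{0}} (p : X ⟶ Spec (.of ℂ)) [LocallyOfFiniteType p] {x : X}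
    (hx : IsClosed {x}) : Function.Bijective (residueHom p x) := by
  have h : CommRingCat.ofHom (residueHom p x) = (residueFieldIsoBase p x hx).inv := by
    apply Spec.map_injective
    rw [SpecMap_residueFieldIsoBase_inv]
    have : CommRingCat.ofHom (residueHom p x) = Spec.preimage (X.fromSpecStalk x ≫ p) ≫ X.residue x :=
      rfl
    rw [this, Spec.map_comp, Spec.map_preimage, Scheme.fromSpecResidueField, Category.assoc]
  have h2 := ConcreteCategory.bijective_of_isIso (residueFieldIsoBase p x hx).inv
  rw [← h] at h2
  exact h2

section Chart

variable {n : ℕ} {d : Fin n → ℤ} (P : ProjectiveBundle (splitBundle d))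

instance : LocallyOfFiniteType P.π := by
  have h : ⨆ a : Fin 2 × Fin n, chart P a.1 a.2 = ⊤ := by
    rw [eq_top_iff]
    intro x _
    obtain ⟨i, k, hx⟩ := exists_mem_chart P x
    exact TopologicalSpace.Opens.mem_iSup.mpr ⟨(i, k), hx⟩
  have : IsZariskiLocalAtSource @LocallyOfFiniteType :=
    HasRingHomProperty.instIsZariskiLocalAtSource (Q := RingHom.FiniteType)
  refine (IsZariskiLocalAtSource.iff_of_iSup_eq_top (P := @LocallyOfFiniteType)
    (fun a : Fin 2 × Fin n ↦ chart P a.1 a.2) h).mpr fun a ↦ ?_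
  have := isIso_chart P a.1 a.2
  rw [← Scheme.Hom.resLE_comp_ι P.π (chart_le P a.1 a.2), ← AffineSpace.homOfVector_over
    (P.π.resLE (P1.D a.1) (chart P a.1 a.2) (chart_le P a.1 a.2))
    (fun l : {l // l ≠ a.2} ↦ (chart P a.1 a.2).topIso.inv (fiberRatio P a.1 a.2 l.1))]
  infer_instance

instance : LocallyOfFiniteType P.toSpec :=
  MorphismProperty.comp_mem @LocallyOfFiniteType P.π P1.toSpec inferInstance inferInstance

theorem eq_closedPoint {i : Fin 2} {k : Fin n} {x : P.X} (hx : x ∈ chart P i k) {b : Fin n → ℂ}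
    (h : ∀ f, x ∈ P.X.basicOpen (chartHom P i k f) ↔ MvPolynomial.eval b f ≠ 0) :
    x = closedPoint P i k b := by
  have h' : ∀ f, closedPoint P i k b ∈ P.X.basicOpen (chartHom P i k f) ↔
    MvPolynomial.eval b f ≠ 0 := chartPoint_mem_basicOpen_iff P i k _
  refine (Specializes.antisymm ?_ ?_ : Inseparable (closedPoint P i k b) x).eq.symm
  · refine (isAffineOpen_chart P i k).specializes hx fun f hf ↦ ?_
    obtain ⟨f, rfl⟩ := (chartHom_bijective P i k).surjective f
    exact (h' f).mpr ((h f).mp hf)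
  · refine (isAffineOpen_chart P i k).specializes (closedPoint_mem P i k b) fun f hf ↦ ?_
    obtain ⟨f, rfl⟩ := (chartHom_bijective P i k).surjective f
    exact (h f).mpr ((h' f).mp hf)

theorem mem_basicOpen_iff_of_isClosed {i : Fin 2} {k : Fin n} {x : P.X} (hx : x ∈ chart P i k)
    (hc : IsClosed {x}) : ∃ b, ∀ f, x ∈ P.X.basicOpen (chartHom P i k f) ↔
      MvPolynomial.eval b f ≠ 0 := by
  have hbij := bijective_residueHom P.toSpec hc
  choose b hb using fun l ↦ hbij.surjective (chartEval P hx (MvPolynomial.X l))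
  refine ⟨b, fun f ↦ ?_⟩
  have h1 : chartEval P hx = (residueHom P.toSpec x).comp (MvPolynomial.eval b) := by
    apply MvPolynomial.ringHom_ext
    · intro c; rw [chartEval_C]; simp
    · intro l; rw [← hb]; simp
  rw [← not_iff_not, not_not, ← chartEval_eq_zero_iff P hx, h1, RingHom.comp_apply,
    map_eq_zero_iff _ hbij.injective]

variable [NeZero n]

/-- The section of `π` over `D₊(xᵢ)` given by the coordinate `e₀`. -/
def localSection (i : Fin 2) : (P1.D i : Scheme) ⟶ P.X :=
  have := isIso_chart P i 0
  AffineSpace.homOfVector (𝟙 (P1.D i : Scheme)) 0 ≫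
    inv (AffineSpace.homOfVector (P.π.resLE (P1.D i) (chart P i 0) (chart_le P i 0))
      fun l : {l : Fin n // l ≠ 0} ↦ (chart P i 0).topIso.inv (fiberRatio P i 0 l.1)) ≫
    (chart P i 0).ι

theorem exists_localSection_eq (i : Fin 2) : ∃ τ : (P1.D i : Scheme) ⟶ chart P i 0,
    localSection P i = τ ≫ (chart P i 0).ι ∧
    τ ≫ P.π.resLE (P1.D i) (chart P i 0) (chart_le P i 0) = 𝟙 _ ∧
    ∀ l ≠ 0, τ.appTop.hom ((chart P i 0).topIso.inv (fiberRatio P i 0 l)) = 0 := by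
  have := isIso_chart P i 0
  set c := AffineSpace.homOfVector (P.π.resLE (P1.D i) (chart P i 0) (chart_le P i 0))
      fun l : {l : Fin n // l ≠ 0} ↦ (chart P i 0).topIso.inv (fiberRatio P i 0 l.1) with hc
  have hτ : (AffineSpace.homOfVector (𝟙 (P1.D i : Scheme)) 0 ≫ inv c) ≫ c =
      AffineSpace.homOfVector (𝟙 (P1.D i : Scheme)) 0 := by simp
  refine ⟨AffineSpace.homOfVector (𝟙 (P1.D i : Scheme)) 0 ≫ inv c, by
    simp only [localSection, Category.assoc, hc], ?_, fun l hl ↦ ?_⟩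
  · rw [← AffineSpace.homOfVector_over (P.π.resLE (P1.D i) (chart P i 0) (chart_le P i 0))
      fun l : {l : Fin n // l ≠ 0} ↦ (chart P i 0).topIso.inv (fiberRatio P i 0 l.1), ← hc,
      ← Category.assoc, hτ, AffineSpace.homOfVector_over]
  · have h1 : (chart P i 0).topIso.inv (fiberRatio P i 0 l) =
        c.appTop (AffineSpace.coord _ (⟨l, hl⟩ : {l : Fin n // l ≠ 0})) := by
      rw [hc, AffineSpace.homOfVector_appTop_coord]
    rw [h1]
    have h2 := congrArg (fun g ↦ g (AffineSpace.coord _ (⟨l, hl⟩ : {l : Fin n // l ≠ 0})))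
      (congrArg (fun g ↦ (Scheme.Hom.appTop g).hom) hτ)
    rw [Scheme.Hom.comp_appTop] at h2
    refine h2.trans ?_
    exact (AffineSpace.homOfVector_appTop_coord _ _ _)

theorem localSection_comp (i : Fin 2) : localSection P i ≫ P.π = (P1.D i).ι := by
  obtain ⟨τ, h1, h2, -⟩ := exists_localSection_eq P i
  rw [h1, Category.assoc, ← Scheme.Hom.resLE_comp_ι P.π (chart_le P i 0), reassoc_of% h2]

theorem localSection_mem (i : Fin 2) (y : (P1.D i : Scheme)) :
    localSection P i y ∈ chart P i 0 := by
  obtain ⟨τ, h1, -, -⟩ := exists_localSection_eq P i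
  rw [h1, Scheme.Hom.comp_apply]
  exact (τ y).2

end Chart

end ProjBundle

namespace ProjBundle

/-! ## Factorization through the projection to the base -/

theorem top_le_ι_preimage {X : Scheme.{0}} (U : X.Opens) : ⊤ ≤ U.ι ⁻¹ᵁ U :=
  U.ι_preimage_self.ge

theorem appLE_eq_topIso_inv {X : Scheme.{0}} {U : X.Opens} {g : (U : Scheme) ⟶ X} (hg : g = U.ι)
    (e : ⊤ ≤ g ⁻¹ᵁ U) : g.appLE U ⊤ e = U.topIso.inv := by
  subst hg
  rw [Scheme.Opens.ι_appLE, Scheme.Opens.topIso_inv]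
  rfl

section Chart

variable {n : ℕ} {d : Fin n → ℤ} (P : ProjectiveBundle (splitBundle d)) [NeZero n]

theorem le_localSection_preimage (i : Fin 2) : ⊤ ≤ localSection P i ⁻¹ᵁ chart P i 0 :=
  fun y _ ↦ localSection_mem P i y

/-- The restriction of functions on a chart to the zero section, as functions on `D₊(xᵢ)`. -/
def restrictSection (i : Fin 2) : Γ(P.X, chart P i 0) ⟶ Γ(P1, P1.D i) :=
  (localSection P i).appLE (chart P i 0) ⊤ (le_localSection_preimage P i) ≫ (P1.D i).topIso.hom

theorem appLE_restrictSection (i : Fin 2) :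
    P.π.appLE (P1.D i) (chart P i 0) (chart_le P i 0) ≫ restrictSection P i = 𝟙 _ := by
  rw [restrictSection, ← Category.assoc, Scheme.Hom.appLE_comp_appLE,
    appLE_eq_topIso_inv (localSection_comp P i), Iso.inv_hom_id]

theorem restrictSection_fiberRatio (i : Fin 2) {l : Fin n} (hl : l ≠ 0) :
    (restrictSection P i).hom (fiberRatio P i 0 l) = 0 := by
  obtain ⟨τ, h1, -, h3⟩ := exists_localSection_eq P i
  have h : ∀ (g : (P1.D i : Scheme) ⟶ P.X) (hg : g = τ ≫ (chart P i 0).ι)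
      (e : ⊤ ≤ g ⁻¹ᵁ chart P i 0),
      g.appLE (chart P i 0) ⊤ e = (chart P i 0).topIso.inv ≫ τ.appTop := by
    rintro _ rfl e
    have h5 : τ.appLE ⊤ ⊤ (le_preimage_top τ ⊤) = τ.appTop := by
      rw [Scheme.Hom.appTop, Scheme.Hom.app_eq_appLE]; rfl
    rw [← appLE_eq_topIso_inv rfl (top_le_ι_preimage _), ← h5, Scheme.Hom.appLE_comp_appLE]
  rw [restrictSection, h _ h1, CommRingCat.comp_apply, CommRingCat.comp_apply]
  exact (congrArg _ (h3 l hl)).trans (map_zero _)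

theorem localSection_mem_basicOpen_iff (i : Fin 2) (y : (P1.D i : Scheme)) (f : Γ(P.X, chart P i 0)) :
    localSection P i y ∈ P.X.basicOpen f ↔
      (P1.D i).ι y ∈ P1.basicOpen ((restrictSection P i).hom f) := by
  have h1 := basicOpen_appLE (localSection P i) (le_localSection_preimage P i) f
  have h2 := basicOpen_appLE (P1.D i).ι (U := P1.D i) (V := ⊤) (top_le_ι_preimage _)
    ((restrictSection P i).hom f)
  have h4 : ((P1.D i).ι.appLE (P1.D i) ⊤ (top_le_ι_preimage _)).hom ((restrictSection P i).hom f) =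
      ((localSection P i).appLE (chart P i 0) ⊤ (le_localSection_preimage P i)).hom f := by
    rw [appLE_eq_topIso_inv rfl, ← CommRingCat.comp_apply, restrictSection, Category.assoc, Iso.hom_inv_id,
      Category.comp_id]
  rw [h4, h1, top_inf_eq, top_inf_eq] at h2
  exact iff_of_eq (congrArg (fun U ↦ y ∈ U) h2)

/-- On functions, `π` followed by the section over `D₊(xᵢ)` sets all fibre coordinates to zero and
keeps the base coordinate. -/
theorem appLE_restrictSection_chartHom (i : Fin 2) (f : MvPolynomial (Fin n) ℂ) :
    (P.π.appLE (P1.D i) (chart P i 0) (chart_le P i 0)).hom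
      ((restrictSection P i).hom (chartHom P i 0 f)) =
    chartHom P i 0 (MvPolynomial.aeval (Pi.single 0 (MvPolynomial.X 0)) f) := by
  have h : ∀ a, (restrictSection P i).hom
      ((P.π.appLE (P1.D i) (chart P i 0) (chart_le P i 0)).hom a) = a := fun a ↦ by
    rw [← CommRingCat.comp_apply, appLE_restrictSection]; rfl
  have key : ((P.π.appLE (P1.D i) (chart P i 0) (chart_le P i 0)).hom.comp
      (restrictSection P i).hom).comp (chartHom P i 0) =
      (chartHom P i 0).comp (MvPolynomial.aeval (Pi.single 0 (MvPolynomial.X 0)) :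
        MvPolynomial (Fin n) ℂ →ₐ[ℂ] MvPolynomial (Fin n) ℂ).toRingHom := by
    apply MvPolynomial.ringHom_ext
    · intro c
      simp only [AlgHom.toRingHom_eq_coe, RingHom.comp_apply, chartHom_C, RingHom.coe_coe,
        MvPolynomial.aeval_C, MvPolynomial.algebraMap_eq]
      rw [← constHom_comp_appLE, RingHom.comp_apply, h]
    · intro l
      simp only [AlgHom.toRingHom_eq_coe, RingHom.comp_apply, chartHom_X, RingHom.coe_coe,
        MvPolynomial.aeval_X]
      by_cases hl : l = 0
      · subst hl
        rw [Pi.single_eq_same, chartHom_X, coord_self, baseRatio, h]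
      · rw [Pi.single_eq_of_ne hl, map_zero, coord_of_ne P i hl, restrictSection_fiberRatio P i hl,
          map_zero]
  exact congrArg (fun g ↦ g f) key

/-- If the generic point of a line maps to a closed point, then so do all its specializations, to
the same point. -/
theorem apply_closedPoint_eq {Y : Scheme.{0}} (φ : P.X ⟶ Y) {i : Fin 2} {b c : Fin n → ℂ}
    (hφ : IsClosed {φ (chartLine P i 0 b c)}) {b' : Fin n → ℂ} (s : ℂ) (hs : b + s • c = b') :
    φ (closedPoint P i 0 b') = φ (chartLine P i 0 b c) := by
  subst hs
  have h := (chartLine_specializes P i 0 b c s).map φ.continuous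
  exact Set.mem_singleton_iff.mp (h.mem_closed hφ (Set.mem_singleton _))

/-- A morphism that contracts the lines in the fibres of `π` maps a closed point of a chart to the
same point as the zero section. -/
theorem apply_eq_apply_localSection {Y : Scheme.{0}} (φ : P.X ⟶ Y)
    (hφ : ∀ (i : Fin 2) (b c : Fin n → ℂ), c ≠ 0 → c 0 = 0 → IsClosed {φ (chartLine P i 0 b c)})
    {i : Fin 2} {x : P.X} (hx : x ∈ chart P i 0) (hc : IsClosed {x}) (y : (P1.D i : Scheme))
    (hy : (P1.D i).ι y = P.π x) : φ x = φ (localSection P i y) := by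
  obtain ⟨b, hb⟩ := mem_basicOpen_iff_of_isClosed P hx hc
  have h1 : ∀ f, localSection P i y ∈ P.X.basicOpen (chartHom P i 0 f) ↔
      MvPolynomial.eval (Pi.single 0 (b 0)) f ≠ 0 := fun f ↦ by
    have e : MvPolynomial.eval b (MvPolynomial.aeval (Pi.single 0 (MvPolynomial.X 0)) f) =
        MvPolynomial.eval (Pi.single 0 (b 0)) f := by
      induction f using MvPolynomial.induction_on with
      | C a => simp
      | add p q hp hq => rw [map_add, map_add, map_add, hp, hq]
      | mul_X p l hp =>
        rw [map_mul, map_mul, map_mul, hp, MvPolynomial.aeval_X, MvPolynomial.eval_X]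
        obtain rfl | hl := eq_or_ne l 0
        · simp
        · rw [Pi.single_eq_of_ne hl, Pi.single_eq_of_ne hl, map_zero]
    rw [localSection_mem_basicOpen_iff, hy, ← e, ← hb, ← appLE_restrictSection_chartHom,
      basicOpen_appLE]
    exact ⟨fun h ↦ ⟨hx, h⟩, fun h ↦ h.2⟩
  rw [eq_closedPoint P hx hb, eq_closedPoint P (localSection_mem P i y) h1]
  by_cases h0 : b - Pi.single 0 (b 0) = 0
  · rw [sub_eq_zero] at h0
    rw [← h0]
  -- The line from `b` to the point of the zero section in the same fibre: its direction has no base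
  -- component, it passes through `b` at parameter `0` and meets the section at parameter `-1`.
  have hcl := hφ i b (b - Pi.single 0 (b 0)) h0 (by simp)
  rw [apply_closedPoint_eq P φ hcl 0 (by simp), apply_closedPoint_eq P φ hcl (-1) (by simp)]

end Chart

end ProjBundle

/-! ### Descent of the morphism to the projective line -/

namespace ProjBundle

section Chart

variable {n : ℕ} {d : Fin n → ℤ} (P : ProjectiveBundle (splitBundle d)) [NeZero n]

variable {Y : Scheme.{0}} {q : Y ⟶ Spec (.of ℂ)} [IsProper q] {φ : P.X ⟶ Y}

/-- The source is reduced and locally of finite type over `ℂ` and the target is separated, so it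
suffices to compare closed points of a dense open subset. The chart with fibre index zero is dense,
and there `apply_eq_apply_localSection` applies. -/
theorem ι_comp_eq_morphismRestrict_comp
    (hq : φ ≫ q = P.toSpec)
    (hφ : ∀ (i : Fin 2) (b c : Fin n → ℂ), c ≠ 0 → c 0 = 0 → IsClosed {φ (chartLine P i 0 b c)})
    (i : Fin 2) :
    (P.π ⁻¹ᵁ P1.D i).ι ≫ φ = (P.π ∣_ P1.D i) ≫ localSection P i ≫ φ := by
  set U := P.π ⁻¹ᵁ P1.D i with hU
  have hj : JacobsonSpace P.X := LocallyOfFiniteType.jacobsonSpace P.toSpec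
  have hne : Nonempty U := ⟨⟨genericPoint P.X, chart_le P i 0 (genericPoint_mem_chart P i 0)⟩⟩
  have hft : LocallyOfFiniteType ((U.ι ≫ φ) ≫ q) := by
    rw [Category.assoc, hq]
    infer_instance
  have hgen : ((U.ι ⁻¹ᵁ chart P i 0 : U.toScheme.Opens) : Set U).Nonempty :=
    ⟨⟨genericPoint P.X, chart_le P i 0 (genericPoint_mem_chart P i 0)⟩,
      genericPoint_mem_chart P i 0⟩
  refine ext_of_apply_eq q (U.ι ⁻¹ᵁ chart P i 0 : U.toScheme.Opens)
    (U.ι ⁻¹ᵁ chart P i 0).2.isLocallyClosed ?_ (fun x hx hc ↦ ?_) ?_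
  · exact (U.ι ⁻¹ᵁ chart P i 0).2.dense hgen
  · have hc' : IsClosed {U.ι x} := by
      refine isClosed_singleton_of_isLocallyClosed_singleton ?_
      rw [← Set.image_singleton]
      refine hc.isLocallyClosed.image U.ι.isOpenEmbedding.isInducing ?_
      exact U.ι.isOpenEmbedding.isOpen_range.isLocallyClosed
    rw [Scheme.Hom.comp_apply, Scheme.Hom.comp_apply, Scheme.Hom.comp_apply]
    refine apply_eq_apply_localSection P φ hφ hx hc' _ ?_
    rw [← Scheme.Hom.comp_apply, morphismRestrict_ι, Scheme.Hom.comp_apply]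
  · simp only [Category.assoc, hq]
    rw [ProjectiveBundle.toSpec, reassoc_of% (localSection_comp P i), morphismRestrict_ι_assoc]

/-- A morphism to `X` over `D₊(xᵢ)` lands in the preimage of `D₊(xᵢ)`, where `φ` factors through
`π`. It makes the local factorizations agree on overlaps. -/
theorem comp_eq_comp_of_comp_eq
    (hq : φ ≫ q = P.toSpec)
    (hφ : ∀ (i : Fin 2) (b c : Fin n → ℂ), c ≠ 0 → c 0 = 0 → IsClosed {φ (chartLine P i 0 b c)})
    {i : Fin 2} {Z : Scheme.{0}} (t : Z ⟶ P.X)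
    (v : Z ⟶ (P1.D i : Scheme)) (h : t ≫ P.π = v ≫ (P1.D i).ι) :
    t ≫ φ = v ≫ localSection P i ≫ φ := by
  have hp := isPullback_morphismRestrict P.π (P1.D i)
  rw [← hp.lift_snd v t h.symm, Category.assoc, ι_comp_eq_morphismRestrict_comp P hq hφ,
    ← Category.assoc, hp.lift_fst]

/-- A morphism that contracts the lines in the fibres of `π` factors through `π`. -/
theorem exists_comp_eq
    (hq : φ ≫ q = P.toSpec)
    (hφ : ∀ (i : Fin 2) (b c : Fin n → ℂ), c ≠ 0 → c 0 = 0 → IsClosed {φ (chartLine P i 0 b c)})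
    : ∃ ψ : P1 ⟶ Y, P.π ≫ ψ = φ := by
  let 𝒰 := P1.openCoverOfIsOpenCover P1.D P1.iSup_D
  refine ⟨𝒰.glueMorphisms (fun i ↦ localSection P i ≫ φ) fun i j ↦ ?_, ?_⟩
  · have h1 : ∀ i j : Fin 2, (Limits.pullback.fst (P1.D i).ι (P1.D j).ι ≫ localSection P i) ≫ φ =
        Limits.pullback.snd (P1.D i).ι (P1.D j).ι ≫ localSection P j ≫ φ := fun i j ↦ by
      refine comp_eq_comp_of_comp_eq P hq hφ _ _ ?_
      rw [Category.assoc, localSection_comp]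
      exact Limits.pullback.condition
    exact (Category.assoc _ _ _).symm.trans (h1 i j)
  · refine Scheme.Cover.hom_ext (P.X.openCoverOfIsOpenCover (fun i ↦ P.π ⁻¹ᵁ P1.D i) ?_) _ _
      fun i ↦ ?_
    · rw [TopologicalSpace.IsOpenCover, ← Scheme.Hom.preimage_iSup, P1.iSup_D]
      rfl
    · have h1 : ∀ (ψ : P1 ⟶ Y) (i : Fin 2), (P1.D i).ι ≫ ψ = localSection P i ≫ φ →
          (P.π ⁻¹ᵁ P1.D i).ι ≫ P.π ≫ ψ = (P.π ⁻¹ᵁ P1.D i).ι ≫ φ := fun ψ i h ↦ by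
        rw [ι_comp_eq_morphismRestrict_comp P hq hφ, ← morphismRestrict_ι_assoc, h]
      exact h1 _ i (𝒰.ι_glueMorphisms _ _ i)

/-- `ψ` is proper because `ℙ¹` is, and it has finite fibres because the image of `η` is not closed.
Pull-back of functions along the surjective `π` to the reduced `ℙ¹` is injective, so bijectivity for
`φ` passes to `ψ`. -/
theorem exists_iso_of_comp_eq (hq : φ ≫ q = P.toSpec)
    (hb : ∀ V : Y.Opens, Function.Bijective (φ.app V).hom)
    {η : P.X} (hη : ¬ IsClosed {φ η}) {ψ : P1 ⟶ Y} (h : P.π ≫ ψ = φ) :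
    ∃ e : Y ≅ P1, φ ≫ e.hom = P.π := by
  have hπ : Function.Surjective P.π := fun y ↦ by
    obtain ⟨i, hi⟩ := P1.exists_mem_D y
    have h1 : ∀ y : (P1.D i : Scheme), P.π (localSection P i y) = (P1.D i).ι y := fun y ↦ by
      rw [← Scheme.Hom.comp_apply, localSection_comp]
    exact ⟨_, h1 ⟨y, hi⟩⟩
  have hψq : ψ ≫ q = P1.toSpec := by
    have hπ' : ∀ i, (P1.D i).ι ≫ ψ ≫ q = (P1.D i).ι ≫ P1.toSpec := fun i ↦ by
      rw [← localSection_comp P i, Category.assoc, Category.assoc, reassoc_of% h, hq,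
        ProjectiveBundle.toSpec]
    exact Scheme.Cover.hom_ext (P1.openCoverOfIsOpenCover P1.D P1.iSup_D) _ _ hπ'
  have : IsProper (ψ ≫ q) := hψq ▸ inferInstance
  have := IsProper.of_comp ψ q
  have hinj : ∀ V : P1.Opens, Function.Injective (P.π.app V).hom := fun V ↦ by
    rw [injective_iff_map_eq_zero]
    intro f hf
    rw [← basicOpen_eq_bot_iff, eq_bot_iff]
    intro y hy
    obtain ⟨x, rfl⟩ := hπ y
    have h1 : x ∈ P.π ⁻¹ᵁ P1.basicOpen f := hy
    rw [Scheme.preimage_basicOpen] at h1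
    have h2 : (P.π.app V) f = 0 := hf
    rw [h2, Scheme.basicOpen_zero] at h1
    exact h1.elim
  have hbij : ∀ V : Y.Opens, Function.Bijective (ψ.app V).hom := fun V ↦ by
    subst h
    have h1 : Function.Bijective ((P.π.app (ψ ⁻¹ᵁ V)).hom ∘ (ψ.app V).hom) := hb V
    exact ⟨h1.1.of_comp, fun f ↦ by
      obtain ⟨g, hg⟩ := h1.2 ((P.π.app (ψ ⁻¹ᵁ V)).hom f)
      exact ⟨g, hinj _ hg⟩⟩
  have hfin := P1.finite_preimage ψ ψ.isClosedMap fun hc ↦ by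
    have h1 := ((genericPoint_specializes (P.π η)).map ψ.continuous).mem_closed hc rfl
    rw [← Scheme.Hom.comp_apply, h] at h1
    exact hη (by rw [h1]; exact hc)
  have := isIso_of_isProper_of_finite_preimage ψ hfin hbij
  exact ⟨(asIso ψ).symm, by rw [← h]; simp⟩

end Chart

end ProjBundle

/-! ### The bound on the twists and the two remaining bundles -/

namespace ProjBundle

/-- If the sum were at least two, all lines in the fibres would be contracted but the zero section
would not, which makes `φ` isomorphic to `π`. -/
theorem sum_lt_two_of_isContraction {n : ℕ} {d : Fin n → ℤ} (P : ProjectiveBundle (splitBundle d))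
    [NeZero n] (hd : ∀ k, 0 ≤ d k) (hd0 : d 0 = 0) {K : LineBundle P.X}
    (hK : IsCanonicalBundle P.toSpec K) {R : Set (N1 P.toSpec)}
    (hR : IsExtremalRay (closedConeOfCurves P.toSpec) R) (hneg : ∀ z ∈ R, z ≠ 0 → degree K z < 0)
    {Y : Scheme.{0}} {q : Y ⟶ Spec (.of ℂ)} {φ : P.X ⟶ Y} (hφ : IsContraction P.toSpec R q φ)
    (hne : ¬ ∃ e : Y ≅ P1, φ ≫ e.hom = P.π) : ∑ k, d k < 2 := by
  by_contra! hd2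
  have := hφ.isProper
  obtain ⟨ψ, hψ⟩ := exists_comp_eq P hφ.comp fun i b c hc hc0 ↦
    (hφ.isClosed_iff ⟨chartLine P i 0 b c, isCurve_chartLine P i 0 b hc⟩).mpr
      (cls_chartLine_mem P hd hd0 hd2 hK hR hneg i b hc hc0)
  exact hne (exists_iso_of_comp_eq P hφ.comp hφ.bijective_app (fun h ↦
    cls_zeroSection_notMem P hd0 hd2 hK hneg ((hφ.isClosed_iff ⟨_, isCurve_zeroSection P⟩).mp h)) hψ)

/-- The identity is expressed in two frames by the transition matrix itself, so the compatibility is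
the cocycle condition. -/
theorem isIsomorphic_splitBundle_self {n : ℕ} (d : Fin n → ℤ) :
    (splitBundle d).IsIsomorphic (splitBundle d) := by
  have key : ∀ (i j k l : Fin 2) (W : P1.Opens) (hi : W ≤ P1.D i) (hj : W ≤ P1.D j)
      (hk : W ≤ P1.D k) (hl : W ≤ P1.D l),
      Matrix.GeneralLinearGroup.map (res (le_inf hi hj))
          (P1.diag d i j _ inf_le_left inf_le_right) *
        Matrix.GeneralLinearGroup.map (res (le_inf hj hl))
          (P1.diag d j l _ inf_le_left inf_le_right) =
      Matrix.GeneralLinearGroup.map (res (le_inf hi hk))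
          (P1.diag d i k _ inf_le_left inf_le_right) *
        Matrix.GeneralLinearGroup.map (res (le_inf hk hl))
          (P1.diag d k l _ inf_le_left inf_le_right) := fun i j k l W hi hj hk hl ↦ by
    simp only [P1.map_diag]
    rw [← P1.diag_mul, ← P1.diag_mul]
  exact ⟨fun i k ↦ P1.diag d i k _ inf_le_left inf_le_right, key⟩

/-- By monotonicity an earlier positive entry would make the last one positive too, and the sum at
least two; so only the last entry can be nonzero, and it is at most one. -/
theorem eq_zero_or_eq_snoc_of_monotone {r : ℕ} {a : Fin r → ℕ} (ha : Monotone a)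
    (h : ∑ i, a i < 2) :
    (Fin.cons 0 fun i ↦ (a i : ℤ) : Fin (r + 1) → ℤ) = (fun _ ↦ 0) ∨
      (Fin.cons 0 fun i ↦ (a i : ℤ) : Fin (r + 1) → ℤ) =
        (Fin.snoc (fun _ : Fin r ↦ 0) 1 : Fin (r + 1) → ℤ) := by
  cases r with
  | zero => left; funext k; rw [Fin.eq_zero k]; rfl
  | succ r =>
    rw [Fin.sum_univ_castSucc] at h
    have h1 : ∀ i : Fin r, a i.castSucc = 0 := fun i ↦ by
      have h2 := Finset.single_le_sum (f := fun i : Fin r ↦ a i.castSucc) (fun _ _ ↦ Nat.zero_le _)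
        (Finset.mem_univ i)
      have h3 : a i.castSucc ≤ a (Fin.last r) := ha (Fin.le_last _)
      have h2 : a i.castSucc ≤ ∑ i : Fin r, a i.castSucc := h2
      omega
    simp only [h1, Finset.sum_const_zero, zero_add] at h
    have e : a = Fin.snoc (fun _ : Fin r ↦ 0) (a (Fin.last r)) := by
      funext i
      refine Fin.lastCases ?_ (fun i ↦ ?_) i
      · simp
      · simp [h1]
    have e' : (Fin.cons 0 fun i ↦ (a i : ℤ) : Fin (r + 1 + 1) → ℤ) =
        Fin.snoc (fun _ : Fin (r + 1) ↦ 0) (a (Fin.last r) : ℤ) := by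
      funext i
      refine Fin.lastCases ?_ (fun i ↦ ?_) i
      · rw [Fin.snoc_last, ← Fin.succ_last, Fin.cons_succ]
      · rw [Fin.snoc_castSucc]
        refine Fin.cases ?_ (fun i ↦ ?_) i
        · rfl
        · rw [← Fin.succ_castSucc, Fin.cons_succ, h1]; rfl
    rw [e']
    interval_cases a (Fin.last r)
    · left
      funext i
      refine Fin.lastCases ?_ (fun i ↦ ?_) i
      · simp
      · simp
    · right; rfl

end ProjBundle

end

open ProjBundle

theorem proposition3p1 (r : ℕ) (a : Fin r → ℕ) (ha : Monotone a)
    (P : ProjectiveBundle (splitBundle (Fin.cons 0 fun i ↦ (a i : ℤ) : Fin (r + 1) → ℤ)))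
    (K : LineBundle P.X) (hK : IsCanonicalBundle P.toSpec K)
    (R : Set (N1 P.toSpec)) (hR : IsExtremalRay (closedConeOfCurves P.toSpec) R)
    (hneg : ∀ z ∈ R, z ≠ 0 → degree K z < 0)
    (Y : Scheme.{0}) (q : Y ⟶ Spec (.of ℂ)) (φ : P.X ⟶ Y)
    (hφ : IsContraction P.toSpec R q φ)
    (hne : ¬ ∃ e : Y ≅ P1, φ ≫ e.hom = P.π) :
    (splitBundle (Fin.cons 0 fun i ↦ (a i : ℤ) : Fin (r + 1) → ℤ)).IsIsomorphic
        (splitBundle fun _ : Fin (r + 1) ↦ 0) ∨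
      (splitBundle (Fin.cons 0 fun i ↦ (a i : ℤ) : Fin (r + 1) → ℤ)).IsIsomorphic
        (splitBundle (Fin.snoc (fun _ : Fin r ↦ 0) 1 : Fin (r + 1) → ℤ)) := by
  have h := sum_lt_two_of_isContraction P (fun k ↦ Fin.cases le_rfl (fun i ↦ Int.natCast_nonneg _) k)
    rfl hK hR hneg hφ hne
  rw [Fin.sum_univ_succ] at h
  simp only [Fin.cons_zero, Fin.cons_succ, zero_add] at h
  refine (eq_zero_or_eq_snoc_of_monotone ha (by exact_mod_cast h)).imp (fun e ↦ ?_) fun e ↦ ?_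
  · rw [e]; exact isIsomorphic_splitBundle_self _
  · rw [e]; exact isIsomorphic_splitBundle_self _
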